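/- Let $d\ge 1$, let $2d/3<\beta\le d$, and let $X=(X_t)_{t\ge 0}$, $X_0=0$, be a nondegenerate symmetric stable process of index $\beta$ in $\mathbb{R}^d$, i.e. a (c\`adl\`ag) process with stationary independent increments and $E\,e^{i\lambda\cdot X_t}=e^{-t\psi(\lambda)}$, where $\psi$ is continuous, even, positively homogeneous of degree $\beta$ ($\psi(r\lambda)=r^\beta\psi(\lambda)$ for $r\ge 0$), and $c|\lambda|^\beta\le\psi(\lambda)\le C|\lambda|^\beta$ for some constants $0<c<C<\infty$. Let $f$ be a nonnegative, symmetric Schwartz function on $\mathbb{R}^d$ with $\int f\,dx=1$, put $f_\varepsilon(x)=\varepsilon^{-d}f(x/\varepsilon)$ for $\varepsilon>0$, and $$\gamma_{t,\varepsilon}=\int_0^t\int_0^s f_\varepsilon(X_s-X_r)\,dr\,ds-E\Big\{\int_0^t\int_0^s f_\varepsilon(X_s-X_r)\,dr\,ds\Big\}.$$ Then for all sufficiently small $\rho>0$ there is $\theta>0$ such that $$\sup_{\varepsilon,\varepsilon',t>0,\ \varepsilon\neq\varepsilon'}E\exp\left\{\theta\left|\frac{\gamma_{t,\varepsilon}-\gamma_{t,\varepsilon'}}{|\varepsilon-\varepsilon'|^{\rho}\,t^{2-(d+\rho)/\beta}}\right|^{\beta/(d+\rho)}\right\}<\infty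 .$$ Moreover, for every $t\ge 0$ there is a random variable $\gamma_t$ such that, as $\varepsilon\downarrow 0$, $\gamma_{t,\varepsilon}\to\gamma_t$ almost surely and in $L^p$ for every $1\le p<\infty$. -/

import Mathlib

open MeasureTheory ProbabilityTheory Filter Topology
open scoped NNReal ENNReal SchwartzMap

namespace StableSelfIntersection

/-- `ψ` is the characteristic exponent of a nondegenerate symmetric stable law of index `β`
on `ℝᵈ`: continuous, even, positively homogeneous of degree `β`, and comparable to `|p|^β`. -/
structure IsSymmetricStableExponent {d : ℕ} (β : ℝ) (ψ : EuclideanSpace ℝ (Fin d) → ℝ) :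
    Prop where
  continuous : Continuous ψ
  homogeneous : ∀ r : ℝ, 0 ≤ r → ∀ p, ψ (r • p) = r ^ β * ψ p
  even : ∀ p, ψ (-p) = ψ p
  comparable : ∃ c C : ℝ, 0 < c ∧ c < C ∧ ∀ p, c * ‖p‖ ^ β ≤ ψ p ∧ ψ p ≤ C * ‖p‖ ^ β

/-- A path indexed by `[0, ∞)` is right continuous and has left limits. -/
def IsCadlagPath {E : Type*} [TopologicalSpace E] (x : ℝ≥0 → E) : Prop :=
  ∀ t : ℝ≥0, ContinuousWithinAt x (Set.Ici t) t ∧ ∃ l : E, Tendsto x (𝓝[<] t) (𝓝 l)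

/-- `X` is the Lévy process with characteristic exponent `ψ`: it starts at the origin, has
independent and stationary increments with
`E exp (i p · (X (s + t) - X s)) = exp (-t ψ p)`, and its paths are almost surely right
continuous with left limits. -/
structure IsLevyProcessWithExponent {Ω : Type*} [MeasurableSpace Ω] {d : ℕ}
    (ψ : EuclideanSpace ℝ (Fin d) → ℝ) (X : ℝ≥0 → Ω → EuclideanSpace ℝ (Fin d))
    (P : Measure Ω) : Prop where
  measurable : ∀ t, Measurable (X t)
  start : ∀ᵐ ω ∂P, X 0 ω = 0
  indepIncrements : HasIndepIncrements X P
  charFun_increment : ∀ (s t : ℝ≥0) (p : EuclideanSpace ℝ (Fin d)),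
    charFun (P.map (fun ω => X (s + t) ω - X s ω)) p = (Real.exp (-(t * ψ p)) : ℂ)
  cadlag : ∀ᵐ ω ∂P, IsCadlagPath (fun t => X t ω)

/-- The mollifier: a nonnegative, symmetric Schwartz function of integral one. -/
structure IsMollifier {d : ℕ} (f : 𝓢(EuclideanSpace ℝ (Fin d), ℝ)) : Prop where
  nonneg : ∀ x, 0 ≤ f x
  symm : ∀ x, f (-x) = f x
  integral_eq_one : ∫ x, f x = 1

/-- The rescaled function `f_ε(x) = ε⁻ᵈ f(x / ε)`. -/
noncomputable def rescale {d : ℕ} (f : EuclideanSpace ℝ (Fin d) → ℝ) (ε : ℝ)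
    (x : EuclideanSpace ℝ (Fin d)) : ℝ :=
  f (ε⁻¹ • x) / ε ^ d

/-- The regularized self-intersection local time `∫₀ᵗ ∫₀ˢ f_ε(X_s - X_r) dr ds`. -/
noncomputable def selfIntersection {Ω : Type*} {d : ℕ} (f : EuclideanSpace ℝ (Fin d) → ℝ)
    (X : ℝ≥0 → Ω → EuclideanSpace ℝ (Fin d)) (t ε : ℝ) (ω : Ω) : ℝ :=
  ∫ s in (0 : ℝ)..t, ∫ r in (0 : ℝ)..s, rescale f ε (X s.toNNReal ω - X r.toNNReal ω)

/-- The centred version `γ_{t,ε}`. -/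
noncomputable def gammaReg {Ω : Type*} [MeasurableSpace Ω] {d : ℕ}
    (f : EuclideanSpace ℝ (Fin d) → ℝ) (X : ℝ≥0 → Ω → EuclideanSpace ℝ (Fin d))
    (P : Measure Ω) (t ε : ℝ) (ω : Ω) : ℝ :=
  selfIntersection f X t ε ω - ∫ ω', selfIntersection f X t ε ω' ∂P

end StableSelfIntersection

/-! Put a = (d + ρ)/β and h = f_ε − f_ε'. The Fourier transform of f is bounded and Lipschitz, hence
ρ-Hölder, so h is a superposition of plane waves with amplitude at most B|ε − ε'|^ρ |p|^ρ
(`exists_rescale_sub_amplitude`). Everything rests on bounding the 2k-th moment of the centred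
integral of h(X_s − X_r) over the triangle 0 ≤ r ≤ s ≤ t by the 2k-th power of a multiple of |ε −
ε'|^ρ t^(2−a), times (2k)!^a.

The triangle is cut dyadically into squares, 2^n of side t/2^(n+1) at level n (`triangle_eq_sum`). A
square with corner at time m pairs the path before m with the path after m; seen from X_m these are
independent, so in Fourier variables the n-th moment of a square factors into expectations of two
products of occupation integrals. Ordering the times in each product and using the exponential decay
of the characteristic functions bounds each expectation by e^(λL) times a sum over orderings of
products of resolvents 1/(λ + c|·|^β) at partial sums of the momenta
(`enorm_integral_prod_occupation_le`). The square of this sum is integrated one momentum at a time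
by Cauchy–Schwarz (`lintegral_prod_mul_chainSum_sq_le`, `lintegral_resolvent_le`), which gives n!^2
λ^(n(a−2)) up to a power C^n. Taking λ = n/L yields (C L^(2−a))^n n!^a
(`IsRegularProcess.exists_abs_integral_crossTerm_pow_le`).

The squares of one level are independent, so after centring a sum of N of them costs √N rather than
N (`abs_integral_sum_pow_le`). Level n then contributes of order t^(2−a) 2^(−n(2−a)) 2^(n/2), a
convergent geometric series because a < 3/2; this is where β > 2d/3 enters, while β ≤ d ensures a ≥
1. The small triangles left on the diagonal vanish in the limit because h is bounded
(`exists_eLpNorm_triangle_le`).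

Moments of size (2k)!^a make the exponential of a small multiple of the power 1/a integrable
(`lintegral_exp_rpow_le_two`). The same bounds are Hölder estimates in ε in every L^(2k). They give
convergence in L^p, and almost surely along a polynomial grid by summability of moments; between
grid points the smoothness of ε ↦ f_ε controls the oscillation for every path
(`exists_limit_of_holder`). -/

namespace StableSelfIntersection

/-! ### Time-ordered integrals and chains of resolvents -/

section Chain

variable {E : Type*} [NormedAddCommGroup E]

/-- The sum over all orderings of the coordinates of `p` of the products of `κ` evaluated at the
successive partial sums. -/
noncomputable def chainSum (κ : E → ℝ≥0∞) : (n : ℕ) → (Fin n → E) → ℝ≥0∞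
  | 0, _ => 1
  | n + 1, p => ∑ j : Fin (n + 1), κ (∑ i, p i) * chainSum κ n (fun i => p (j.succAbove i))

lemma measurable_chainSum [MeasurableSpace E] [BorelSpace E] [SecondCountableTopology E]
    {κ : E → ℝ≥0∞} (hκ : Measurable κ) (n : ℕ) : Measurable (chainSum κ n) := by
  induction n with
  | zero => exact measurable_const
  | succ n ih =>
    refine Finset.measurable_fun_sum _ fun j _ => Measurable.mul ?_ ?_
    · exact hκ.comp (Finset.measurable_sum _ fun i _ => measurable_pi_apply i)
    · exact ih.comp (measurable_pi_lambda _ fun i => measurable_pi_apply _)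

lemma lintegral_exp_Icc_le {m τ T : ℝ} (hm : 0 < m) :
    ∫⁻ x in Set.Icc τ T, ENNReal.ofReal (Real.exp (-(x - τ) * m)) ≤ (ENNReal.ofReal m)⁻¹ := by
  calc ∫⁻ x in Set.Icc τ T, ENNReal.ofReal (Real.exp (-(x - τ) * m))
      ≤ ∫⁻ x in Set.Ici τ, ENNReal.ofReal (Real.exp (-(x - τ) * m)) :=
        lintegral_mono_set Set.Icc_subset_Ici_self
    _ = ∫⁻ x in Set.Ioi τ, ENNReal.ofReal (Real.exp (-(x - τ) * m)) := by
        rw [Measure.restrict_congr_set Ioi_ae_eq_Ici]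
    _ = ∫⁻ x in Set.Ioi τ, ENNReal.ofReal (Real.exp (τ * m) * Real.exp (-m * x)) := by
        congr 1 with x; rw [← Real.exp_add]; congr 2; ring
    _ = ENNReal.ofReal (∫ x in Set.Ioi τ, Real.exp (τ * m) * Real.exp (-m * x)) := by
        rw [ofReal_integral_eq_lintegral_ofReal]
        · exact (integrableOn_exp_mul_Ioi (by linarith) τ).const_mul _
        · exact ae_of_all _ fun x => by positivity
    _ = ENNReal.ofReal m⁻¹ := by
        rw [integral_const_mul, integral_exp_mul_Ioi (by linarith)]
        congr 1
        rw [neg_div_neg_eq, mul_div_assoc', ← Real.exp_add]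
        rw [show τ * m + -m * τ = 0 by ring, Real.exp_zero, one_div]
    _ = (ENNReal.ofReal m)⁻¹ := ENNReal.ofReal_inv_of_pos hm
    _ ≤ _ := le_rfl

/-- Integral over a cube of a function that loses an exponential factor each time its smallest
coordinate is removed. -/
lemma lintegral_cube_le_chainSum {g : E → ℝ} (hg : ∀ q, 0 ≤ g q) {lam τ₀ T : ℝ} (hlam : 0 < lam)
    (φ : ∀ n : ℕ, ℝ → (Fin n → ℝ) → (Fin n → E) → ℝ≥0∞)
    (h0 : ∀ τ s p, φ 0 τ s p ≤ 1)
    (hstep : ∀ n τ s p j, τ₀ ≤ τ → τ ≤ s j → (∀ i, s j ≤ s i) → (∀ i, s i ≤ T) →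
      φ (n + 1) τ s p ≤ ENNReal.ofReal (Real.exp (-(s j - τ) * g (∑ i, p i))) *
        φ n (s j) (fun i => s (j.succAbove i)) (fun i => p (j.succAbove i)))
    (n : ℕ) (τ : ℝ) (hτ : τ₀ ≤ τ) (hτT : τ ≤ T) (p : Fin n → E) :
    ∫⁻ s in Set.univ.pi (fun _ : Fin n => Set.Icc τ T), φ n τ s p ≤
      ENNReal.ofReal (Real.exp (lam * (T - τ))) *
        chainSum (fun q => (ENNReal.ofReal (lam + g q))⁻¹) n p := by
  induction n generalizing τ with
  | zero =>
    have h1 : (1 : ℝ≥0∞) ≤ ENNReal.ofReal (Real.exp (lam * (T - τ))) := by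
      rw [← ENNReal.ofReal_one]
      exact ENNReal.ofReal_le_ofReal (Real.one_le_exp (mul_nonneg hlam.le (by linarith)))
    calc ∫⁻ s in Set.univ.pi (fun _ : Fin 0 => Set.Icc τ T), φ 0 τ s p
        ≤ ∫⁻ s : Fin 0 → ℝ, 1 := (setLIntegral_le_lintegral _ _).trans (lintegral_mono (h0 τ · p))
      _ = 1 := by simp [volume_pi]
      _ ≤ _ := by simpa [chainSum] using h1
  | succ n ih =>
    set κ : E → ℝ≥0∞ := fun q => (ENNReal.ofReal (lam + g q))⁻¹ with hκ
    set q := ∑ i, p i with hq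
    set cube : Set (Fin (n + 1) → ℝ) := Set.univ.pi (fun _ => Set.Icc τ T) with hcube
    -- The pieces record which coordinate is smallest. Ties make them overlap, which is harmless for
    -- an upper bound.
    let A : Fin (n + 1) → Set (Fin (n + 1) → ℝ) := fun j => cube ∩ ⋂ i, {s | s j ≤ s i}
    have hcov : cube ⊆ ⋃ j, A j := by
      intro s hs
      obtain ⟨j, hj⟩ := Finite.exists_min s
      exact Set.mem_iUnion.2 ⟨j, hs, Set.mem_iInter.2 hj⟩
    have hAmeas : ∀ j, MeasurableSet (A j) := fun j =>
      (MeasurableSet.univ_pi fun _ => measurableSet_Icc).inter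
        (MeasurableSet.iInter fun i => measurableSet_le (measurable_pi_apply j)
          (measurable_pi_apply i))
    -- On `A j` the other coordinates lie in `[s j, T]`. Writing this with indicators separates `s
    -- j` from the rest, and the inequality `lintegral_prod_le` then avoids any measurability
    -- assumption on `φ`.
    let H : Fin (n + 1) → ℝ → (Fin n → ℝ) → ℝ≥0∞ := fun j x s' =>
      (Set.Icc τ T).indicator (fun x => ENNReal.ofReal (Real.exp (-(x - τ) * g q)) *
        (Set.univ.pi (fun _ : Fin n => Set.Icc x T)).indicator
          (fun s' => φ n x s' (fun i => p (j.succAbove i))) s') x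
    have key : ∀ j, ∫⁻ s in A j, φ (n + 1) τ s p ≤
        ENNReal.ofReal (Real.exp (lam * (T - τ))) *
          (κ q * chainSum κ n (fun i => p (j.succAbove i))) := by
      intro j
      set p' : Fin n → E := fun i => p (j.succAbove i)
      have e := volume_preserving_piFinSuccAbove (fun _ : Fin (n + 1) => ℝ) j
      calc ∫⁻ s in A j, φ (n + 1) τ s p
          ≤ ∫⁻ s : Fin (n + 1) → ℝ in A j, H j (s j) (fun i => s (j.succAbove i)) := by
            refine setLIntegral_mono' (hAmeas j) fun s hs => ?_
            obtain ⟨hs1, hs2⟩ := hs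
            have hs3 : ∀ i, s i ∈ Set.Icc τ T := fun i => hs1 i (Set.mem_univ i)
            have hs4 : ∀ i, s j ≤ s i := fun i => Set.mem_iInter.1 hs2 i
            simp only [H]
            rw [Set.indicator_of_mem (hs3 j), Set.indicator_of_mem]
            · exact hstep n τ s p j hτ (hs3 j).1 hs4 (fun i => (hs3 i).2)
            · exact fun i _ => ⟨hs4 _, (hs3 _).2⟩
        _ ≤ ∫⁻ s : Fin (n + 1) → ℝ, H j (s j) (fun i => s (j.succAbove i)) := setLIntegral_le_lintegral _ _
        _ = ∫⁻ z : ℝ × (Fin n → ℝ), H j z.1 z.2 :=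
            e.lintegral_comp_emb (MeasurableEquiv.measurableEmbedding _)
              (fun z : ℝ × (Fin n → ℝ) => H j z.1 z.2)
        _ ≤ ∫⁻ x, ∫⁻ s', H j x s' := lintegral_prod_le _
        _ ≤ ∫⁻ x in Set.Icc τ T, ENNReal.ofReal (Real.exp (lam * (T - τ))) * chainSum κ n p' *
              ENNReal.ofReal (Real.exp (-(x - τ) * (lam + g q))) := by
            rw [← lintegral_indicator measurableSet_Icc]
            refine lintegral_mono fun x => ?_
            by_cases hx : x ∈ Set.Icc τ T
            · simp only [H, Set.indicator_of_mem hx]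
              rw [lintegral_const_mul' _ _ ENNReal.ofReal_ne_top,
                lintegral_indicator (MeasurableSet.univ_pi fun _ => measurableSet_Icc)]
              -- The factor exp(lam (T − x)) from the induction splits as exp(lam (T − τ)) exp(−lam
              -- (x − τ)); the second part joins the decay in `g q` and produces the rate `lam + g
              -- q`.
              refine (mul_le_mul_right (ih x (hτ.trans hx.1) hx.2 p') _).trans_eq ?_
              rw [← mul_assoc, ← ENNReal.ofReal_mul (Real.exp_pos _).le, ← Real.exp_add,
                mul_right_comm, ← ENNReal.ofReal_mul (Real.exp_pos _).le, ← Real.exp_add]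
              congr 3
              ring
            · simp [H, Set.indicator_of_notMem hx]
        _ = ENNReal.ofReal (Real.exp (lam * (T - τ))) * chainSum κ n p' *
              ∫⁻ x in Set.Icc τ T, ENNReal.ofReal (Real.exp (-(x - τ) * (lam + g q))) := by
            rw [lintegral_const_mul]
            fun_prop
        _ ≤ ENNReal.ofReal (Real.exp (lam * (T - τ))) * chainSum κ n p' * κ q := by
            gcongr
            exact lintegral_exp_Icc_le (by linarith [hg q])
        _ = _ := by ring
    calc ∫⁻ s in cube, φ (n + 1) τ s p
        ≤ ∫⁻ s in ⋃ j, A j, φ (n + 1) τ s p := lintegral_mono_set hcov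
      _ ≤ ∑' j, ∫⁻ s in A j, φ (n + 1) τ s p := lintegral_iUnion_le _ _
      _ = ∑ j, ∫⁻ s in A j, φ (n + 1) τ s p := tsum_fintype _
      _ ≤ ∑ j, ENNReal.ofReal (Real.exp (lam * (T - τ))) *
          (κ q * chainSum κ n (fun i => p (j.succAbove i))) := Finset.sum_le_sum fun j _ => key j
      _ = _ := by rw [← Finset.mul_sum]; rfl

lemma sq_sum_le_card_mul_sum_sq_ennreal {ι : Type*} (s : Finset ι) (f : ι → ℝ≥0∞) :
    (∑ i ∈ s, f i) ^ 2 ≤ s.card * ∑ i ∈ s, f i ^ 2 := by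
  have h := ENNReal.rpow_sum_le_const_mul_sum_rpow s f (p := 2) (by norm_num)
  norm_num at h
  exact h

/-- `L²` bound for `chainSum` against product weights. -/
lemma lintegral_prod_mul_chainSum_sq_le [MeasurableSpace E] [BorelSpace E]
    [SecondCountableTopology E] (μ : Measure E) [SigmaFinite μ] {v w κ : E → ℝ≥0∞}
    (hv : Measurable v) (hw : Measurable w) (hκ : Measurable κ) {C : ℝ≥0∞}
    (hC : ∀ y, ∫⁻ x, v x * w (x + y) * κ (x + y) ^ 2 ∂μ ≤ C * w y) (n : ℕ) :
    ∫⁻ p, (∏ i, v (p i)) * w (∑ i, p i) * chainSum κ n p ^ 2 ∂(Measure.pi fun _ : Fin n => μ) ≤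
      (n.factorial : ℝ≥0∞) ^ 2 * C ^ n * w 0 := by
  induction n with
  | zero => simp [chainSum]
  | succ n ih =>
    let G : Fin (n + 1) → (Fin (n + 1) → E) → ℝ≥0∞ := fun j p =>
      (∏ i, v (p i)) * w (∑ i, p i) *
        (κ (∑ i, p i) ^ 2 * chainSum κ n (fun i => p (j.succAbove i)) ^ 2)
    have hchain := measurable_chainSum hκ n
    have hsum : ∀ m, Measurable fun p : Fin m → E => ∑ i, p i := fun m =>
      Finset.measurable_sum _ fun i _ => measurable_pi_apply i
    have hGm : ∀ j, Measurable (G j) := fun j => by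
      have h1 : Measurable fun p : Fin (n + 1) → E => ∏ i, v (p i) :=
        Finset.measurable_prod _ fun i _ => hv.comp (measurable_pi_apply i)
      have h2 : Measurable fun p : Fin (n + 1) → E => chainSum κ n (fun i => p (j.succAbove i)) :=
        hchain.comp (measurable_pi_lambda _ fun i => measurable_pi_apply _)
      exact (h1.mul (hw.comp (hsum _))).mul (((hκ.comp (hsum _)).pow_const 2).mul
        (h2.pow_const 2))
    have key : ∀ j, ∫⁻ p, G j p ∂(Measure.pi fun _ => μ) ≤
        C * ((n.factorial : ℝ≥0∞) ^ 2 * C ^ n * w 0) := by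
      intro j
      have e := measurePreserving_piFinSuccAbove (fun _ : Fin (n + 1) => μ) j
      -- The removed momentum is integrated first: it enters only through its own weight and the
      -- total sum, since the shorter chain depends on the other momenta alone. Then `hC` returns
      -- `w` at the sum of the remaining momenta, which is the induction hypothesis.
      let F : E → (Fin n → E) → ℝ≥0∞ := fun x p' =>
        (∏ i, v (p' i)) * chainSum κ n p' ^ 2 *
          (v x * w (x + ∑ i, p' i) * κ (x + ∑ i, p' i) ^ 2)
      have hF : Measurable (Function.uncurry F) := by
        have h1 : Measurable fun z : E × (Fin n → E) => ∏ i, v (z.2 i) :=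
          Finset.measurable_prod _ fun i _ =>
            hv.comp ((measurable_pi_apply i).comp measurable_snd)
        have h2 : Measurable fun z : E × (Fin n → E) => z.1 + ∑ i, z.2 i :=
          measurable_fst.add ((hsum n).comp measurable_snd)
        exact (h1.mul ((hchain.comp measurable_snd).pow_const 2)).mul
          (((hv.comp measurable_fst).mul (hw.comp h2)).mul ((hκ.comp h2).pow_const 2))
      calc ∫⁻ p, G j p ∂(Measure.pi fun _ => μ)
          = ∫⁻ p, F (p j) (fun i => p (j.succAbove i)) ∂(Measure.pi fun _ => μ) := by
            congr 1 with p
            simp only [G, F]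
            rw [Fin.prod_univ_succAbove _ j, Fin.sum_univ_succAbove _ j]
            ring
        _ = ∫⁻ z, Function.uncurry F z ∂(μ.prod (Measure.pi fun _ => μ)) :=
            e.lintegral_comp_emb (MeasurableEquiv.measurableEmbedding _) (Function.uncurry F)
        _ = ∫⁻ p', ∫⁻ x, F x p' ∂μ ∂(Measure.pi fun _ => μ) :=
            lintegral_prod_symm _ hF.aemeasurable
        _ ≤ ∫⁻ p', C * ((∏ i, v (p' i)) * w (∑ i, p' i) * chainSum κ n p' ^ 2)
              ∂(Measure.pi fun _ => μ) := by
            refine lintegral_mono fun p' => ?_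
            have hm : Measurable fun x => v x * w (x + ∑ i, p' i) * κ (x + ∑ i, p' i) ^ 2 :=
              (hv.mul (hw.comp (measurable_id.add_const _))).mul
                ((hκ.comp (measurable_id.add_const _)).pow_const 2)
            simp only [F]
            rw [lintegral_const_mul _ hm]
            refine (mul_le_mul_right (hC _) _).trans_eq ?_
            ring
        _ = C * ∫⁻ p', ((∏ i, v (p' i)) * w (∑ i, p' i) * chainSum κ n p' ^ 2)
              ∂(Measure.pi fun _ => μ) := by
            refine lintegral_const_mul _ ?_
            exact ((Finset.measurable_prod _ fun i _ => hv.comp (measurable_pi_apply i)).mul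
              (hw.comp (hsum _))).mul (hchain.pow_const 2)
        _ ≤ _ := by gcongr
    calc ∫⁻ p, (∏ i, v (p i)) * w (∑ i, p i) * chainSum κ (n + 1) p ^ 2
          ∂(Measure.pi fun _ : Fin (n + 1) => μ)
        ≤ ∫⁻ p, ((n + 1 : ℕ) : ℝ≥0∞) * ∑ j, G j p ∂(Measure.pi fun _ : Fin (n + 1) => μ) := by
          refine lintegral_mono fun p => ?_
          -- Cauchy–Schwarz over the choice of `j` costs `n + 1`, and summing the `n + 1` equal
          -- bounds costs another; hence the square of the factorial.
          have h := sq_sum_le_card_mul_sum_sq_ennreal Finset.univ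
            (fun j : Fin (n + 1) => κ (∑ i, p i) * chainSum κ n (fun i => p (j.succAbove i)))
          rw [Finset.card_univ, Fintype.card_fin] at h
          refine (mul_le_mul_right h _).trans_eq ?_
          simp only [G, mul_pow, ← Finset.mul_sum]
          ring
      _ = ((n + 1 : ℕ) : ℝ≥0∞) * ∑ j, ∫⁻ p, G j p ∂(Measure.pi fun _ : Fin (n + 1) => μ) := by
          rw [lintegral_const_mul _ (Finset.measurable_sum _ fun j _ => hGm j),
            lintegral_finsetSum _ fun j _ => hGm j]
      _ ≤ ((n + 1 : ℕ) : ℝ≥0∞) *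
            ∑ _j : Fin (n + 1), C * ((n.factorial : ℝ≥0∞) ^ 2 * C ^ n * w 0) := by
          gcongr with j; exact key j
      _ = _ := by
          rw [Finset.sum_const, Finset.card_univ, Fintype.card_fin, nsmul_eq_mul,
            Nat.factorial_succ]
          push_cast
          ring

end Chain

/-! ### The one-momentum integral and its scaling -/

section Resolvent

variable {E : Type*} [NormedAddCommGroup E] [NormedSpace ℝ E] [FiniteDimensional ℝ E]
  [MeasurableSpace E] [BorelSpace E]

lemma lintegral_comp_smul_pos (μ : Measure E) [μ.IsAddHaarMeasure] {F : E → ℝ≥0∞}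
    (hF : Measurable F) {r : ℝ} (hr : 0 < r) :
    ∫⁻ x, F x ∂μ = ENNReal.ofReal (r ^ Module.finrank ℝ E) * ∫⁻ x, F (r • x) ∂μ := by
  have h : ∫⁻ x, F (r • x) ∂μ = ∫⁻ x, F x ∂(Measure.map (fun x => r • x) μ) :=
    (lintegral_map hF (measurable_const_smul r)).symm
  rw [h, Measure.map_addHaar_smul _ hr.ne', lintegral_smul_measure, smul_eq_mul, ← mul_assoc,
    abs_of_pos (by positivity), ← ENNReal.ofReal_mul (by positivity),
    mul_inv_cancel₀ (by positivity), ENNReal.ofReal_one, one_mul]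

lemma exists_const_one_add_rpow_le {c β : ℝ} (hc : 0 < c) (hβ : 0 < β) :
    ∃ A : ℝ, 0 < A ∧ ∀ x : ℝ, 0 ≤ x → (1 + x) ^ β ≤ A * (1 + c * x ^ β) := by
  refine ⟨2 ^ β * (1 + c⁻¹), by positivity, fun x hx => ?_⟩
  have h1 : (1 + x) ^ β ≤ 2 ^ β * (1 + x ^ β) := by
    rcases le_total x 1 with h | h
    · calc (1 + x) ^ β ≤ 2 ^ β := by gcongr; linarith
        _ ≤ 2 ^ β * (1 + x ^ β) := le_mul_of_one_le_right (by positivity)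
            (by linarith [Real.rpow_nonneg hx β])
    · calc (1 + x) ^ β ≤ (2 * x) ^ β := by gcongr; linarith
        _ = 2 ^ β * x ^ β := Real.mul_rpow (by norm_num) hx
        _ ≤ 2 ^ β * (1 + x ^ β) := by gcongr; linarith
  refine h1.trans ?_
  rw [mul_assoc]
  gcongr
  have h2 : 0 ≤ x ^ β := Real.rpow_nonneg hx β
  have h3 : (1 + c⁻¹) * (1 + c * x ^ β) = 1 + x ^ β + c⁻¹ + c * x ^ β := by
    field_simp; ring
  rw [h3]
  have := mul_nonneg hc.le h2
  have := inv_pos.2 hc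
  linarith

/-- The integrand is of order (1 + ‖x‖)^(2ρ − 2β), integrable as soon as 2β − 2ρ exceeds the
dimension. This is the source of the condition ρ < β − d/2. -/
lemma lintegral_weight_lt_top (μ : Measure E) [μ.IsAddHaarMeasure] {c β ρ : ℝ} (hc : 0 < c)
    (hβ : 0 < β) (hd : (Module.finrank ℝ E : ℝ) < 2 * β - 2 * ρ) :
    ∫⁻ x : E, (ENNReal.ofReal ((1 + ‖x‖) ^ ρ) ^ 2 *
      (ENNReal.ofReal (1 + c * ‖x‖ ^ β))⁻¹ ^ 2) ∂μ < ∞ := by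
  obtain ⟨A, hA, hle⟩ := exists_const_one_add_rpow_le hc hβ
  calc ∫⁻ x : E, (ENNReal.ofReal ((1 + ‖x‖) ^ ρ) ^ 2 *
        (ENNReal.ofReal (1 + c * ‖x‖ ^ β))⁻¹ ^ 2) ∂μ
      ≤ ∫⁻ x : E, ENNReal.ofReal (A ^ 2) *
          ENNReal.ofReal ((1 + ‖x‖) ^ (-(2 * β - 2 * ρ))) ∂μ := by
        refine lintegral_mono fun x => ?_
        have h1 : 0 < 1 + c * ‖x‖ ^ β := by positivity
        have h2 : 0 < 1 + ‖x‖ := by positivity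
        rw [← ENNReal.ofReal_inv_of_pos h1, ← ENNReal.ofReal_pow (by positivity),
          ← ENNReal.ofReal_pow (by positivity), ← ENNReal.ofReal_mul (by positivity),
          ← ENNReal.ofReal_mul (by positivity)]
        refine ENNReal.ofReal_le_ofReal ?_
        rw [show -(2 * β - 2 * ρ) = ρ * (2 : ℕ) + -(β * (2 : ℕ)) by push_cast; ring,
          Real.rpow_add h2, Real.rpow_neg h2.le, Real.rpow_mul_natCast h2.le,
          Real.rpow_mul_natCast h2.le, mul_left_comm]
        gcongr
        rw [← inv_pow, ← mul_pow]
        gcongr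
        rw [← div_eq_mul_inv, le_div_iff₀ (by positivity), ← div_eq_inv_mul,
          div_le_iff₀ h1]
        exact hle _ (norm_nonneg x)
    _ = ENNReal.ofReal (A ^ 2) * ∫⁻ x : E, ENNReal.ofReal ((1 + ‖x‖) ^ (-(2 * β - 2 * ρ))) ∂μ :=
        lintegral_const_mul' _ _ ENNReal.ofReal_ne_top
    _ < ∞ := ENNReal.mul_lt_top ENNReal.ofReal_lt_top (finite_integral_one_add_norm hd)

/-- The one-variable estimate behind the moment bound, with its exact scaling in `lam`. -/
lemma lintegral_resolvent_le (μ : Measure E) [μ.IsAddHaarMeasure] {c β ρ lam : ℝ} (hc : 0 < c)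
    (hβ : 0 < β) (hρ : 0 < ρ) (hlam : 0 < lam) (y : E) :
    ∫⁻ x : E, ENNReal.ofReal (‖x‖ ^ ρ) *
        ENNReal.ofReal ((1 + lam ^ (-(1 / β)) * ‖x + y‖) ^ ρ) *
        (ENNReal.ofReal (lam + c * ‖x + y‖ ^ β))⁻¹ ^ 2 ∂μ ≤
      ENNReal.ofReal (lam ^ ((Module.finrank ℝ E + ρ) / β - 2)) *
        (∫⁻ x : E, (ENNReal.ofReal ((1 + ‖x‖) ^ ρ) ^ 2 *
          (ENNReal.ofReal (1 + c * ‖x‖ ^ β))⁻¹ ^ 2) ∂μ) *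
        ENNReal.ofReal ((1 + lam ^ (-(1 / β)) * ‖y‖) ^ ρ) := by
  -- δ is the momentum scale at which ‖x‖^β equals `lam`; the substitution x ↦ δx extracts all
  -- dependence on `lam`.
  set δ : ℝ := lam ^ (1 / β) with hδ
  have hδ0 : 0 < δ := by positivity
  have hδinv : lam ^ (-(1 / β)) = δ⁻¹ := Real.rpow_neg hlam.le _
  have hδβ : δ ^ β = lam := by
    rw [hδ, ← Real.rpow_mul hlam.le, one_div_mul_cancel hβ.ne', Real.rpow_one]
  rw [hδinv]
  let w : E → ℝ≥0∞ := fun x => ENNReal.ofReal ((1 + δ⁻¹ * ‖x‖) ^ ρ)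
  let κ : E → ℝ≥0∞ := fun x => (ENNReal.ofReal (lam + c * ‖x‖ ^ β))⁻¹
  have hwm : Measurable w := by
    have : Measurable fun x : E => (1 + δ⁻¹ * ‖x‖) ^ ρ := by fun_prop
    exact this.ennreal_ofReal
  have hκm : Measurable κ := by
    have : Measurable fun x : E => lam + c * ‖x‖ ^ β := by fun_prop
    exact this.ennreal_ofReal.inv
  -- This is why the weight has this form: ‖x‖ ≤ ‖x + y‖ + ‖y‖ ≤ δ(1 + ‖y‖/δ)(1 + ‖x + y‖/δ) trades
  -- a power of the single momentum for weights at the two consecutive partial sums, so the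
  -- recursion reproduces `w y`.
  have hwy : ∀ x, ENNReal.ofReal (‖x‖ ^ ρ) ≤ ENNReal.ofReal (δ ^ ρ) * w y * w (x + y) := by
    intro x
    simp only [w]
    rw [← ENNReal.ofReal_mul (by positivity), ← ENNReal.ofReal_mul (by positivity)]
    refine ENNReal.ofReal_le_ofReal ?_
    rw [← Real.mul_rpow (by positivity) (by positivity),
      ← Real.mul_rpow (by positivity) (by positivity)]
    refine Real.rpow_le_rpow (norm_nonneg _) ?_ hρ.le
    have h1 : ‖x‖ ≤ ‖x + y‖ + ‖y‖ := by simpa using norm_sub_le (x + y) y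
    have h2 : δ * (1 + δ⁻¹ * ‖y‖) * (1 + δ⁻¹ * ‖x + y‖) =
        δ + ‖x + y‖ + ‖y‖ + δ⁻¹ * ‖y‖ * ‖x + y‖ := by field_simp; ring
    rw [h2]
    have : 0 ≤ δ⁻¹ * ‖y‖ * ‖x + y‖ := by positivity
    linarith
  calc ∫⁻ x : E, ENNReal.ofReal (‖x‖ ^ ρ) * w (x + y) * κ (x + y) ^ 2 ∂μ
      ≤ ∫⁻ x : E, ENNReal.ofReal (δ ^ ρ) * w y * (w (x + y) ^ 2 * κ (x + y) ^ 2) ∂μ := by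
        refine lintegral_mono fun x => ?_
        calc _ ≤ ENNReal.ofReal (δ ^ ρ) * w y * w (x + y) * w (x + y) * κ (x + y) ^ 2 := by
              gcongr; exact hwy x
          _ = _ := by ring
    _ = ENNReal.ofReal (δ ^ ρ) * w y * ∫⁻ x : E, w (x + y) ^ 2 * κ (x + y) ^ 2 ∂μ := by
        refine lintegral_const_mul _ ?_
        exact ((hwm.comp (measurable_id.add_const y)).pow_const 2).mul
          ((hκm.comp (measurable_id.add_const y)).pow_const 2)
    _ = ENNReal.ofReal (δ ^ ρ) * w y * ∫⁻ x : E, w x ^ 2 * κ x ^ 2 ∂μ := by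
        rw [lintegral_add_right_eq_self (fun x => w x ^ 2 * κ x ^ 2) y]
    _ = ENNReal.ofReal (δ ^ ρ) * w y * (ENNReal.ofReal (δ ^ Module.finrank ℝ E) *
          ∫⁻ x : E, w (δ • x) ^ 2 * κ (δ • x) ^ 2 ∂μ) := by
        rw [lintegral_comp_smul_pos μ (F := fun x => w x ^ 2 * κ x ^ 2)
          ((hwm.pow_const 2).mul (hκm.pow_const 2)) hδ0]
    _ = ENNReal.ofReal (δ ^ ρ) * w y * (ENNReal.ofReal (δ ^ Module.finrank ℝ E) *
          ∫⁻ x : E, ENNReal.ofReal (lam ^ (-2 : ℝ)) * (ENNReal.ofReal ((1 + ‖x‖) ^ ρ) ^ 2 *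
          (ENNReal.ofReal (1 + c * ‖x‖ ^ β))⁻¹ ^ 2) ∂μ) := by
        congr 3 with x
        have h1 : w (δ • x) = ENNReal.ofReal ((1 + ‖x‖) ^ ρ) := by
          simp only [w]
          rw [norm_smul, Real.norm_of_nonneg hδ0.le, inv_mul_cancel_left₀ hδ0.ne']
        have h2 : κ (δ • x) = ENNReal.ofReal lam⁻¹ * (ENNReal.ofReal (1 + c * ‖x‖ ^ β))⁻¹ := by
          simp only [κ]
          rw [norm_smul, Real.norm_of_nonneg hδ0.le, Real.mul_rpow hδ0.le (norm_nonneg x), hδβ,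
            ← ENNReal.ofReal_inv_of_pos (by positivity),
            ← ENNReal.ofReal_inv_of_pos (by positivity), ← ENNReal.ofReal_mul (by positivity),
            ← mul_inv]
          congr 2
          ring
        rw [h1, h2, mul_pow, Real.rpow_neg hlam.le, Real.rpow_two, ← inv_pow,
          ENNReal.ofReal_pow (by positivity)]
        ring
    _ = _ := by
        rw [lintegral_const_mul' _ _ ENNReal.ofReal_ne_top]
        have h3 : lam ^ ((Module.finrank ℝ E + ρ) / β - 2) =
            δ ^ ρ * δ ^ Module.finrank ℝ E * lam ^ (-2 : ℝ) := by
          rw [hδ, ← Real.rpow_natCast (lam ^ (1 / β)), ← Real.rpow_mul hlam.le,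
            ← Real.rpow_mul hlam.le, ← Real.rpow_add hlam, ← Real.rpow_add hlam]
          congr 1
          ring
        rw [h3, ENNReal.ofReal_mul (by positivity), ENNReal.ofReal_mul (by positivity)]
        ring

end Resolvent

end StableSelfIntersection

namespace StableSelfIntersection

/-! ### Factorial growth of moments under centring and independent sums -/

section MomentGrowth

/-- The antidiagonals below `M` are disjoint and lie inside the square of side `M`, so truncated
Cauchy products are dominated by products of truncated sums. -/
lemma sum_range_antidiagonal_le {b c : ℕ → ℝ} (hb : ∀ i, 0 ≤ b i) (hc : ∀ i, 0 ≤ c i) (M : ℕ) :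
    ∑ m ∈ Finset.range M, ∑ z ∈ Finset.HasAntidiagonal.antidiagonal m, b z.1 * c z.2 ≤
      (∑ i ∈ Finset.range M, b i) * ∑ j ∈ Finset.range M, c j := by
  rw [Finset.sum_mul_sum, ← Finset.sum_product', ← Finset.sum_biUnion]
  · refine Finset.sum_le_sum_of_subset_of_nonneg ?_ fun z _ _ => mul_nonneg (hb _) (hc _)
    intro z hz
    simp only [Finset.mem_biUnion, Finset.mem_range, Finset.HasAntidiagonal.mem_antidiagonal,
      Finset.mem_product] at hz ⊢
    omega
  · intro m _ m' _ hne
    refine Finset.disjoint_left.2 fun z hz hz' => hne ?_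
    rw [Finset.HasAntidiagonal.mem_antidiagonal] at hz hz'
    omega

/-- Since the binomial coefficient is at least 1 and a ≥ 1, it is bounded by its own a-th power.
Moments divided by m!^a are therefore submultiplicative under convolution. -/
lemma choose_mul_factorial_rpow_le {a : ℝ} (ha : 1 ≤ a) {i j m : ℕ} (h : i + j = m) :
    (m.choose i : ℝ) * ((i.factorial : ℝ) ^ a * (j.factorial : ℝ) ^ a) ≤
      (m.factorial : ℝ) ^ a := by
  subst h
  have h1 : (1 : ℝ) ≤ ((i + j).choose i : ℝ) := by
    exact_mod_cast Nat.choose_pos (Nat.le_add_right i j)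
  have h2 : (((i + j).choose i : ℝ)) * i.factorial * j.factorial = (i + j).factorial := by
    rw [Nat.choose_symm_add]; exact_mod_cast Nat.add_choose_mul_factorial_mul_factorial i j
  rw [← h2, Real.mul_rpow (by positivity) (by positivity),
    Real.mul_rpow (by positivity) (by positivity), mul_assoc]
  gcongr
  exact Real.self_le_rpow_of_one_le h1 ha

/-- Centring removes the linear term, so the deviation from 1 is quadratic in `y`; this is what
later produces √N instead of N. -/
lemma sum_range_geometric_without_one_le {y : ℝ} (hy : 0 ≤ y) (hy2 : y ≤ 1 / 2) (M : ℕ) :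
    ∑ j ∈ Finset.range M, (if j = 1 then 0 else y ^ j) ≤ 1 + 2 * y ^ 2 := by
  have h : ∀ M : ℕ, ∑ j ∈ Finset.range (M + 2), (if j = 1 then 0 else y ^ j) ≤
      1 + 2 * y ^ 2 - 2 * y ^ (M + 2) := by
    intro M
    induction M with
    | zero => simp [Finset.sum_range_succ]
    | succ M ih =>
      rw [Finset.sum_range_succ, if_neg (by omega)]
      have h1 : y ^ (M + 1 + 2) = y ^ (M + 2) * y := by ring
      have h2 : 0 ≤ y ^ (M + 2) := by positivity
      nlinarith
  have h1 : ∑ j ∈ Finset.range M, (if j = 1 then 0 else y ^ j) ≤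
      ∑ j ∈ Finset.range (M + 2), (if j = 1 then 0 else y ^ j) := by
    refine Finset.sum_le_sum_of_subset_of_nonneg (by
      intro x hx; rw [Finset.mem_range] at *; omega) fun j _ _ => ?_
    split_ifs <;> positivity
  have h2 : 0 ≤ 2 * y ^ (M + 2) := by positivity
  linarith [h M]

variable {Ω : Type*} [MeasurableSpace Ω] {P : Measure Ω} [IsProbabilityMeasure P]

lemma integrable_pow_of_bounded {f : Ω → ℝ} (hf : Measurable f) {M : ℝ} (hM : ∀ ω, |f ω| ≤ M)
    (m : ℕ) : Integrable (fun ω => f ω ^ m) P := by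
  refine Integrable.of_bound (hf.pow_const m).aestronglyMeasurable (M ^ m) (ae_of_all _ fun ω => ?_)
  rw [Real.norm_eq_abs, abs_pow]
  exact pow_le_pow_left₀ (abs_nonneg _) (hM ω) m

lemma integral_add_pow_of_indepFun {f g : Ω → ℝ} (hf : Measurable f) (hg : Measurable g)
    {M M' : ℝ} (hM : ∀ ω, |f ω| ≤ M) (hM' : ∀ ω, |g ω| ≤ M') (h : IndepFun f g P) (m : ℕ) :
    ∫ ω, (f ω + g ω) ^ m ∂P = ∑ z ∈ Finset.HasAntidiagonal.antidiagonal m,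
      (m.choose z.1 : ℝ) * ((∫ ω, f ω ^ z.1 ∂P) * ∫ ω, g ω ^ z.2 ∂P) := by
  have h1 : ∀ ω, (f ω + g ω) ^ m = ∑ z ∈ Finset.HasAntidiagonal.antidiagonal m,
      (m.choose z.1 : ℝ) * (f ω ^ z.1 * g ω ^ z.2) := fun ω => by
    rw [(Commute.all (f ω) (g ω)).add_pow']
    simp
  have hind : ∀ i j : ℕ, IndepFun (fun ω => f ω ^ i) (fun ω => g ω ^ j) P := fun i j =>
    h.comp (φ := fun x => x ^ i) (ψ := fun x => x ^ j) (by fun_prop) (by fun_prop)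
  simp_rw [h1]
  rw [integral_finsetSum]
  · refine Finset.sum_congr rfl fun z _ => ?_
    rw [integral_const_mul, (hind z.1 z.2).integral_fun_mul_eq_mul_integral
      (hf.pow_const _).aestronglyMeasurable (hg.pow_const _).aestronglyMeasurable]
  · intro z _
    exact ((hind z.1 z.2).integrable_mul (integrable_pow_of_bounded hf hM _)
      (integrable_pow_of_bounded hg hM' _)).const_mul _

/-- Centering preserves the growth of the moments. -/
lemma abs_integral_centered_pow_le {f : Ω → ℝ} (hf : Measurable f) {M K a : ℝ}
    (hM : ∀ ω, |f ω| ≤ M) (hK : 0 ≤ K) (ha : 1 ≤ a)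
    (hmom : ∀ m : ℕ, |∫ ω, f ω ^ m ∂P| ≤ K ^ m * (m.factorial : ℝ) ^ a) (m : ℕ) :
    |∫ ω, (f ω - ∫ ω', f ω' ∂P) ^ m ∂P| ≤ (2 * K) ^ m * (m.factorial : ℝ) ^ a := by
  set e := ∫ ω', f ω' ∂P with he
  have hek : |e| ≤ K := by simpa using hmom 1
  -- A constant is independent of every variable, so centring is a binomial expansion of `f + (-e)`;
  -- the case m = 1 of the moment bound gives |e| ≤ K.
  have h := integral_add_pow_of_indepFun (P := P) hf (measurable_const (a := -e)) hM
    (fun _ => le_rfl) (indepFun_const_right f (-e)) m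
  simp_rw [sub_eq_add_neg]
  rw [h]
  calc |∑ z ∈ Finset.HasAntidiagonal.antidiagonal m,
        (m.choose z.1 : ℝ) * ((∫ ω, f ω ^ z.1 ∂P) * ∫ ω, (-e) ^ z.2 ∂P)|
      ≤ ∑ z ∈ Finset.HasAntidiagonal.antidiagonal m,
        |(m.choose z.1 : ℝ) * ((∫ ω, f ω ^ z.1 ∂P) * ∫ ω, (-e) ^ z.2 ∂P)| :=
        Finset.abs_sum_le_sum_abs _ _
    _ ≤ ∑ z ∈ Finset.HasAntidiagonal.antidiagonal m, (m.choose z.1 : ℝ) * (K ^ m * (m.factorial : ℝ) ^ a) := by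
        refine Finset.sum_le_sum fun z hz => ?_
        have hz' := Finset.HasAntidiagonal.mem_antidiagonal.1 hz
        rw [abs_mul, abs_mul, Nat.abs_cast, integral_const, probReal_univ, one_smul, abs_pow,
          abs_neg]
        refine mul_le_mul_of_nonneg_left ?_ (by positivity)
        calc |∫ ω, f ω ^ z.1 ∂P| * |e| ^ z.2
            ≤ K ^ z.1 * (z.1.factorial : ℝ) ^ a * K ^ z.2 := by gcongr; exact hmom _
          _ = K ^ m * (z.1.factorial : ℝ) ^ a := by rw [← hz', pow_add]; ring
          _ ≤ K ^ m * (m.factorial : ℝ) ^ a := by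
            gcongr; omega
    _ = (2 * K) ^ m * (m.factorial : ℝ) ^ a := by
        rw [← Finset.sum_mul, mul_pow, Finset.Nat.sum_antidiagonal_eq_sum_range_succ_mk]
        have : (∑ k ∈ Finset.range m.succ, (m.choose k : ℝ)) = 2 ^ m := by
          exact_mod_cast Nat.sum_range_choose m
        rw [this]; ring

/-- Moments of a sum of independent centered variables grow like those of the summands, with the
square root of the number of summands as factor. -/
lemma abs_integral_sum_pow_le {Y : ℕ → Ω → ℝ} (hY : ∀ j, Measurable (Y j)) {M K a : ℝ}
    (hM : ∀ j ω, |Y j ω| ≤ M) (hK : 0 < K) (ha : 1 ≤ a) (hcent : ∀ j, ∫ ω, Y j ω ∂P = 0)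
    (hmom : ∀ j, ∀ m : ℕ, |∫ ω, Y j ω ^ m ∂P| ≤ K ^ m * (m.factorial : ℝ) ^ a)
    {N : ℕ} (hind : ∀ k < N, IndepFun (fun ω => ∑ j ∈ Finset.range k, Y j ω) (Y k) P)
    (hN : 0 < N) (m : ℕ) :
    |∫ ω, (∑ j ∈ Finset.range N, Y j ω) ^ m ∂P| ≤
      2 * (2 * K * √N) ^ m * (m.factorial : ℝ) ^ a := by
  have hNR : (0 : ℝ) < N := by exact_mod_cast hN
  have hsN : 1 ≤ √(N : ℝ) := Real.one_le_sqrt.2 (by exact_mod_cast hN)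
  -- The quantity followed is the sum over m of |E S_k^m| x^m / m!^a with Kx = y. Each centred
  -- summand multiplies it by at most 1 + 2y², and y = 1/(2√N) gives (1 + 2y²)^N = (1 + 1/(2N))^N ≤
  -- e^(1/2) ≤ 2. A single term is at most the sum, and 1/x = 2K√N is the stated growth rate.
  set y : ℝ := (2 * √N)⁻¹ with hy
  have hy0 : 0 < y := by positivity
  have hy2 : y ≤ 1 / 2 := by
    rw [hy, inv_le_comm₀ (by positivity) (by norm_num)]; linarith
  set x : ℝ := y / K with hx
  have hx0 : 0 < x := by positivity
  have hKx : K * x = y := by rw [hx]; field_simp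
  let S : ℕ → Ω → ℝ := fun k ω => ∑ j ∈ Finset.range k, Y j ω
  have hS : ∀ k, Measurable (S k) := fun k => Finset.measurable_fun_sum _ fun j _ => hY j
  have hSb : ∀ k ω, |S k ω| ≤ k * M := fun k ω => by
    refine (Finset.abs_sum_le_sum_abs _ _).trans ?_
    refine (Finset.sum_le_card_nsmul _ _ M fun j _ => hM j ω).trans ?_
    simp
  let b : ℕ → ℕ → ℝ := fun k m => |∫ ω, S k ω ^ m ∂P| * x ^ m / (m.factorial : ℝ) ^ a
  let c : ℕ → ℝ := fun j => if j = 1 then 0 else y ^ j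
  have hb : ∀ k m, 0 ≤ b k m := fun k m => by positivity
  have hc : ∀ j, 0 ≤ c j := fun j => by simp only [c]; split_ifs <;> positivity
  have hYc : ∀ k j, |∫ ω, Y k ω ^ j ∂P| * x ^ j / (j.factorial : ℝ) ^ a ≤ c j := by
    intro k j
    simp only [c]
    split_ifs with hj
    · subst hj; simp [hcent]
    · rw [div_le_iff₀ (by positivity), ← hKx, mul_pow]
      calc |∫ ω, Y k ω ^ j ∂P| * x ^ j ≤ K ^ j * (j.factorial : ℝ) ^ a * x ^ j := by
            gcongr; exact hmom k j
        _ = _ := by ring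
  have hconv : ∀ k < N, ∀ m, b (k + 1) m ≤ ∑ z ∈ Finset.HasAntidiagonal.antidiagonal m, b k z.1 * c z.2 := by
    intro k hk m
    have h1 : ∀ ω, S (k + 1) ω = S k ω + Y k ω := fun ω => Finset.sum_range_succ _ _
    have h2 := integral_add_pow_of_indepFun (hS k) (hY k) (hSb k) (hM k) (hind k hk) m
    simp only [b]
    simp_rw [h1]
    rw [h2, mul_div_assoc]
    refine (mul_le_mul_of_nonneg_right (Finset.abs_sum_le_sum_abs _ _)
      (by positivity)).trans ?_
    rw [Finset.sum_mul]
    refine Finset.sum_le_sum fun z hz => ?_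
    have hz' := Finset.HasAntidiagonal.mem_antidiagonal.1 hz
    refine le_trans ?_ (mul_le_mul_of_nonneg_left (hYc k z.2) (by positivity))
    rw [abs_mul, abs_mul, Nat.abs_cast, ← mul_div_assoc, div_mul_div_comm,
      div_le_div_iff₀ (by positivity) (by positivity)]
    have h3 := choose_mul_factorial_rpow_le ha hz'
    have h4 : x ^ m = x ^ z.1 * x ^ z.2 := by rw [← hz', pow_add]
    rw [h4]
    calc _ = |∫ ω, S k ω ^ z.1 ∂P| * |∫ ω, Y k ω ^ z.2 ∂P| * (x ^ z.1 * x ^ z.2) *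
          ((m.choose z.1 : ℝ) * ((z.1.factorial : ℝ) ^ a * (z.2.factorial : ℝ) ^ a)) := by ring
      _ ≤ |∫ ω, S k ω ^ z.1 ∂P| * |∫ ω, Y k ω ^ z.2 ∂P| * (x ^ z.1 * x ^ z.2) *
          (m.factorial : ℝ) ^ a := by gcongr
      _ = _ := by ring
  have hsum : ∀ k ≤ N, ∀ M', ∑ m ∈ Finset.range M', b k m ≤ (1 + 2 * y ^ 2) ^ k := by
    intro k
    induction k with
    | zero =>
      intro _ M'
      have h0 : ∀ m ∈ Finset.range M', b 0 m ≤ if m = 0 then 1 else 0 := by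
        intro m _
        rcases Nat.eq_zero_or_pos m with rfl | hm
        · simp [b]
        · simp [b, S, hm.ne']
      refine (Finset.sum_le_sum h0).trans ?_
      rw [Finset.sum_ite_eq']
      split_ifs <;> simp
    | succ k ih =>
      intro hk M'
      calc ∑ m ∈ Finset.range M', b (k + 1) m
          ≤ ∑ m ∈ Finset.range M', ∑ z ∈ Finset.HasAntidiagonal.antidiagonal m, b k z.1 * c z.2 :=
            Finset.sum_le_sum fun m _ => hconv k hk m
        _ ≤ (∑ i ∈ Finset.range M', b k i) * ∑ j ∈ Finset.range M', c j :=
            sum_range_antidiagonal_le (hb k) hc M'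
        _ ≤ (1 + 2 * y ^ 2) ^ k * (1 + 2 * y ^ 2) :=
            mul_le_mul (ih (by omega) M') (sum_range_geometric_without_one_le hy0.le hy2 M')
              (Finset.sum_nonneg fun j _ => hc j) (by positivity)
        _ = _ := (pow_succ _ _).symm
  have hfin : (1 + 2 * y ^ 2) ^ N ≤ 2 := by
    have h1 : 2 * y ^ 2 = 1 / 2 / N := by
      rw [hy, inv_pow, mul_pow, Real.sq_sqrt hNR.le]; field_simp
    calc (1 + 2 * y ^ 2) ^ N ≤ Real.exp (1 / 2) := by
          rw [h1]
          calc (1 + 1 / 2 / (N : ℝ)) ^ N ≤ Real.exp (1 / 2 / N) ^ N := by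
                gcongr; rw [add_comm]; exact Real.add_one_le_exp _
            _ = Real.exp (1 / 2) := by rw [← Real.exp_nat_mul]; field_simp
      _ ≤ 2 := by
          have h2 := Real.exp_one_lt_d9
          have h3 : Real.exp (1 / 2) ^ 2 = Real.exp 1 := by
            rw [← Real.exp_nat_mul]; norm_num
          nlinarith [Real.exp_pos (1 / 2)]
  have hbm : b N m ≤ 2 := by
    refine le_trans ?_ ((hsum N le_rfl (m + 1)).trans hfin)
    exact Finset.single_le_sum (f := b N) (fun i _ => hb N i) (Finset.self_mem_range_succ m)
  have h5 : |∫ ω, S N ω ^ m ∂P| * x ^ m ≤ 2 * (m.factorial : ℝ) ^ a :=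
    (div_le_iff₀ (by positivity)).1 hbm
  have h6 : x * (2 * K * √N) = 1 := by rw [hx, hy]; field_simp
  calc |∫ ω, S N ω ^ m ∂P| = |∫ ω, S N ω ^ m ∂P| * x ^ m * (2 * K * √N) ^ m := by
        rw [mul_assoc, ← mul_pow, h6, one_pow, mul_one]
    _ ≤ 2 * (m.factorial : ℝ) ^ a * (2 * K * √N) ^ m := by gcongr
    _ = _ := by ring

end MomentGrowth

end StableSelfIntersection

namespace StableSelfIntersection

/-! ### Joint measurability of right continuous processes -/

section Paths

/-- A right continuous process is jointly measurable. -/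
lemma measurable_uncurry_of_rightContinuous {Ω E : Type*} [MeasurableSpace Ω]
    [TopologicalSpace E] [TopologicalSpace.PseudoMetrizableSpace E] [MeasurableSpace E]
    [BorelSpace E] {Z : ℝ → Ω → E} (hm : ∀ s, Measurable (Z s))
    (hc : ∀ ω s, ContinuousWithinAt (fun u => Z u ω) (Set.Ici s) s) :
    Measurable (Function.uncurry Z) := by
  -- A discretization with countably many values that lies strictly to the right of `s`, at distance
  -- at most 1/(k + 1), so right continuity suffices.
  let a : ℕ → ℝ → ℝ := fun k s => (⌊((k : ℝ) + 1) * s⌋ + 1) / ((k : ℝ) + 1)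
  have ha : ∀ s, Tendsto (fun k => a k s) atTop (𝓝[≥] s) := by
    intro s
    refine tendsto_nhdsWithin_iff.2 ⟨?_, Eventually.of_forall fun k => ?_⟩
    · have h1 : Tendsto (fun k : ℕ => s + 1 / ((k : ℝ) + 1)) atTop (𝓝 (s + 0)) :=
        tendsto_const_nhds.add tendsto_one_div_add_atTop_nhds_zero_nat
      rw [add_zero] at h1
      refine tendsto_of_tendsto_of_tendsto_of_le_of_le tendsto_const_nhds h1 (fun k => ?_)
        fun k => ?_
      · have hk : (0 : ℝ) < (k : ℝ) + 1 := by positivity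
        simp only [a]
        rw [le_div_iff₀ hk, mul_comm]
        exact (Int.lt_floor_add_one _).le
      · have hk : (0 : ℝ) < (k : ℝ) + 1 := by positivity
        simp only [a]
        rw [div_le_iff₀ hk, add_mul s, one_div_mul_cancel hk.ne', mul_comm s]
        gcongr
        exact Int.floor_le _
    · have hk : (0 : ℝ) < (k : ℝ) + 1 := by positivity
      simp only [a, Set.mem_Ici]
      rw [le_div_iff₀ hk, mul_comm]
      exact (Int.lt_floor_add_one _).le
  refine measurable_of_tendsto_metrizable (f := fun k (z : ℝ × Ω) => Z (a k z.1) z.2)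
    (fun k => ?_) (tendsto_pi_nhds.2 fun z => ?_)
  · have h1 : Measurable fun z : ℤ × Ω => Z (((z.1 : ℝ) + 1) / ((k : ℝ) + 1)) z.2 :=
      measurable_from_prod_countable_right fun z => hm (((z : ℝ) + 1) / ((k : ℝ) + 1))
    have h2 : Measurable fun z : ℝ × Ω => ((⌊((k : ℝ) + 1) * z.1⌋ : ℤ), z.2) :=
      (Int.measurable_floor.comp (measurable_fst.const_mul _)).prodMk measurable_snd
    exact h1.comp h2
  · exact (hc z.2 z.1).tendsto.comp (ha z.1)

end Paths

/-! ### Independence of the increments before and after a fixed time -/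

section Increments

/-- Independence of increments is available along monotone sequences of times; a finite set is
placed on one by sorting it and repeating its maximum forever. -/
lemma exists_monotone_range_superset (K : Finset ℝ) (hK : K.Nonempty) :
    ∃ t : ℕ → ℝ, Monotone t ∧ ∀ x ∈ K, ∃ i, t i = x := by
  have hc : 0 < K.card := hK.card_pos
  let e := K.orderEmbOfFin rfl
  refine ⟨fun i => e ⟨min i (K.card - 1), by omega⟩, fun i j hij => ?_, fun x hx => ?_⟩
  · refine e.monotone ?_
    rw [Fin.mk_le_mk]
    omega
  · have : x ∈ Set.range e := by rw [Finset.range_orderEmbOfFin]; exact hx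
    obtain ⟨i, hi⟩ := this
    refine ⟨i, ?_⟩
    rw [← hi]
    exact congrArg e (Fin.ext (by simp only; omega))

variable {Ω : Type*} [mΩ : MeasurableSpace Ω] {P : Measure Ω}
  {E : Type*} [NormedAddCommGroup E] [MeasurableSpace E] [BorelSpace E]
  [SecondCountableTopology E]

/-- The increments of `Z` before time `a`. -/
@[reducible] def past (Z : ℝ → Ω → E) (a : ℝ) : MeasurableSpace Ω :=
  MeasurableSpace.comap (fun ω (u : Set.Iic a) => Z u ω - Z a ω) inferInstance

/-- The increments of `Z` after time `a`. -/
@[reducible] def future (Z : ℝ → Ω → E) (a : ℝ) : MeasurableSpace Ω :=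
  MeasurableSpace.comap (fun ω (u : Set.Ici a) => Z u ω - Z a ω) inferInstance

/-- It suffices to treat finitely many times on each side. Together with `a` they lie on one
monotone sequence; increments to times before `a` and after `a` are then sums over disjoint blocks
of an independent family of consecutive increments. -/
lemma indep_past_future [IsProbabilityMeasure P] {Z : ℝ → Ω → E} (hm : ∀ s, Measurable (Z s))
    (hZ : HasIndepIncrements Z P) (a : ℝ) : Indep (past Z a) (future Z a) P := by
  classical
  have main : IndepFun (fun ω (u : Set.Iic a) => Z u ω - Z a ω)
      (fun ω (u : Set.Ici a) => Z u ω - Z a ω) P := by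
    refine IndepFun.process_indepFun_process (X := fun (u : Set.Iic a) ω => Z u ω - Z a ω)
      (Y := fun (u : Set.Ici a) ω => Z u ω - Z a ω)
      (fun u => (hm u).sub (hm a)) (fun u => (hm u).sub (hm a)) fun I J => ?_
    obtain ⟨t, ht, htK⟩ := exists_monotone_range_superset
      (insert a (I.image Subtype.val ∪ J.image Subtype.val)) (Finset.insert_nonempty _ _)
    obtain ⟨k, hk⟩ := htK a (Finset.mem_insert_self _ _)
    have hI : ∀ u : I, ∃ i ≤ k, t i = u := by
      intro u
      obtain ⟨i, hi⟩ := htK u (Finset.mem_insert_of_mem (Finset.mem_union_left _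
        (Finset.mem_image_of_mem _ u.2)))
      rcases le_total i k with h | h
      · exact ⟨i, h, hi⟩
      · refine ⟨k, le_rfl, le_antisymm ?_ ?_⟩
        · rw [← hi]; exact ht h
        · rw [hk]; exact u.1.2
    have hJ : ∀ u : J, ∃ i, k ≤ i ∧ t i = u := by
      intro u
      obtain ⟨i, hi⟩ := htK u (Finset.mem_insert_of_mem (Finset.mem_union_right _
        (Finset.mem_image_of_mem _ u.2)))
      rcases le_total k i with h | h
      · exact ⟨i, h, hi⟩
      · refine ⟨k, le_rfl, le_antisymm ?_ ?_⟩
        · rw [hk]; exact u.1.2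
        · rw [← hi]; exact ht h
    choose iI hiI htI using hI
    choose iJ hiJ htJ using hJ
    obtain ⟨n, hn⟩ : ∃ n, ∀ u, iJ u ≤ n := ⟨∑ u, iJ u, fun u =>
      Finset.single_le_sum (f := iJ) (fun _ _ => Nat.zero_le _) (Finset.mem_univ u)⟩
    let D : ℕ → Ω → E := fun i ω => Z (t (i + 1)) ω - Z (t i) ω
    have hD : iIndepFun D P := hZ.nat ht
    have hDm : ∀ i, Measurable (D i) := fun i => (hm _).sub (hm _)
    have hST : Disjoint (Finset.range k) (Finset.Ico k n) := by
      refine Finset.disjoint_left.2 fun i hi hi' => ?_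
      rw [Finset.mem_range] at hi
      rw [Finset.mem_Ico] at hi'
      omega
    have h := hD.indepFun_finset _ _ hST hDm
    let φ : (Finset.range k → E) → (I → E) := fun x u =>
      -∑ i, if iI u ≤ i.1 then x i else 0
    let χ : (Finset.Ico k n → E) → (J → E) := fun x u =>
      ∑ i, if i.1 < iJ u then x i else 0
    have hφ : Measurable φ := by
      refine measurable_pi_lambda _ fun u => (Finset.measurable_fun_sum _ fun i _ => ?_).neg
      split_ifs
      · exact measurable_pi_apply i
      · exact measurable_const
    have hχ : Measurable χ := by
      refine measurable_pi_lambda _ fun u => Finset.measurable_fun_sum _ fun i _ => ?_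
      split_ifs
      · exact measurable_pi_apply i
      · exact measurable_const
    have h' := h.comp hφ hχ
    have e1 : (φ ∘ fun ω (i : Finset.range k) => D i ω) =
        fun ω (u : I) => Z u ω - Z a ω := by
      ext ω u
      simp only [φ, Function.comp]
      rw [Finset.sum_coe_sort (Finset.range k) (fun i => if iI u ≤ i then D i ω else 0),
        ← Finset.sum_filter]
      have : (Finset.range k).filter (fun i => iI u ≤ i) = Finset.Ico (iI u) k := by
        ext i; simp [and_comm]
      rw [this, Finset.sum_Ico_sub (fun i => Z (t i) ω) (hiI u), hk, htI, neg_sub]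
    have e2 : (χ ∘ fun ω (i : Finset.Ico k n) => D i ω) =
        fun ω (u : J) => Z u ω - Z a ω := by
      ext ω u
      simp only [χ, Function.comp]
      rw [Finset.sum_coe_sort (Finset.Ico k n) (fun i => if i < iJ u then D i ω else 0),
        ← Finset.sum_filter]
      have : (Finset.Ico k n).filter (fun i => i < iJ u) = Finset.Ico k (iJ u) := by
        ext i
        have := hn u
        simp only [Finset.mem_filter, Finset.mem_Ico]
        omega
      rw [this, Finset.sum_Ico_sub (fun i => Z (t i) ω) (hiJ u), hk, htJ]
    rw [e1, e2] at h'
    exact h'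
  exact main

lemma measurable_past_sub (Z : ℝ → Ω → E) {a u v : ℝ} (hu : u ≤ a) (hv : v ≤ a) :
    Measurable[past Z a] (fun ω => Z u ω - Z v ω) := by
  have h : ∀ w : Set.Iic a, Measurable[past Z a] (fun ω => Z w ω - Z a ω) := fun w =>
    (measurable_pi_apply w).comp (comap_measurable (fun ω (u : Set.Iic a) => Z u ω - Z a ω))
  have h1 := (h ⟨u, hu⟩).sub (h ⟨v, hv⟩)
  have h2 : (fun ω => Z u ω - Z v ω) = (fun ω => Z u ω - Z a ω) - fun ω => Z v ω - Z a ω := by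
    ext ω; simp
  rw [h2]
  exact h1

lemma measurable_future_sub (Z : ℝ → Ω → E) {a u v : ℝ} (hu : a ≤ u) (hv : a ≤ v) :
    Measurable[future Z a] (fun ω => Z u ω - Z v ω) := by
  have h : ∀ w : Set.Ici a, Measurable[future Z a] (fun ω => Z w ω - Z a ω) := fun w =>
    (measurable_pi_apply w).comp (comap_measurable (fun ω (u : Set.Ici a) => Z u ω - Z a ω))
  have h1 := (h ⟨u, hu⟩).sub (h ⟨v, hv⟩)
  have h2 : (fun ω => Z u ω - Z v ω) = (fun ω => Z u ω - Z a ω) - fun ω => Z v ω - Z a ω := by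
    ext ω; simp
  rw [h2]
  exact h1

end Increments

/-! ### Plane waves and moments of occupation integrals -/

section Wave

variable {E : Type*} [NormedAddCommGroup E] [InnerProductSpace ℝ E]

/-- The plane wave `exp (2 π i ⟨p, x⟩)`. -/
noncomputable def wave (p x : E) : ℂ := Complex.exp ((2 * Real.pi * inner ℝ p x : ℝ) * Complex.I)

lemma norm_wave (p x : E) : ‖wave p x‖ = 1 := Complex.norm_exp_ofReal_mul_I _

lemma wave_add_right (p x y : E) : wave p (x + y) = wave p x * wave p y := by
  simp only [wave]
  rw [← Complex.exp_add, inner_add_right]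
  push_cast
  ring_nf

lemma wave_sum_left {ι : Type*} (s : Finset ι) (p : ι → E) (x : E) :
    wave (∑ i ∈ s, p i) x = ∏ i ∈ s, wave (p i) x := by
  simp only [wave]
  rw [← Complex.exp_sum, sum_inner, Finset.mul_sum, Complex.ofReal_sum, Finset.sum_mul]

lemma continuous_wave : Continuous fun z : E × E => wave z.1 z.2 := by
  unfold wave
  fun_prop

variable [MeasurableSpace E] [BorelSpace E] [SecondCountableTopology E]

lemma measurable_wave {α : Type*} [MeasurableSpace α] {f g : α → E} (hf : Measurable f)
    (hg : Measurable g) : Measurable fun x => wave (f x) (g x) :=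
  continuous_wave.measurable.comp (hf.prodMk hg)

variable {Ω : Type*} [mΩ : MeasurableSpace Ω]

/-- On `[τ₀, T]` the process `W` has independent increments whose characteristic functions decay
exponentially with rate `g`. -/
structure HasDecayingIncrements (P : Measure Ω) (g : E → ℝ) (W : ℝ → Ω → E) (τ₀ T : ℝ) :
    Prop where
  measurable : Measurable (Function.uncurry W)
  decay : ∀ τ σ : ℝ, τ₀ ≤ τ → τ ≤ σ → σ ≤ T → ∀ q,
    ‖∫ ω, wave q (W σ ω - W τ ω) ∂P‖ ≤ Real.exp (-(σ - τ) * g q)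
  indep : ∀ (τ σ : ℝ) (n : ℕ) (s : Fin n → ℝ), τ₀ ≤ τ → τ ≤ σ → (∀ i, σ ≤ s i) →
    (∀ i, s i ≤ T) → IndepFun (fun ω => W σ ω - W τ ω) (fun ω i => W (s i) ω - W σ ω) P

/-- The time integral of `wave p` along the increments of `W` from time `τ₀`. -/
noncomputable def occupation (W : ℝ → Ω → E) (τ₀ T : ℝ) (p : E) (ω : Ω) : ℂ :=
  ∫ s in Set.Icc τ₀ T, wave p (W s ω - W τ₀ ω)

variable {P : Measure Ω} [IsProbabilityMeasure P]

lemma norm_occupation_le (W : ℝ → Ω → E) {τ₀ T : ℝ} (h : τ₀ ≤ T) (p : E) (ω : Ω) :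
    ‖occupation W τ₀ T p ω‖ ≤ T - τ₀ := by
  refine (norm_setIntegral_le_of_norm_le_const (by simp) fun s _ =>
    (norm_wave _ _).le).trans ?_
  simp [Measure.real, h]

lemma measurable_occupation {W : ℝ → Ω → E} (hW : Measurable (Function.uncurry W)) (τ₀ T : ℝ) :
    Measurable fun z : E × Ω => occupation W τ₀ T z.1 z.2 := by
  refine (StronglyMeasurable.integral_prod_right
    (f := fun (z : E × Ω) (s : ℝ) => wave z.1 (W s z.2 - W τ₀ z.2))
    (Measurable.stronglyMeasurable ?_)).measurable
  have h1 : Measurable fun y : (E × Ω) × ℝ => W y.2 y.1.2 :=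
    hW.comp (measurable_snd.prodMk (measurable_snd.comp measurable_fst))
  have h2 : Measurable fun y : (E × Ω) × ℝ => W τ₀ y.1.2 :=
    hW.comp (measurable_const.prodMk (measurable_snd.comp measurable_fst))
  exact measurable_wave (measurable_fst.comp measurable_fst) (h1.sub h2)

/-- The joint moments of the occupation integrals are dominated by `chainSum`. -/
lemma enorm_integral_prod_occupation_le {g : E → ℝ} (hg : ∀ q, 0 ≤ g q) {W : ℝ → Ω → E}
    {τ₀ T lam : ℝ} (hτ : τ₀ ≤ T) (hlam : 0 < lam) (hW : HasDecayingIncrements P g W τ₀ T) {n : ℕ}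
    (p : Fin n → E) :
    ‖∫ ω, ∏ i, occupation W τ₀ T (p i) ω ∂P‖ₑ ≤
      ENNReal.ofReal (Real.exp (lam * (T - τ₀))) *
        chainSum (fun q => (ENNReal.ofReal (lam + g q))⁻¹) n p := by
  have hWs : ∀ s, Measurable (W s) := fun s => hW.measurable.comp measurable_prodMk_left
  let φ : ∀ n : ℕ, ℝ → (Fin n → ℝ) → (Fin n → E) → ℝ≥0∞ := fun n τ s p =>
    ‖∫ ω, ∏ i, wave (p i) (W (s i) ω - W τ ω) ∂P‖ₑ
  have h0 : ∀ τ s p, φ 0 τ s p ≤ 1 := fun τ s p => by simp [φ]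
  have hstep : ∀ n τ s p j, τ₀ ≤ τ → τ ≤ s j → (∀ i, s j ≤ s i) → (∀ i, s i ≤ T) →
      φ (n + 1) τ s p ≤ ENNReal.ofReal (Real.exp (-(s j - τ) * g (∑ i, p i))) *
        φ n (s j) (fun i => s (j.succAbove i)) (fun i => p (j.succAbove i)) := by
    intro n τ s p j h1 h2 h3 h4
    -- All increments are split at the smallest time `s j`. The common initial part carries the
    -- total momentum and is independent of what follows, so one step of decay factors out.
    have hprod : ∀ ω, ∏ i, wave (p i) (W (s i) ω - W τ ω) =
        wave (∑ i, p i) (W (s j) ω - W τ ω) *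
          ∏ i, wave (p (j.succAbove i))
            (W (s (j.succAbove i)) ω - W (s j) ω) := by
      intro ω
      rw [wave_sum_left, Fin.prod_univ_succAbove _ j, Fin.prod_univ_succAbove
        (fun i => wave (p i) (W (s j) ω - W τ ω)) j, mul_assoc,
        ← Finset.prod_mul_distrib]
      congr 1
      refine Finset.prod_congr rfl fun i _ => ?_
      rw [← wave_add_right]
      congr 1
      abel
    have hind := (hW.indep τ (s j) n (fun i => s (j.succAbove i)) h1 h2 (fun i => h3 _)
      (fun i => h4 _)).comp
        (φ := fun x => wave (∑ i, p i) x)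
        (ψ := fun x : Fin n → E => ∏ i, wave (p (j.succAbove i)) (x i))
        (measurable_wave measurable_const measurable_id)
        (Finset.measurable_fun_prod _ fun i _ =>
          measurable_wave measurable_const (measurable_pi_apply i))
    simp only [Function.comp_def] at hind
    simp only [φ]
    simp_rw [hprod]
    rw [hind.integral_fun_mul_eq_mul_integral, enorm_mul]
    · gcongr
      rw [← ofReal_norm]
      exact ENNReal.ofReal_le_ofReal (hW.decay τ (s j) h1 h2 (h4 j) _)
    · exact (measurable_wave measurable_const ((hWs _).sub (hWs _))).aestronglyMeasurable
    · exact (Finset.measurable_fun_prod _ fun i _ =>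
          measurable_wave measurable_const ((hWs _).sub (hWs _))).aestronglyMeasurable
  have hmain := lintegral_cube_le_chainSum hg (lam := lam) hlam φ h0 hstep n τ₀ le_rfl hτ p
  refine le_trans ?_ hmain
  let ν : Measure (Fin n → ℝ) := Measure.pi fun _ => volume.restrict (Set.Icc τ₀ T)
  have hν : ν = volume.restrict (Set.univ.pi fun _ : Fin n => Set.Icc τ₀ T) := by
    simp only [ν]
    rw [volume_pi, Measure.restrict_pi_pi]
  have hprod : ∀ ω, ∏ i, occupation W τ₀ T (p i) ω =
      ∫ s, ∏ i, wave (p i) (W (s i) ω - W τ₀ ω) ∂ν := fun ω =>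
    (integral_fintype_prod_eq_prod
      (fun i s => wave (p i) (W s ω - W τ₀ ω))).symm
  have hmeas : Measurable fun z : Ω × (Fin n → ℝ) =>
      ∏ i, wave (p i) (W (z.2 i) z.1 - W τ₀ z.1) := by
    refine Finset.measurable_fun_prod _ fun i _ => measurable_wave measurable_const ?_
    have h1 : Measurable fun z : Ω × (Fin n → ℝ) => W (z.2 i) z.1 :=
      hW.measurable.comp
        (((measurable_pi_apply (X := fun _ : Fin n => ℝ) i).comp measurable_snd).prodMk
          measurable_fst)
    exact h1.sub ((hWs τ₀).comp measurable_fst)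
  have : IsFiniteMeasure ν := by simp only [ν]; infer_instance
  simp_rw [hprod]
  rw [integral_integral_swap]
  · refine (enorm_integral_le_lintegral_enorm _).trans_eq ?_
    rw [hν]
  · refine Integrable.of_bound hmeas.aestronglyMeasurable 1 (ae_of_all _ fun z => ?_)
    simp only [Function.uncurry]
    rw [norm_prod]
    simp [norm_wave]

end Wave

end StableSelfIntersection

namespace StableSelfIntersection

/-! ### Regular processes, time reversal and adaptedness -/

section Regular

variable {Ω : Type*} [mΩ : MeasurableSpace Ω]
  {E : Type*} [NormedAddCommGroup E] [InnerProductSpace ℝ E] [MeasurableSpace E] [BorelSpace E]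
  [SecondCountableTopology E]

lemma measurable_uncurry_reverse {Z : ℝ → Ω → E} (hZ : Measurable (Function.uncurry Z)) :
    Measurable (Function.uncurry fun s ω => -Z (-s) ω) :=
  (hZ.comp (measurable_fst.neg.prodMk measurable_snd)).neg

/-- A right continuous process on the real line with independent increments, whose characteristic
functions after time `0` decay exponentially with rate `g`. -/
structure IsRegularProcess (P : Measure Ω) (g : E → ℝ) (Z : ℝ → Ω → E) : Prop where
  measurable : ∀ s, Measurable (Z s)
  rightContinuous : ∀ ω s, ContinuousWithinAt (fun u => Z u ω) (Set.Ici s) s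
  indep : HasIndepIncrements Z P
  decay : ∀ τ σ : ℝ, 0 ≤ τ → τ ≤ σ → ∀ q,
    ‖∫ ω, wave q (Z σ ω - Z τ ω) ∂P‖ ≤ Real.exp (-(σ - τ) * g q)

lemma indepFun_of_indep_of_measurable {P : Measure Ω} {m₁ m₂ : MeasurableSpace Ω}
    {α γ : Type*} [MeasurableSpace α] [MeasurableSpace γ] (h : Indep m₁ m₂ P) {f : Ω → α}
    {f' : Ω → γ} (hf : Measurable[m₁] f) (hf' : Measurable[m₂] f') : IndepFun f f' P :=
  indep_of_indep_of_le_left (indep_of_indep_of_le_right h hf'.comap_le) hf.comap_le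

variable {P : Measure Ω} [IsProbabilityMeasure P] {g : E → ℝ} {Z : ℝ → Ω → E}

lemma IsRegularProcess.measurable_uncurry (hZ : IsRegularProcess P g Z) :
    Measurable (Function.uncurry Z) :=
  measurable_uncurry_of_rightContinuous hZ.measurable hZ.rightContinuous

lemma IsRegularProcess.hasDecayingIncrements (hZ : IsRegularProcess P g Z) {τ₀ T : ℝ}
    (hτ : 0 ≤ τ₀) : HasDecayingIncrements P g Z τ₀ T where
  measurable := hZ.measurable_uncurry
  decay τ σ h1 h2 _ q := hZ.decay τ σ (hτ.trans h1) h2 q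
  indep τ σ n s _ h2 h3 _ := by
    refine indepFun_of_indep_of_measurable (indep_past_future hZ.measurable hZ.indep σ)
      (measurable_past_sub Z le_rfl h2) ?_
    exact @measurable_pi_lambda _ _ _ (future Z σ) _ _ fun i =>
      measurable_future_sub Z (h3 i) le_rfl

/-- Read backwards, an increment is again an increment of `Z` in the original direction, at
nonnegative times; the decay carries over without any symmetry of the law, and independence follows
with past and future exchanged. -/
lemma IsRegularProcess.hasDecayingIncrements_reverse (hZ : IsRegularProcess P g Z) {τ₀ T : ℝ}
    (hT : T ≤ 0) : HasDecayingIncrements P g (fun s ω => -Z (-s) ω) τ₀ T where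
  measurable :=
    measurable_uncurry_reverse hZ.measurable_uncurry
  decay τ σ _ h2 h3 q := by
    have h := hZ.decay (-σ) (-τ) (by linarith) (by linarith) q
    have e1 : ∀ ω, -Z (-σ) ω - -Z (-τ) ω = Z (-τ) ω - Z (-σ) ω := fun ω => by abel
    simp_rw [e1]
    rwa [show -τ - -σ = σ - τ by ring] at h
  indep τ σ n s _ h2 h3 _ := by
    have e1 : ∀ u v ω, -Z (-u) ω - -Z (-v) ω = Z (-v) ω - Z (-u) ω := fun u v ω => by abel
    simp_rw [e1]
    refine indepFun_of_indep_of_measurable (indep_past_future hZ.measurable hZ.indep (-σ)).symm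
      (measurable_future_sub Z (by linarith) le_rfl) ?_
    exact @measurable_pi_lambda _ _ _ (past Z (-σ)) _ _ fun i =>
      measurable_past_sub Z le_rfl (by linarith [h3 i])

/-- After freezing before time `a`, the increments from `a` are jointly measurable with respect
to the future of `a`. -/
lemma IsRegularProcess.measurable_uncurry_future (hZ : IsRegularProcess P g Z) (a : ℝ) :
    Measurable[@Prod.instMeasurableSpace ℝ Ω _ (future Z a)]
      (Function.uncurry fun s ω => Z (max s a) ω - Z a ω) := by
  refine @measurable_uncurry_of_rightContinuous Ω E (future Z a) _ _ _ _ _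
    (fun s => measurable_future_sub Z (le_max_right _ _) le_rfl) fun ω s => ?_
  refine ContinuousWithinAt.sub ?_ continuousWithinAt_const
  refine (hZ.rightContinuous ω (max s a)).comp (t := Set.Ici (max s a))
    (f := fun u => max u a) ?_ fun u hu => max_le_max_right a hu
  exact (continuous_id.max continuous_const).continuousWithinAt

/-- After freezing after time `a`, the increments up to `a` are jointly measurable with respect
to the past of `a`. -/
lemma IsRegularProcess.measurable_uncurry_past (hZ : IsRegularProcess P g Z) (a : ℝ) :
    Measurable[@Prod.instMeasurableSpace ℝ Ω _ (past Z a)]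
      (Function.uncurry fun s ω => Z (min s a) ω - Z a ω) := by
  refine @measurable_uncurry_of_rightContinuous Ω E (past Z a) _ _ _ _ _
    (fun s => measurable_past_sub Z (min_le_right _ _) le_rfl) fun ω s => ?_
  refine ContinuousWithinAt.sub ?_ continuousWithinAt_const
  refine (hZ.rightContinuous ω (min s a)).comp (t := Set.Ici (min s a))
    (f := fun u => min u a) ?_ fun u hu => min_le_min_right a hu
  exact (continuous_id.min continuous_const).continuousWithinAt

/-- Freezing the path before `a` leaves the integral over `[a, b]` unchanged and makes it visibly a
function of later increments. With its counterpart for the past, this yields the independence of the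
two occupation integrals. -/
lemma IsRegularProcess.measurable_future_occupation (hZ : IsRegularProcess P g Z) (a b : ℝ)
    (p : E) : Measurable[future Z a] (occupation Z a b p) := by
  have h := @measurable_occupation E _ _ _ _ _ Ω (future Z a) _
    (hZ.measurable_uncurry_future a) a b
  have h2 : (fun ω => occupation (fun s ω => Z (max s a) ω - Z a ω) a b p ω) =
      occupation Z a b p := by
    ext ω
    refine setIntegral_congr_fun measurableSet_Icc fun s hs => ?_
    simp [max_eq_left hs.1]
  rw [← h2]
  exact h.comp (@measurable_prodMk_left _ _ _ (future Z a) p)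

lemma IsRegularProcess.measurable_past_occupation (hZ : IsRegularProcess P g Z) (a b : ℝ)
    (p : E) : Measurable[past Z a] (occupation (fun s ω => -Z (-s) ω) (-a) b p) := by
  have h0 : Measurable[@Prod.instMeasurableSpace ℝ Ω _ (past Z a)]
      (Function.uncurry fun s ω => -(Z (min (-s) a) ω - Z a ω)) :=
    @measurable_uncurry_reverse Ω (past Z a) _ _ _ _ _ _ _ (hZ.measurable_uncurry_past a)
  have h := @measurable_occupation E _ _ _ _ _ Ω (past Z a) _ h0 (-a) b
  have h2 : (fun ω => occupation (fun s ω => -(Z (min (-s) a) ω - Z a ω)) (-a) b p ω) =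
      occupation (fun s ω => -Z (-s) ω) (-a) b p := by
    ext ω
    refine setIntegral_congr_fun measurableSet_Icc fun s hs => ?_
    have : min (-s) a = -s := min_eq_left (by linarith [hs.1])
    simp only [this, neg_neg, min_self]
    congr 1
    abel
  rw [← h2]
  exact h.comp (@measurable_prodMk_left _ _ _ (past Z a) p)

end Regular

/-! ### Moments of the interaction of two adjacent path segments -/

section Cross

variable {Ω : Type*} [mΩ : MeasurableSpace Ω]
  {E : Type*} [NormedAddCommGroup E] [InnerProductSpace ℝ E]

/-- The interaction of the paths of `Z` on `[a, m]` and `[m, b]`. -/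
noncomputable def crossTerm (h : E → ℝ) (Z : ℝ → Ω → E) (a m b : ℝ) (ω : Ω) : ℝ :=
  ∫ s in m..b, ∫ r in a..m, h (Z s ω - Z r ω)

variable [MeasurableSpace E] [BorelSpace E] [FiniteDimensional ℝ E]

lemma integrable_mul_of_norm_le {α : Type*} [MeasurableSpace α] (ν : Measure α)
    [IsFiniteMeasure ν] {G : E → ℂ} (hG : Integrable G) {k : α × E → ℂ} (hk : Measurable k)
    {C : ℝ} (hC : ∀ z, ‖k z‖ ≤ C) :
    Integrable (fun z : α × E => G z.2 * k z) (ν.prod volume) :=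
  (hG.comp_snd ν).mul_bdd hk.aestronglyMeasurable (ae_of_all _ hC)

variable {P : Measure Ω} [IsProbabilityMeasure P] {g : E → ℝ} {Z : ℝ → Ω → E}

/-- Split Z_s − Z_r at time `m`: the plane wave becomes a product of a function of `s` and a
function of `r`, and Fubini turns the double time integral into a product of two occupation
integrals, the second one time-reversed. -/
lemma IsRegularProcess.crossTerm_eq_integral (hZ : IsRegularProcess P g Z) {h : E → ℝ} {G : E → ℂ}
    (hG : Integrable G) (hGh : ∀ x, (h x : ℂ) = ∫ p, G p * wave p x) {a m b : ℝ} (ham : a ≤ m)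
    (hmb : m ≤ b) (ω : Ω) :
    (crossTerm h Z a m b ω : ℂ) =
      ∫ p, G p * (occupation Z m b p ω * occupation (fun s ω => -Z (-s) ω) (-m) (-a) p ω) := by
  have hZω : Measurable fun s => Z s ω := hZ.measurable_uncurry.comp measurable_prodMk_right
  set O : E → ℂ := fun p => occupation (fun s ω => -Z (-s) ω) (-m) (-a) p ω with hO
  have hOm : Measurable O :=
    (measurable_occupation (measurable_uncurry_reverse hZ.measurable_uncurry) (-m) (-a)).comp
      (measurable_prodMk_right (y := ω))
  have hOeq : ∀ p, O p = ∫ r in Set.Icc a m, wave p (Z m ω - Z r ω) := by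
    intro p
    simp only [hO, occupation]
    rw [integral_Icc_eq_integral_Ioc, ← intervalIntegral.integral_of_le (by linarith),
      integral_Icc_eq_integral_Ioc, ← intervalIntegral.integral_of_le ham,
      ← intervalIntegral.integral_comp_neg]
    refine intervalIntegral.integral_congr fun r _ => ?_
    simp only [neg_neg]
    congr 1
    abel
  have hOb : ∀ p, ‖O p‖ ≤ -a - -m := fun p => norm_occupation_le _ (by linarith) _ _
  have inner : ∀ s, ((∫ r in a..m, h (Z s ω - Z r ω) : ℝ) : ℂ) =
      ∫ p, G p * (wave p (Z s ω - Z m ω) * O p) := by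
    intro s
    rw [intervalIntegral.integral_of_le ham, ← integral_Icc_eq_integral_Ioc,
      ← integral_complex_ofReal]
    simp_rw [hGh]
    rw [integral_integral_swap]
    · refine integral_congr_ae (ae_of_all _ fun p => ?_)
      simp only
      rw [integral_const_mul, hOeq, ← integral_const_mul (wave p (Z s ω - Z m ω))]
      congr 1
      refine integral_congr_ae (ae_of_all _ fun r => ?_)
      simp only
      rw [← wave_add_right]
      congr 1
      abel
    · refine integrable_mul_of_norm_le _ hG (k := fun z : ℝ × E => wave z.2 (Z s ω - Z z.1 ω))
        ?_ fun z => (norm_wave _ _).le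
      exact measurable_wave measurable_snd (measurable_const.sub (hZω.comp measurable_fst))
  simp only [crossTerm]
  rw [intervalIntegral.integral_of_le hmb, ← integral_Icc_eq_integral_Ioc,
    ← integral_complex_ofReal]
  simp_rw [inner]
  rw [integral_integral_swap]
  · refine integral_congr_ae (ae_of_all _ fun p => ?_)
    simp only
    rw [integral_const_mul, integral_mul_const]
    rfl
  · refine integrable_mul_of_norm_le _ hG (C := 1 * (-a - -m))
      (k := fun z : ℝ × E => wave z.2 (Z z.1 ω - Z m ω) * O z.2) ?_ fun z => ?_
    · exact (measurable_wave measurable_snd ((hZω.comp measurable_fst).sub_const _)).mul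
        (hOm.comp measurable_snd)
    · rw [norm_mul]
      gcongr
      · exact (norm_wave _ _).le
      · exact hOb _

/-- The moments of the interaction of two independent path segments, with a free parameter
`lam`. -/
lemma IsRegularProcess.enorm_integral_crossTerm_pow_le (hZ : IsRegularProcess P g Z)
    {h : E → ℝ} {G : E → ℂ} (hG : Integrable G)
    (hGh : ∀ x, (h x : ℂ) = ∫ p, G p * wave p x)
    {c β ρ B lam : ℝ} (hc : 0 < c) (hβ : 0 < β) (hρ : 0 < ρ) (hB : 0 ≤ B)
    (hlam : 0 < lam) (hg : ∀ q, g q = c * ‖q‖ ^ β) (hGB : ∀ p, ‖G p‖ ≤ B * ‖p‖ ^ ρ)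
    {a m b : ℝ} (ha : 0 ≤ a) (ham : a ≤ m) (hmb : m ≤ b) (n : ℕ) :
    ‖∫ ω, crossTerm h Z a m b ω ^ n ∂P‖ₑ ≤
      ENNReal.ofReal B ^ n * (ENNReal.ofReal (Real.exp (lam * (b - m))) *
        ENNReal.ofReal (Real.exp (lam * (m - a)))) * ((n.factorial : ℝ≥0∞) ^ 2 *
          (ENNReal.ofReal (lam ^ ((Module.finrank ℝ E + ρ) / β - 2)) *
            ∫⁻ x : E, (ENNReal.ofReal ((1 + ‖x‖) ^ ρ) ^ 2 *
              (ENNReal.ofReal (1 + c * ‖x‖ ^ β))⁻¹ ^ 2)) ^ n) := by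
  set W : ℝ → Ω → E := fun s ω => -Z (-s) ω with hW
  have hWm : Measurable (Function.uncurry W) :=
    measurable_uncurry_reverse hZ.measurable_uncurry
  set A : E → Ω → ℂ := occupation Z m b with hA
  set A' : E → Ω → ℂ := occupation W (-m) (-a) with hA'
  have hAm : Measurable fun z : E × Ω => A z.1 z.2 :=
    measurable_occupation hZ.measurable_uncurry m b
  have hA'm : Measurable fun z : E × Ω => A' z.1 z.2 := measurable_occupation hWm (-m) (-a)
  have hAb : ∀ p ω, ‖A p ω‖ ≤ b - m := fun p ω => norm_occupation_le _ hmb _ _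
  have hA'b : ∀ p ω, ‖A' p ω‖ ≤ -a - -m := fun p ω => norm_occupation_le _ (by linarith) _ _
  let κ : E → ℝ≥0∞ := fun q => (ENNReal.ofReal (lam + c * ‖q‖ ^ β))⁻¹
  let v : E → ℝ≥0∞ := fun q => ENNReal.ofReal (‖q‖ ^ ρ)
  let w : E → ℝ≥0∞ := fun q => ENNReal.ofReal ((1 + lam ^ (-(1 / β)) * ‖q‖) ^ ρ)
  have hκm : Measurable κ := by
    have : Measurable fun x : E => lam + c * ‖x‖ ^ β := by fun_prop
    exact this.ennreal_ofReal.inv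
  have hvm : Measurable v := by
    have : Measurable fun x : E => ‖x‖ ^ ρ := by fun_prop
    exact this.ennreal_ofReal
  have hwm : Measurable w := by
    have : Measurable fun x : E => (1 + lam ^ (-(1 / β)) * ‖x‖) ^ ρ := by fun_prop
    exact this.ennreal_ofReal
  have hw1 : ∀ q, 1 ≤ w q := fun q => by
    rw [← ENNReal.ofReal_one]
    refine ENNReal.ofReal_le_ofReal (Real.one_le_rpow ?_ hρ.le)
    have : 0 ≤ lam ^ (-(1 / β)) * ‖q‖ := by positivity
    linarith
  have hg0 : ∀ q, 0 ≤ g q := fun q => by rw [hg]; positivity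
  have hκg : (fun q => (ENNReal.ofReal (lam + g q))⁻¹) = κ := by ext q; simp only [κ, hg]
  have hpow : ∀ ω, ((crossTerm h Z a m b ω ^ n : ℝ) : ℂ) =
      ∫ p : Fin n → E, ∏ i, G (p i) * (A (p i) ω * A' (p i) ω) ∂(Measure.pi fun _ => volume) := by
    intro ω
    rw [integral_fintype_prod_eq_pow (fun p => G p * (A p ω * A' p ω)), Fintype.card_fin,
      Complex.ofReal_pow, hZ.crossTerm_eq_integral hG hGh ham hmb]
  have hswap : Integrable (Function.uncurry fun (ω : Ω) (p : Fin n → E) =>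
      ∏ i, G (p i) * (A (p i) ω * A' (p i) ω)) (P.prod (Measure.pi fun _ => volume)) := by
    have hGp : Integrable (fun p : Fin n → E => ∏ i, G (p i)) (Measure.pi fun _ => volume) :=
      Integrable.fintype_prod fun _ => hG
    have hmeas : Measurable fun z : Ω × (Fin n → E) => ∏ i, (A (z.2 i) z.1 * A' (z.2 i) z.1) := by
      refine Finset.measurable_fun_prod _ fun i _ => ?_
      have h1 : Measurable fun z : Ω × (Fin n → E) => (z.2 i, z.1) :=
        ((measurable_pi_apply (X := fun _ : Fin n => E) i).comp measurable_snd).prodMk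
          measurable_fst
      exact (hAm.comp h1).mul (hA'm.comp h1)
    have := (hGp.comp_snd P).mul_bdd hmeas.aestronglyMeasurable
      (c := ((b - m) * (-a - -m)) ^ n) (ae_of_all _ fun z => by
        rw [norm_prod]
        calc ∏ i, ‖A (z.2 i) z.1 * A' (z.2 i) z.1‖ ≤ ∏ _i : Fin n, (b - m) * (-a - -m) := by
              refine Finset.prod_le_prod (fun _ _ => norm_nonneg _) fun i _ => ?_
              rw [norm_mul]
              exact mul_le_mul (hAb _ _) (hA'b _ _) (norm_nonneg _) (by linarith)
          _ = ((b - m) * (-a - -m)) ^ n := by simp)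
    refine this.congr (ae_of_all _ fun z => ?_)
    simp only [Function.uncurry]
    rw [← Finset.prod_mul_distrib]
  have hE : ‖∫ ω, crossTerm h Z a m b ω ^ n ∂P‖ₑ =
      ‖∫ p : Fin n → E, ∫ ω, ∏ i, G (p i) * (A (p i) ω * A' (p i) ω) ∂P
        ∂(Measure.pi fun _ => volume)‖ₑ := by
    rw [← integral_integral_swap hswap]
    simp_rw [← hpow]
    rw [integral_complex_ofReal, ← ofReal_norm, ← ofReal_norm, Complex.norm_real]
  have hfix : ∀ p : Fin n → E, ‖∫ ω, ∏ i, G (p i) * (A (p i) ω * A' (p i) ω) ∂P‖ₑ ≤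
      ENNReal.ofReal B ^ n * (ENNReal.ofReal (Real.exp (lam * (b - m))) *
        ENNReal.ofReal (Real.exp (lam * (m - a)))) *
        ((∏ i, v (p i)) * w (∑ i, p i) * chainSum κ n p ^ 2) := by
    intro p
    have h1 : ∀ ω, ∏ i, G (p i) * (A (p i) ω * A' (p i) ω) =
        (∏ i, G (p i)) * ((∏ i, A (p i) ω) * ∏ i, A' (p i) ω) := fun ω => by
      rw [← Finset.prod_mul_distrib, ← Finset.prod_mul_distrib]
    -- The two products depend on increments on opposite sides of time `m`.
    have hind : IndepFun (fun ω => ∏ i, A (p i) ω) (fun ω => ∏ i, A' (p i) ω) P := by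
      refine indepFun_of_indep_of_measurable (indep_past_future hZ.measurable hZ.indep m).symm
        ?_ ?_
      · exact @Finset.measurable_fun_prod _ _ _ _ _ _ (future Z m) _ _ fun i _ =>
          hZ.measurable_future_occupation m b (p i)
      · exact @Finset.measurable_fun_prod _ _ _ _ _ _ (past Z m) _ _ fun i _ =>
          hZ.measurable_past_occupation m (-a) (p i)
    have m1 : Measurable fun ω => ∏ i, A (p i) ω := Finset.measurable_fun_prod _ fun i _ =>
      hAm.comp measurable_prodMk_left
    have m2 : Measurable fun ω => ∏ i, A' (p i) ω := Finset.measurable_fun_prod _ fun i _ =>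
      hA'm.comp measurable_prodMk_left
    simp_rw [h1]
    rw [integral_const_mul, hind.integral_fun_mul_eq_mul_integral m1.aestronglyMeasurable
      m2.aestronglyMeasurable, enorm_mul, enorm_mul]
    have b1 := enorm_integral_prod_occupation_le hg0 hmb hlam
      (hZ.hasDecayingIncrements (T := b) (ha.trans ham)) p
    have b2 := enorm_integral_prod_occupation_le hg0 (by linarith : -m ≤ -a) hlam
      (hZ.hasDecayingIncrements_reverse (τ₀ := -m) (by linarith : -a ≤ 0)) p
    rw [hκg] at b1 b2
    rw [show -a - -m = m - a by ring] at b2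
    have b3 : ‖∏ i, G (p i)‖ₑ ≤ ENNReal.ofReal B ^ n * ∏ i, v (p i) := by
      rw [← ofReal_norm, norm_prod, ENNReal.ofReal_prod_of_nonneg fun _ _ => norm_nonneg _]
      calc ∏ i, ENNReal.ofReal ‖G (p i)‖ ≤ ∏ i, ENNReal.ofReal B * v (p i) := by
            refine Finset.prod_le_prod' fun i _ => ?_
            simp only [v]
            rw [← ENNReal.ofReal_mul hB]
            exact ENNReal.ofReal_le_ofReal (hGB _)
        _ = _ := by rw [Finset.prod_mul_distrib]; simp
    calc _ ≤ (ENNReal.ofReal B ^ n * ∏ i, v (p i)) *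
          ((ENNReal.ofReal (Real.exp (lam * (b - m))) * chainSum κ n p) *
            (ENNReal.ofReal (Real.exp (lam * (m - a))) * chainSum κ n p)) := by gcongr
      _ = ENNReal.ofReal B ^ n * (ENNReal.ofReal (Real.exp (lam * (b - m))) *
          ENNReal.ofReal (Real.exp (lam * (m - a)))) *
          ((∏ i, v (p i)) * 1 * chainSum κ n p ^ 2) := by ring
      -- Inserting `w ≥ 1` is what lets the momentum recursion close; it ends at `w 0 = 1`.
      _ ≤ _ := by gcongr; exact hw1 _
  rw [hE]
  refine (enorm_integral_le_lintegral_enorm _).trans ?_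
  refine (lintegral_mono hfix).trans ?_
  rw [lintegral_const_mul' _ _ (by finiteness)]
  gcongr
  refine (lintegral_prod_mul_chainSum_sq_le volume hvm hwm hκm
    (fun y => lintegral_resolvent_le volume hc hβ hρ hlam y) n).trans_eq ?_
  simp [w]

omit [InnerProductSpace ℝ E] [FiniteDimensional ℝ E] in
lemma measurable_crossTerm [SecondCountableTopology E] {V : ℝ → Ω → E}
    (hV : Measurable (Function.uncurry V)) {h : E → ℝ} (hh : Measurable h) {a m b : ℝ}
    (ham : a ≤ m) (hmb : m ≤ b) : Measurable (crossTerm h V a m b) := by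
  have h1 : Measurable fun z : (Ω × ℝ) × ℝ => h (V z.1.2 z.1.1 - V z.2 z.1.1) :=
    hh.comp ((hV.comp ((measurable_snd.comp measurable_fst).prodMk
      (measurable_fst.comp measurable_fst))).sub
      (hV.comp (measurable_snd.prodMk (measurable_fst.comp measurable_fst))))
  have h2 : StronglyMeasurable fun z : Ω × ℝ => ∫ r in Set.Ioc a m, h (V z.2 z.1 - V r z.1) :=
    h1.stronglyMeasurable.integral_prod_right
      (f := fun (z : Ω × ℝ) (r : ℝ) => h (V z.2 z.1 - V r z.1))
  have h3 := h2.integral_prod_right (ν := volume.restrict (Set.Ioc m b))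
      (f := fun (ω : Ω) (s : ℝ) => ∫ r in Set.Ioc a m, h (V s ω - V r ω))
  have h4 : crossTerm h V a m b = fun ω => ∫ s in Set.Ioc m b, ∫ r in Set.Ioc a m,
      h (V s ω - V r ω) := by
    ext ω
    simp only [crossTerm]
    rw [intervalIntegral.integral_of_le hmb]
    simp_rw [intervalIntegral.integral_of_le ham]
  rw [h4]
  exact h3.measurable

omit mΩ [InnerProductSpace ℝ E] [MeasurableSpace E] [BorelSpace E] [FiniteDimensional ℝ E] in
lemma crossTerm_congr {h : E → ℝ} {V V' : ℝ → Ω → E} {a m b : ℝ} (ham : a ≤ m) (hmb : m ≤ b)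
    (ω : Ω) (hV : ∀ s ∈ Set.Icc a b, ∀ r ∈ Set.Icc a b, V s ω - V r ω = V' s ω - V' r ω) :
    crossTerm h V a m b ω = crossTerm h V' a m b ω := by
  refine intervalIntegral.integral_congr fun s hs => ?_
  refine intervalIntegral.integral_congr fun r hr => ?_
  rw [Set.uIcc_of_le hmb] at hs
  rw [Set.uIcc_of_le ham] at hr
  rw [hV s ⟨ham.trans hs.1, hs.2⟩ r ⟨hr.1, hr.2.trans hmb⟩]

lemma IsRegularProcess.measurable_future_crossTerm (hZ : IsRegularProcess P g Z)
    {h : E → ℝ} (hh : Measurable h) {a m b : ℝ} (ham : a ≤ m) (hmb : m ≤ b) :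
    Measurable[future Z a] (crossTerm h Z a m b) := by
  have h1 := @measurable_crossTerm Ω (future Z a) _ _ _ _ _ _ (hZ.measurable_uncurry_future a) _ hh
    _ _ _ ham hmb
  convert! h1 using 1
  ext ω
  refine crossTerm_congr ham hmb ω fun s hs r hr => ?_
  simp [max_eq_left hs.1, max_eq_left hr.1]

lemma IsRegularProcess.measurable_past_crossTerm (hZ : IsRegularProcess P g Z)
    {h : E → ℝ} (hh : Measurable h) {a m b c : ℝ} (ham : a ≤ m) (hmb : m ≤ b) (hbc : b ≤ c) :
    Measurable[past Z c] (crossTerm h Z a m b) := by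
  have h1 := @measurable_crossTerm Ω (past Z c) _ _ _ _ _ _ (hZ.measurable_uncurry_past c) _ hh
    _ _ _ ham hmb
  convert! h1 using 1
  ext ω
  refine crossTerm_congr ham hmb ω fun s hs r hr => ?_
  simp [min_eq_left (hs.2.trans hbc), min_eq_left (hr.2.trans hbc)]

omit mΩ [InnerProductSpace ℝ E] [MeasurableSpace E] [BorelSpace E] [FiniteDimensional ℝ E] in
lemma abs_crossTerm_le {h : E → ℝ} {V : ℝ → Ω → E} {H : ℝ} (hH : ∀ x, |h x| ≤ H) {a m b : ℝ}
    (ham : a ≤ m) (hmb : m ≤ b) (ω : Ω) :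
    |crossTerm h V a m b ω| ≤ H * (m - a) * (b - m) := by
  have h1 : ∀ s, ‖∫ r in a..m, h (V s ω - V r ω)‖ ≤ H * (m - a) := fun s => by
    have := intervalIntegral.norm_integral_le_of_norm_le_const (a := a) (b := m)
      (f := fun r => h (V s ω - V r ω)) (C := H) fun r _ => hH _
    rwa [abs_of_nonneg (by linarith)] at this
  have := intervalIntegral.norm_integral_le_of_norm_le_const (a := m) (b := b)
    (f := fun s => ∫ r in a..m, h (V s ω - V r ω)) fun s _ => h1 s
  rwa [abs_of_nonneg (by linarith : 0 ≤ b - m)] at this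

/-- Growth of the moments of the interaction of two consecutive path segments of length `L`. -/
lemma IsRegularProcess.exists_abs_integral_crossTerm_pow_le {c β ρ : ℝ} (hc : 0 < c) (hβ : 0 < β)
    (hρ : 0 < ρ) (hd : (Module.finrank ℝ E : ℝ) < 2 * β - 2 * ρ) :
    ∃ K : ℝ, 0 < K ∧ ∀ (g : E → ℝ) (Z : ℝ → Ω → E), IsRegularProcess P g Z →
      (∀ q, g q = c * ‖q‖ ^ β) → ∀ (h : E → ℝ) (G : E → ℂ), Integrable G →
      (∀ x, (h x : ℂ) = ∫ p, G p * wave p x) → ∀ B : ℝ, 0 ≤ B → (∀ p, ‖G p‖ ≤ B * ‖p‖ ^ ρ) →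
      ∀ m L : ℝ, 0 < L → L ≤ m → ∀ n : ℕ,
      |∫ ω, crossTerm h Z (m - L) m (m + L) ω ^ n ∂P| ≤
        (K * B * L ^ (2 - (Module.finrank ℝ E + ρ) / β)) ^ n *
          (n.factorial : ℝ) ^ ((Module.finrank ℝ E + ρ) / β) := by
  set I : ℝ≥0∞ := ∫⁻ x : E, (ENNReal.ofReal ((1 + ‖x‖) ^ ρ) ^ 2 *
              (ENNReal.ofReal (1 + c * ‖x‖ ^ β))⁻¹ ^ 2) with hI
  have hIt : I ≠ ∞ := (lintegral_weight_lt_top volume hc hβ hd).ne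
  set α : ℝ := (Module.finrank ℝ E + ρ) / β with hα
  have hα2 : α ≤ 2 := by rw [hα, div_le_iff₀ hβ]; linarith
  refine ⟨Real.exp 2 * (I.toReal + 1), by positivity, fun g Z hZ hg h G hG hGh B hB hGB m L hL hLm n
    => ?_⟩
  rcases Nat.eq_zero_or_pos n with rfl | hn
  · simp
  have hnR : (0 : ℝ) < n := by exact_mod_cast hn
  -- With lam = n/L each exponential prefactor is e^n, absorbed in the constant, while the power of
  -- lam recovers part of the squared factorial. The case n = 0 is separate because lam must be
  -- positive.
  have hlam : 0 < (n : ℝ) / L := by positivity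
  have main := hZ.enorm_integral_crossTerm_pow_le hG hGh hc hβ hρ hB hlam hg hGB
    (a := m - L) (m := m) (b := m + L) (by linarith) (by linarith) (by linarith) n
  rw [← hI, ← hα, add_sub_cancel_left, sub_sub_cancel, div_mul_cancel₀ _ hL.ne',
    ← ENNReal.ofReal_toReal hIt, ← ENNReal.ofReal_natCast, ← ofReal_norm,
    ← ENNReal.ofReal_pow (by positivity), ← ENNReal.ofReal_mul (by positivity),
    ← ENNReal.ofReal_mul (by positivity), ← ENNReal.ofReal_mul (by positivity),
    ← ENNReal.ofReal_pow (by positivity), ← ENNReal.ofReal_pow (by positivity),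
    ← ENNReal.ofReal_mul (by positivity), ← ENNReal.ofReal_mul (by positivity),
    ENNReal.ofReal_le_ofReal_iff (by positivity), Real.norm_eq_abs] at main
  refine main.trans ?_
  -- Only n! ≤ n^n is needed: the exponent α − 2 is nonpositive, so the inequality reverses in the
  -- useful direction.
  have hf : (n.factorial : ℝ) ^ 2 * ((n : ℝ) ^ (α - 2)) ^ n ≤ (n.factorial : ℝ) ^ α := by
    have h1 : (n.factorial : ℝ) ≤ (n : ℝ) ^ n := by exact_mod_cast Nat.factorial_le_pow n
    have h2 : ((n : ℝ) ^ (α - 2)) ^ n ≤ (n.factorial : ℝ) ^ (α - 2) := by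
      rw [← Real.rpow_natCast, ← Real.rpow_mul hnR.le, mul_comm, Real.rpow_mul hnR.le,
        Real.rpow_natCast]
      exact Real.rpow_le_rpow_of_nonpos (by positivity) h1 (by linarith)
    calc _ ≤ (n.factorial : ℝ) ^ 2 * (n.factorial : ℝ) ^ (α - 2) := by gcongr
      _ = _ := by
        rw [← Real.rpow_two, ← Real.rpow_add (by positivity)]
        congr 1; ring
  have hlamα : ((n : ℝ) / L) ^ (α - 2) = (n : ℝ) ^ (α - 2) * L ^ (2 - α) := by
    rw [Real.div_rpow hnR.le hL.le, div_eq_mul_inv, ← Real.rpow_neg hL.le, neg_sub]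
  have hexp : Real.exp n * Real.exp n = Real.exp 2 ^ n := by
    rw [← Real.exp_add, ← Real.exp_nat_mul]; congr 1; ring
  rw [hlamα, hexp]
  calc B ^ n * Real.exp 2 ^ n * ((n.factorial : ℝ) ^ 2 *
        ((n : ℝ) ^ (α - 2) * L ^ (2 - α) * I.toReal) ^ n)
      = (B * Real.exp 2 * L ^ (2 - α) * I.toReal) ^ n *
          ((n.factorial : ℝ) ^ 2 * ((n : ℝ) ^ (α - 2)) ^ n) := by
        simp only [mul_pow]; ring
    _ ≤ (B * Real.exp 2 * L ^ (2 - α) * (I.toReal + 1)) ^ n * (n.factorial : ℝ) ^ α := by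
        gcongr; linarith
    _ = _ := by congr 2; ring

end Cross

end StableSelfIntersection

namespace StableSelfIntersection

/-! ### Dyadic decomposition of the time triangle -/

section Triangle

lemma measurable_setIntegral_Ioc_of_measurable {α : Type*} [MeasurableSpace α]
    {k : α → ℝ → ℝ → ℝ} (hk : Measurable fun z : (α × ℝ) × ℝ => k z.1.1 z.1.2 z.2) (a : ℝ) :
    Measurable fun z : α × ℝ => ∫ r in Set.Ioc a z.2, k z.1 z.2 r := by
  have hs : MeasurableSet {z : (α × ℝ) × ℝ | z.2 ∈ Set.Ioc a z.1.2} :=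
    (measurableSet_lt measurable_const measurable_snd).inter
      (measurableSet_le measurable_snd (measurable_snd.comp measurable_fst))
  have h1 := (hk.indicator hs).stronglyMeasurable.integral_prod_right
    (f := fun (z : α × ℝ) (r : ℝ) => {z : (α × ℝ) × ℝ | z.2 ∈ Set.Ioc a z.1.2}.indicator
      (fun z : (α × ℝ) × ℝ => k z.1.1 z.1.2 z.2) (z, r)) (ν := volume)
  refine (congrArg Measurable (funext fun z => ?_)).mpr h1.measurable
  rw [← integral_indicator measurableSet_Ioc]
  rfl

/-- The integral of `k s r` over the triangle `a ≤ r ≤ s ≤ b`. -/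
noncomputable def triangle (k : ℝ → ℝ → ℝ) (a b : ℝ) : ℝ := ∫ s in a..b, ∫ r in a..s, k s r

lemma abs_triangle_le {k : ℝ → ℝ → ℝ} {H : ℝ} (hH : ∀ s r, |k s r| ≤ H) {a b : ℝ} (hab : a ≤ b) :
    |triangle k a b| ≤ H * (b - a) * (b - a) := by
  have hH0 : 0 ≤ H := (abs_nonneg _).trans (hH 0 0)
  have h1 : ∀ s ∈ Set.uIoc a b, ‖∫ r in a..s, k s r‖ ≤ H * (b - a) := fun s hs => by
    rw [Set.uIoc_of_le hab] at hs
    refine (intervalIntegral.norm_integral_le_of_norm_le_const (C := H) fun r _ => hH s r).trans ?_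
    rw [abs_of_nonneg (by linarith [hs.1])]
    gcongr
    exact hs.2
  have := intervalIntegral.norm_integral_le_of_norm_le_const h1
  rwa [abs_of_nonneg (by linarith : 0 ≤ b - a)] at this

lemma intervalIntegrable_of_measurable_of_abs_le {f : ℝ → ℝ} (hf : Measurable f) {H : ℝ}
    (hH : ∀ r, |f r| ≤ H) (u v : ℝ) : IntervalIntegrable f volume u v :=
  (intervalIntegrable_const (c := H)).mono_fun' hf.aestronglyMeasurable (ae_of_all _ hH)

lemma intervalIntegrable_integral_left {k : ℝ → ℝ → ℝ} (hk : Measurable (Function.uncurry k))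
    {H : ℝ} (hH : ∀ s r, |k s r| ≤ H) {u v : ℝ} (huv : u ≤ v) :
    IntervalIntegrable (fun s => ∫ r in u..s, k s r) volume u v := by
  have hH0 : 0 ≤ H := (abs_nonneg _).trans (hH 0 0)
  have hm : Measurable fun s => ∫ r in Set.Ioc u s, k s r :=
    (measurable_setIntegral_Ioc_of_measurable (α := Unit) (k := fun _ => k)
      (hk.comp ((measurable_snd.comp measurable_fst).prodMk measurable_snd)) u).comp
      (measurable_prodMk_left (x := ()))
  have h1 : IntervalIntegrable (fun s => ∫ r in Set.Ioc u s, k s r) volume u v := by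
    refine (intervalIntegrable_const (c := H * (v - u))).mono_fun' hm.aestronglyMeasurable ?_
    rw [Set.uIoc_of_le huv]
    refine (ae_restrict_iff' measurableSet_Ioc).2 (ae_of_all _ fun s hs => ?_)
    simp only
    rw [← intervalIntegral.integral_of_le hs.1.le]
    refine (intervalIntegral.norm_integral_le_of_norm_le_const (C := H)
      fun r _ => hH s r).trans ?_
    rw [abs_of_nonneg (by linarith [hs.1])]
    gcongr
    exact hs.2
  refine h1.congr_ae ?_
  rw [Set.uIoc_of_le huv]
  refine (ae_restrict_iff' measurableSet_Ioc).2 (ae_of_all _ fun s hs => ?_)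
  simp only
  rw [intervalIntegral.integral_of_le hs.1.le]

lemma triangle_sub {k k' : ℝ → ℝ → ℝ} (hk : Measurable (Function.uncurry k))
    (hk' : Measurable (Function.uncurry k')) {H H' : ℝ} (hH : ∀ s r, |k s r| ≤ H)
    (hH' : ∀ s r, |k' s r| ≤ H') {a b : ℝ} (hab : a ≤ b) :
    triangle (fun s r => k s r - k' s r) a b = triangle k a b - triangle k' a b := by
  simp only [triangle]
  rw [← intervalIntegral.integral_sub (intervalIntegrable_integral_left hk hH hab)
    (intervalIntegrable_integral_left hk' hH' hab)]
  congr 1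
  ext s
  exact intervalIntegral.integral_sub
    (intervalIntegrable_of_measurable_of_abs_le (hk.comp measurable_prodMk_left) (hH s) a s)
    (intervalIntegrable_of_measurable_of_abs_le (hk'.comp measurable_prodMk_left) (hH' s) a s)

lemma triangle_split {k : ℝ → ℝ → ℝ} (hk : Measurable (Function.uncurry k)) {H : ℝ}
    (hH : ∀ s r, |k s r| ≤ H) {a m b : ℝ} (ham : a ≤ m) (hmb : m ≤ b) :
    triangle k a b = triangle k a m + triangle k m b + ∫ s in m..b, ∫ r in a..m, k s r := by
  have hkr : ∀ s u v, IntervalIntegrable (k s) volume u v := fun s u v =>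
    intervalIntegrable_of_measurable_of_abs_le (hk.comp measurable_prodMk_left) (hH s) u v
  have hI : ∀ u v, u ≤ v → IntervalIntegrable (fun s => ∫ r in u..s, k s r) volume u v :=
    fun u v huv => intervalIntegrable_integral_left hk hH huv
  have hJ : IntervalIntegrable (fun s => ∫ r in a..m, k s r) volume m b := by
    refine (intervalIntegrable_const (c := H * |m - a|)).mono_fun' ?_ (ae_of_all _ fun s =>
      intervalIntegral.norm_integral_le_of_norm_le_const fun r _ => hH s r)
    simp_rw [intervalIntegral.integral_of_le ham]
    exact (hk.stronglyMeasurable.integral_prod_right (f := k)).aestronglyMeasurable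
  have hsplit : ∀ s, ∫ r in a..s, k s r = (∫ r in m..s, k s r) + ∫ r in a..m, k s r := fun s => by
    rw [add_comm]
    exact (intervalIntegral.integral_add_adjacent_intervals (hkr s a m) (hkr s m s)).symm
  have hI2 : IntervalIntegrable (fun s => ∫ r in a..s, k s r) volume m b :=
    (hI a b (ham.trans hmb)).mono_set (by
      rw [Set.uIcc_of_le hmb, Set.uIcc_of_le (ham.trans hmb)]
      exact Set.Icc_subset_Icc_left ham)
  simp only [triangle]
  rw [← intervalIntegral.integral_add_adjacent_intervals (hI a m ham) hI2, add_assoc]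
  congr 1
  simp_rw [hsplit]
  exact intervalIntegral.integral_add (hI m b hmb) hJ

lemma sum_range_two_mul {M : Type*} [AddCommMonoid M] (f : ℕ → M) (n : ℕ) :
    ∑ i ∈ Finset.range (2 * n), f i = ∑ j ∈ Finset.range n, (f (2 * j) + f (2 * j + 1)) := by
  induction n with
  | zero => simp
  | succ n ih => rw [mul_add, mul_one, Finset.sum_range_succ, Finset.sum_range_succ, ih,
      Finset.sum_range_succ, add_assoc]

/-- Dyadic decomposition of the triangle into squares and small triangles on the diagonal. -/
lemma triangle_eq_sum {k : ℝ → ℝ → ℝ} (hk : Measurable (Function.uncurry k)) {H : ℝ}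
    (hH : ∀ s r, |k s r| ≤ H) {t : ℝ} (ht : 0 ≤ t) (N : ℕ) :
    triangle k 0 t = (∑ n ∈ Finset.range N, ∑ j ∈ Finset.range (2 ^ n),
      ∫ s in ((2 * j + 1) * (t / 2 ^ (n + 1)))..((2 * j + 1) * (t / 2 ^ (n + 1)) + t / 2 ^ (n + 1)),
        ∫ r in ((2 * j + 1) * (t / 2 ^ (n + 1)) - t / 2 ^ (n + 1))..
          ((2 * j + 1) * (t / 2 ^ (n + 1))), k s r) +
      ∑ j ∈ Finset.range (2 ^ N), triangle k (j * (t / 2 ^ N)) ((j + 1) * (t / 2 ^ N)) := by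
  induction N with
  | zero => simp
  | succ N ih =>
    rw [ih, Finset.sum_range_succ _ N, add_assoc]
    congr 1
    rw [show Finset.range (2 ^ (N + 1)) = Finset.range (2 * 2 ^ N) by rw [pow_succ'],
      sum_range_two_mul, ← Finset.sum_add_distrib]
    refine Finset.sum_congr rfl fun j _ => ?_
    set L : ℝ := t / 2 ^ (N + 1) with hL
    have hL0 : 0 ≤ L := by positivity
    have h2L : t / 2 ^ N = 2 * L := by rw [hL, pow_succ]; field_simp
    have e1 : (j : ℝ) * (2 * L) = (2 * j + 1) * L - L := by ring
    have e2 : ((j : ℝ) + 1) * (2 * L) = (2 * j + 1) * L + L := by ring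
    have e3 : 2 * (j : ℝ) * L = (2 * j + 1) * L - L := by ring
    have e4 : (2 * (j : ℝ) + 1 + 1) * L = (2 * j + 1) * L + L := by ring
    -- A triangle of side 2L, cut at its midpoint, is a square of side L and the two triangles
    -- numbered 2j and 2j + 1 at the next level.
    rw [h2L, e1, e2, triangle_split hk hH (m := (2 * j + 1) * L) (by linarith) (by linarith)]
    push_cast
    rw [e3, e4, add_comm]

end Triangle

/-! ### Sums of independent squares at one dyadic level -/

section Levels

variable {Ω : Type*} [mΩ : MeasurableSpace Ω] {P : Measure Ω}

lemma eLpNorm_le_of_integral_pow_le [IsFiniteMeasure P] {f : Ω → ℝ} {k : ℕ} (hk : 0 < k)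
    (hf : Integrable (fun ω => f ω ^ (2 * k)) P) {D : ℝ} (hD : 0 ≤ D)
    (h : ∫ ω, f ω ^ (2 * k) ∂P ≤ D ^ (2 * k)) :
    eLpNorm f ((2 * k : ℕ) : ℝ≥0∞) P ≤ ENNReal.ofReal D := by
  have hk2 : ((2 * k : ℕ) : ℝ) ≠ 0 := by positivity
  rw [eLpNorm_eq_lintegral_rpow_enorm_toReal (by simpa using hk.ne')
    (ENNReal.natCast_ne_top _), ENNReal.toReal_natCast]
  have h1 : ∀ ω, ‖f ω‖ₑ ^ ((2 * k : ℕ) : ℝ) = ENNReal.ofReal (f ω ^ (2 * k)) := fun ω => by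
    rw [ENNReal.rpow_natCast, ← ofReal_norm, ← ENNReal.ofReal_pow (norm_nonneg _), Real.norm_eq_abs,
      (even_two_mul k).pow_abs]
  simp_rw [h1]
  rw [← ofReal_integral_eq_lintegral_ofReal hf (ae_of_all _ fun ω => (even_two_mul k).pow_nonneg _)]
  calc ENNReal.ofReal (∫ ω, f ω ^ (2 * k) ∂P) ^ (1 / ((2 * k : ℕ) : ℝ))
      ≤ ENNReal.ofReal (D ^ (2 * k)) ^ (1 / ((2 * k : ℕ) : ℝ)) := by gcongr
    _ = ENNReal.ofReal D := by
      rw [ENNReal.ofReal_pow hD, ← ENNReal.rpow_natCast, ← ENNReal.rpow_mul,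
        mul_one_div_cancel hk2, ENNReal.rpow_one]

variable [IsProbabilityMeasure P]
  {E : Type*} [NormedAddCommGroup E] [InnerProductSpace ℝ E]
  [MeasurableSpace E] [BorelSpace E] [FiniteDimensional ℝ E]
  {g : E → ℝ} {Z : ℝ → Ω → E}

lemma IsRegularProcess.measurable_triangle (hZ : IsRegularProcess P g Z) {h : E → ℝ}
    (hh : Measurable h) {a b : ℝ} (hab : a ≤ b) :
    Measurable fun ω => triangle (fun s r => h (Z s ω - Z r ω)) a b := by
  have h0 := hZ.measurable_uncurry
  have h1 : Measurable fun z : (Ω × ℝ) × ℝ => h (Z z.1.2 z.1.1 - Z z.2 z.1.1) :=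
    hh.comp ((h0.comp ((measurable_snd.comp measurable_fst).prodMk
      (measurable_fst.comp measurable_fst))).sub
      (h0.comp (measurable_snd.prodMk (measurable_fst.comp measurable_fst))))
  have h2 := measurable_setIntegral_Ioc_of_measurable
    (k := fun ω s r => h (Z s ω - Z r ω)) h1 a
  have h3 := h2.stronglyMeasurable.integral_prod_right (ν := volume.restrict (Set.Ioc a b))
    (f := fun (ω : Ω) (s : ℝ) => ∫ r in Set.Ioc a s, h (Z s ω - Z r ω))
  refine (congrArg Measurable (funext fun ω => ?_)).mpr h3.measurable
  simp only [triangle]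
  rw [intervalIntegral.integral_of_le hab]
  refine setIntegral_congr_fun measurableSet_Ioc fun s hs => ?_
  rw [intervalIntegral.integral_of_le hs.1.le]

/-- One level of the dyadic decomposition: a centered sum of `2 ^ n` independent cross terms. -/
lemma IsRegularProcess.abs_integral_level_pow_le (hZ : IsRegularProcess P g Z) {h : E → ℝ}
    (hh : Measurable h) {H : ℝ} (hH : ∀ x, |h x| ≤ H) {L : ℝ} (hL : 0 < L) {K a : ℝ} (hK : 0 < K)
    (ha : 1 ≤ a) (hmom : ∀ m, L ≤ m → ∀ n : ℕ,
      |∫ ω, crossTerm h Z (m - L) m (m + L) ω ^ n ∂P| ≤ K ^ n * (n.factorial : ℝ) ^ a)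
    {N : ℕ} (hN : 0 < N) (n : ℕ) :
    |∫ ω, (∑ j ∈ Finset.range N, (crossTerm h Z ((2 * j + 1) * L - L) ((2 * j + 1) * L)
        ((2 * j + 1) * L + L) ω - ∫ ω', crossTerm h Z ((2 * j + 1) * L - L) ((2 * j + 1) * L)
        ((2 * j + 1) * L + L) ω' ∂P)) ^ n ∂P| ≤
      2 * (2 * (2 * K) * √N) ^ n * (n.factorial : ℝ) ^ a := by
  let R : ℕ → Ω → ℝ := fun j => crossTerm h Z ((2 * j + 1) * L - L) ((2 * j + 1) * L)
        ((2 * j + 1) * L + L)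
  have hRm : ∀ j, Measurable (R j) := fun j =>
    measurable_crossTerm hZ.measurable_uncurry hh (by linarith) (by linarith)
  have hRb : ∀ j ω, |R j ω| ≤ H * L * L := fun j ω => by
    refine (abs_crossTerm_le hH (by linarith) (by linarith) ω).trans_eq ?_
    ring
  have hjL : ∀ j : ℕ, L ≤ (2 * j + 1) * L := fun j => by
    have : (0 : ℝ) ≤ j := Nat.cast_nonneg j
    nlinarith
  have hRi : ∀ j, Integrable (R j) P := fun j => by
    simpa using integrable_pow_of_bounded (P := P) (hRm j) (hRb j) 1
  have hEb : ∀ j, |∫ ω, R j ω ∂P| ≤ H * L * L := fun j => by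
    have := norm_integral_le_of_norm_le_const (μ := P) (ae_of_all _ fun ω =>
      (Real.norm_eq_abs _).trans_le (hRb j ω))
    simpa using this
  refine abs_integral_sum_pow_le (P := P) (Y := fun j ω => R j ω - ∫ ω', R j ω' ∂P)
    (fun j => (hRm j).sub_const _) (M := 2 * (H * L * L)) (K := 2 * K) (fun j ω => ?_)
    (by positivity) ha (fun j => ?_) (fun j m => ?_) (fun k _ => ?_) hN n
  · refine (abs_sub _ _).trans ?_
    linarith [hRb j ω, hEb j]
  · rw [integral_sub (hRi j) (integrable_const _)]
    simp
  · exact abs_integral_centered_pow_le (hRm j) (hRb j) hK.le ha (hmom _ (hjL j)) m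
  -- The separating time is 2kL: blocks with j < k end at (2j + 2)L ≤ 2kL, and block k starts there.
  · refine indepFun_of_indep_of_measurable
      (indep_past_future hZ.measurable hZ.indep (2 * k * L)) ?_ ?_
    · refine @Finset.measurable_fun_sum _ _ _ _ _ _ (past Z (2 * k * L)) _ _ fun j hj => ?_
      refine (measurable_id.sub_const _).comp
        (hZ.measurable_past_crossTerm hh (by linarith) (by linarith) ?_)
      have : (j : ℝ) + 1 ≤ k := by exact_mod_cast Finset.mem_range.1 hj
      nlinarith
    · refine (measurable_id.sub_const _).comp ?_
      have := hZ.measurable_future_crossTerm hh (a := (2 * k + 1) * L - L) (m := (2 * k + 1) * L)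
        (b := (2 * k + 1) * L + L) (by linarith) (by linarith)
      rwa [show ((2 * k + 1) * L - L : ℝ) = 2 * k * L by ring] at this ⊢

end Levels

end StableSelfIntersection

namespace StableSelfIntersection

/-! ### Summation over the dyadic levels -/

section TriangleMoments

variable {Ω : Type*} [mΩ : MeasurableSpace Ω] {P : Measure Ω} [IsProbabilityMeasure P]

lemma eLpNorm_le_of_forall_abs_le {f : Ω → ℝ} {C : ℝ} (hC : ∀ ω, |f ω| ≤ C) (p : ℝ≥0∞) :
    eLpNorm f p P ≤ ENNReal.ofReal C := by
  refine (eLpNorm_le_of_ae_bound (C := C) (ae_of_all _ fun ω => ?_)).trans_eq (by simp)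
  rw [Real.norm_eq_abs]
  exact hC ω

lemma integrable_of_forall_abs_le {f : Ω → ℝ} (hf : Measurable f) {C : ℝ} (hC : ∀ ω, |f ω| ≤ C) :
    Integrable f P :=
  Integrable.of_bound hf.aestronglyMeasurable C (ae_of_all _ fun ω => by
    rw [Real.norm_eq_abs]; exact hC ω)

lemma abs_sub_integral_le {f : Ω → ℝ} {C : ℝ} (hC : ∀ ω, |f ω| ≤ C) (ω : Ω) :
    |f ω - ∫ ω', f ω' ∂P| ≤ 2 * C := by
  have h : |∫ ω', f ω' ∂P| ≤ C := by
    have := norm_integral_le_of_norm_le_const (μ := P) (ae_of_all _ fun ω =>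
      (Real.norm_eq_abs _).trans_le (hC ω))
    simpa using this
  refine (abs_sub _ _).trans ?_
  linarith [hC ω]

variable {E : Type*} [NormedAddCommGroup E] [InnerProductSpace ℝ E]
  [MeasurableSpace E] [BorelSpace E] [FiniteDimensional ℝ E]
  {g : E → ℝ} {Z : ℝ → Ω → E}

/-- Even exponents turn bounds on signed moments into norm bounds. The leading factor 2 is at most
2^(2k), which is why 4K becomes 8K. -/
lemma IsRegularProcess.eLpNorm_level_le (hZ : IsRegularProcess P g Z) {h : E → ℝ}
    (hh : Measurable h) {H : ℝ} (hH : ∀ x, |h x| ≤ H) {L : ℝ} (hL : 0 < L) {K a : ℝ} (hK : 0 < K)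
    (ha : 1 ≤ a) (hmom : ∀ m, L ≤ m → ∀ n : ℕ,
      |∫ ω, crossTerm h Z (m - L) m (m + L) ω ^ n ∂P| ≤ K ^ n * (n.factorial : ℝ) ^ a)
    {N : ℕ} (hN : 0 < N) {k : ℕ} (hk : 0 < k) :
    eLpNorm (fun ω => ∑ j ∈ Finset.range N, (crossTerm h Z ((2 * j + 1) * L - L) ((2 * j + 1) * L)
        ((2 * j + 1) * L + L) ω - ∫ ω', crossTerm h Z ((2 * j + 1) * L - L) ((2 * j + 1) * L)
        ((2 * j + 1) * L + L) ω' ∂P)) ((2 * k : ℕ) : ℝ≥0∞) P ≤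
      ENNReal.ofReal (8 * K * √N * ((2 * k).factorial : ℝ) ^ (a / (2 * k : ℕ))) := by
  have hk2 : ((2 * k : ℕ) : ℝ) ≠ 0 := by positivity
  have hRb : ∀ (j : ℕ) ω, |crossTerm h Z ((2 * j + 1) * L - L) ((2 * j + 1) * L)
        ((2 * j + 1) * L + L) ω| ≤ H * L * L := fun j ω => by
    refine (abs_crossTerm_le hH (by linarith) (by linarith) ω).trans_eq ?_
    ring
  have hm : Measurable fun ω => ∑ j ∈ Finset.range N,
      (crossTerm h Z ((2 * j + 1) * L - L) ((2 * j + 1) * L)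
        ((2 * j + 1) * L + L) ω - ∫ ω', crossTerm h Z ((2 * j + 1) * L - L) ((2 * j + 1) * L)
        ((2 * j + 1) * L + L) ω' ∂P) := Finset.measurable_fun_sum _ fun j _ =>
    (measurable_crossTerm hZ.measurable_uncurry hh (by linarith) (by linarith)).sub_const _
  refine eLpNorm_le_of_integral_pow_le hk (integrable_pow_of_bounded hm
    (M := N * (2 * (H * L * L))) (fun ω => ?_) _) (by positivity) ?_
  · refine (Finset.abs_sum_le_sum_abs _ _).trans ?_
    refine (Finset.sum_le_card_nsmul _ _ _ fun j _ =>
      abs_sub_integral_le (P := P) (hRb j) ω).trans_eq ?_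
    simp
  · refine (le_abs_self _).trans ((hZ.abs_integral_level_pow_le hh hH hL hK ha hmom hN
      (2 * k)).trans ?_)
    have h1 : (((2 * k).factorial : ℝ) ^ (a / (2 * k : ℕ))) ^ (2 * k) =
        ((2 * k).factorial : ℝ) ^ a := by
      rw [← Real.rpow_mul_natCast (by positivity), div_mul_cancel₀ _ hk2]
    rw [mul_pow (8 * K * √N) _ (2 * k), h1]
    gcongr
    calc 2 * (2 * (2 * K) * √(N : ℝ)) ^ (2 * k)
        ≤ 2 ^ (2 * k) * (2 * (2 * K) * √(N : ℝ)) ^ (2 * k) := by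
          gcongr
          exact le_self_pow₀ (by norm_num) (by omega)
      _ = (8 * K * √N) ^ (2 * k) := by rw [← mul_pow]; ring

/-- The size of one square gains 2^(−n(2−a)) and the √(2^n) of the independent sum loses 2^(n/2).
The resulting ratio 2^(a − 3/2) is below 1 exactly when a < 3/2. -/
lemma dyadic_level_scale_le {a t : ℝ} (ha : a ≤ 2) (ht : 0 < t) (n : ℕ) :
    (t / 2 ^ (n + 1)) ^ (2 - a) * √((2 ^ n : ℕ) : ℝ) ≤ t ^ (2 - a) * ((2 : ℝ) ^ (a - 3 / 2)) ^ n := by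
  have h1 : (t / 2 ^ (n + 1)) ^ (2 - a) ≤ (t / 2 ^ n) ^ (2 - a) := by
    have : t / 2 ^ (n + 1) ≤ t / 2 ^ n := by
      gcongr
      · norm_num
      · omega
    exact Real.rpow_le_rpow (by positivity) this (by linarith)
  calc (t / 2 ^ (n + 1)) ^ (2 - a) * √((2 ^ n : ℕ) : ℝ)
      ≤ (t / 2 ^ n) ^ (2 - a) * √((2 ^ n : ℕ) : ℝ) := by gcongr
    _ = t ^ (2 - a) * ((2 : ℝ) ^ (a - 3 / 2)) ^ n := by
      rw [Real.div_rpow ht.le (by positivity), Real.sqrt_eq_rpow, Nat.cast_pow, Nat.cast_ofNat,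
        ← Real.rpow_natCast, ← Real.rpow_mul (by norm_num), ← Real.rpow_mul (by norm_num),
        ← Real.rpow_natCast, ← Real.rpow_mul (by norm_num), div_mul_eq_mul_div, mul_div_assoc,
        ← Real.rpow_sub (by norm_num)]
      congr 2
      ring

/-- Moment bound for the centered triangle integral. -/
lemma exists_eLpNorm_triangle_le {c β ρ : ℝ} (hc : 0 < c) (hβ : 0 < β)
    (hρ : 0 < ρ) (hd : (Module.finrank ℝ E : ℝ) < 2 * β - 2 * ρ)
    (h1 : 1 ≤ (Module.finrank ℝ E + ρ) / β) (h2 : (Module.finrank ℝ E + ρ) / β < 3 / 2) :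
    ∃ K : ℝ, 0 < K ∧ ∀ (g : E → ℝ) (Z : ℝ → Ω → E), IsRegularProcess P g Z →
      (∀ q, g q = c * ‖q‖ ^ β) → ∀ (h : E → ℝ) (G : E → ℂ), Measurable h →
      (∃ H, ∀ x, |h x| ≤ H) → Integrable G →
      (∀ x, (h x : ℂ) = ∫ p, G p * wave p x) → ∀ B : ℝ, 0 < B → (∀ p, ‖G p‖ ≤ B * ‖p‖ ^ ρ) →
      ∀ t : ℝ, 0 < t → ∀ k : ℕ, 0 < k →
      eLpNorm (fun ω => triangle (fun s r => h (Z s ω - Z r ω)) 0 t -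
        ∫ ω', triangle (fun s r => h (Z s ω' - Z r ω')) 0 t ∂P) ((2 * k : ℕ) : ℝ≥0∞) P ≤
      ENNReal.ofReal (K * B * t ^ (2 - (Module.finrank ℝ E + ρ) / β) *
        ((2 * k).factorial : ℝ) ^ ((Module.finrank ℝ E + ρ) / β / (2 * k : ℕ))) := by
  obtain ⟨K, hK, hmom⟩ := IsRegularProcess.exists_abs_integral_crossTerm_pow_le (P := P) (E := E)
    hc hβ hρ hd
  set a : ℝ := (Module.finrank ℝ E + ρ) / β with ha
  set r : ℝ := (2 : ℝ) ^ (a - 3 / 2) with hr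
  have hr0 : 0 < r := by positivity
  have ha2 : a ≤ 2 := by linarith
  have hr1 : r < 1 := Real.rpow_lt_one_of_one_lt_of_neg (by norm_num) (by linarith)
  have h1r : 0 < 1 - r := by linarith
  refine ⟨8 * K * (1 - r)⁻¹, by positivity, fun g Z hZ hg h G hh hHe hG hGh B hB hGB t ht k hk
    => ?_⟩
  obtain ⟨H, hH⟩ := hHe
  have hH0 : 0 ≤ H := (abs_nonneg _).trans (hH 0)
  set F : ℝ := ((2 * k).factorial : ℝ) ^ (a / (2 * k : ℕ)) with hF
  have hF0 : 0 < F := by positivity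
  let k' : Ω → ℝ → ℝ → ℝ := fun ω s r => h (Z s ω - Z r ω)
  have hk'H : ∀ ω s r, |k' ω s r| ≤ H := fun ω s r => hH _
  have hk'm : ∀ ω, Measurable (Function.uncurry (k' ω)) := fun ω => by
    have hZω : Measurable fun s => Z s ω := hZ.measurable_uncurry.comp measurable_prodMk_right
    exact hh.comp ((hZω.comp measurable_fst).sub (hZω.comp measurable_snd))
  let C : ℕ → ℕ → Ω → ℝ := fun n j => crossTerm h Z
    ((2 * j + 1) * (t / 2 ^ (n + 1)) - t / 2 ^ (n + 1)) ((2 * j + 1) * (t / 2 ^ (n + 1)))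
    ((2 * j + 1) * (t / 2 ^ (n + 1)) + t / 2 ^ (n + 1))
  let D : ℕ → Ω → ℝ := fun N ω => ∑ j ∈ Finset.range (2 ^ N),
    triangle (k' ω) (j * (t / 2 ^ N)) ((j + 1) * (t / 2 ^ N))
  have hLpos : ∀ n : ℕ, 0 < t / 2 ^ n := fun n => by positivity
  have hCm : ∀ n j, Measurable (C n j) := fun n j =>
    measurable_crossTerm hZ.measurable_uncurry hh (by linarith [hLpos (n + 1)])
      (by linarith [hLpos (n + 1)])
  have hCb : ∀ n j ω, |C n j ω| ≤ H * (t / 2 ^ (n + 1)) * (t / 2 ^ (n + 1)) := fun n j ω => by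
    refine (abs_crossTerm_le hH (by linarith [hLpos (n + 1)])
      (by linarith [hLpos (n + 1)]) ω).trans_eq ?_
    ring
  have hCi : ∀ n j, Integrable (C n j) P := fun n j =>
    integrable_of_forall_abs_le (hCm n j) (hCb n j)
  have hDm : ∀ N, Measurable (D N) := fun N => Finset.measurable_fun_sum _ fun j _ =>
    hZ.measurable_triangle hh (by nlinarith [hLpos N])
  have hDb : ∀ N ω, |D N ω| ≤ H * t * t / 2 ^ N := fun N ω => by
    refine (Finset.abs_sum_le_sum_abs _ _).trans ?_
    refine (Finset.sum_le_card_nsmul _ _ (H * (t / 2 ^ N) * (t / 2 ^ N)) fun j _ => ?_).trans_eq ?_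
    · refine (abs_triangle_le (hk'H ω) (by nlinarith [hLpos N])).trans_eq ?_
      ring
    · rw [Finset.card_range, nsmul_eq_mul]
      push_cast
      field_simp
  have hDi : ∀ N, Integrable (D N) P := fun N => integrable_of_forall_abs_le (hDm N) (hDb N)
  have hdec : ∀ N ω, triangle (k' ω) 0 t =
      (∑ n ∈ Finset.range N, ∑ j ∈ Finset.range (2 ^ n), C n j ω) + D N ω := fun N ω =>
    triangle_eq_sum (hk'm ω) (hk'H ω) ht.le N
  have hint : ∀ N, ∫ ω, triangle (k' ω) 0 t ∂P =
      (∑ n ∈ Finset.range N, ∑ j ∈ Finset.range (2 ^ n), ∫ ω, C n j ω ∂P) + ∫ ω, D N ω ∂P := by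
    intro N
    simp_rw [hdec N]
    rw [integral_add (integrable_finsetSum _ fun n _ => integrable_finsetSum _ fun j _ => hCi n j)
      (hDi N), integral_finsetSum _ fun n _ => integrable_finsetSum _ fun j _ => hCi n j]
    congr 1
    exact Finset.sum_congr rfl fun n _ => integral_finsetSum _ fun j _ => hCi n j
  let S : ℕ → Ω → ℝ := fun n ω => ∑ j ∈ Finset.range (2 ^ n), (C n j ω - ∫ ω', C n j ω' ∂P)
  have hSm : ∀ n, Measurable (S n) := fun n => Finset.measurable_fun_sum _ fun j _ =>
    (hCm n j).sub_const _
  have hcent : ∀ N, (fun ω => triangle (k' ω) 0 t - ∫ ω', triangle (k' ω') 0 t ∂P) =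
      (∑ n ∈ Finset.range N, S n) + fun ω => D N ω - ∫ ω', D N ω' ∂P := by
    intro N
    ext ω
    rw [hint N, hdec N ω]
    simp only [Pi.add_apply, Finset.sum_apply, S, Finset.sum_sub_distrib]
    ring
  have hSn : ∀ n, eLpNorm (S n) ((2 * k : ℕ) : ℝ≥0∞) P ≤
      ENNReal.ofReal (8 * K * B * t ^ (2 - a) * F * r ^ n) := by
    intro n
    have hKn : 0 < K * B * (t / 2 ^ (n + 1)) ^ (2 - a) := by positivity
    refine (hZ.eLpNorm_level_le hh hH (hLpos (n + 1)) hKn h1 (fun m hm i =>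
      hmom g Z hZ hg h G hG hGh B hB.le hGB m _ (hLpos (n + 1)) hm i)
      (N := 2 ^ n) (by positivity) hk).trans (ENNReal.ofReal_le_ofReal ?_)
    calc 8 * (K * B * (t / 2 ^ (n + 1)) ^ (2 - a)) * √((2 ^ n : ℕ) : ℝ) * F
        = 8 * K * B * F * ((t / 2 ^ (n + 1)) ^ (2 - a) * √((2 ^ n : ℕ) : ℝ)) := by ring
      _ ≤ 8 * K * B * F * (t ^ (2 - a) * r ^ n) := by
        exact mul_le_mul_of_nonneg_left (dyadic_level_scale_le ha2 ht n) (by positivity)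
      _ = _ := by ring
  have hp1 : (1 : ℝ≥0∞) ≤ ((2 * k : ℕ) : ℝ≥0∞) := by
    exact_mod_cast (by omega : 1 ≤ 2 * k)
  have hbound : ∀ N : ℕ,
      eLpNorm (fun ω => triangle (k' ω) 0 t - ∫ ω', triangle (k' ω') 0 t ∂P)
        ((2 * k : ℕ) : ℝ≥0∞) P ≤
      ENNReal.ofReal (8 * K * (1 - r)⁻¹ * B * t ^ (2 - a) * F + 2 * (H * t * t / 2 ^ N)) := by
    intro N
    rw [hcent N, ENNReal.ofReal_add (by positivity) (by positivity)]
    refine (eLpNorm_add_le (Finset.aestronglyMeasurable_sum _ fun n _ =>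
      (hSm n).aestronglyMeasurable) ((hDm N).sub_const _).aestronglyMeasurable hp1).trans
      (add_le_add ?_ (eLpNorm_le_of_forall_abs_le (abs_sub_integral_le (hDb N)) _))
    refine (eLpNorm_sum_le (fun n _ => (hSm n).aestronglyMeasurable) hp1).trans ?_
    refine (Finset.sum_le_sum fun n _ => hSn n).trans ?_
    rw [← ENNReal.ofReal_sum_of_nonneg fun n _ => by positivity]
    refine ENNReal.ofReal_le_ofReal ?_
    rw [← Finset.mul_sum]
    calc 8 * K * B * t ^ (2 - a) * F * ∑ i ∈ Finset.range N, r ^ i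
        ≤ 8 * K * B * t ^ (2 - a) * F * (1 - r)⁻¹ := by
          gcongr
          rw [← tsum_geometric_of_lt_one hr0.le hr1]
          exact (summable_geometric_of_lt_one hr0.le hr1).sum_le_tsum _
            fun i _ => by positivity
      _ = _ := by ring
  -- The diagonal remainder is the only term involving the sup bound `H`, which for the rescaled
  -- mollifier is not uniform in ε; letting N grow removes it.
  have hlim : Tendsto (fun N : ℕ => ENNReal.ofReal
      (8 * K * (1 - r)⁻¹ * B * t ^ (2 - a) * F + 2 * (H * t * t / 2 ^ N))) atTop
      (𝓝 (ENNReal.ofReal (8 * K * (1 - r)⁻¹ * B * t ^ (2 - a) * F + 2 * 0))) := by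
    refine ENNReal.tendsto_ofReal (tendsto_const_nhds.add (Tendsto.const_mul 2 ?_))
    exact tendsto_const_nhds.div_atTop (tendsto_pow_atTop_atTop_of_one_lt (by norm_num))
  rw [mul_zero, add_zero] at hlim
  exact ge_of_tendsto' hlim hbound

end TriangleMoments

end StableSelfIntersection

namespace StableSelfIntersection

/-! ### Fourier amplitudes and regularity of the rescaled mollifier -/

section Mollifier

variable {d : ℕ}

/-- A Schwartz function is the superposition of plane waves with a bounded Lipschitz integrable
amplitude. -/
lemma exists_fourier_amplitude (f : 𝓢(EuclideanSpace ℝ (Fin d), ℝ)) :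
    ∃ F : EuclideanSpace ℝ (Fin d) → ℂ, Integrable F ∧ (∃ M, ∀ p, ‖F p‖ ≤ M) ∧
      (∃ M, ∀ p q, ‖F p - F q‖ ≤ M * ‖p - q‖) ∧ ∀ x, (f x : ℂ) = ∫ p, F p * wave p x := by
  let f' : 𝓢(EuclideanSpace ℝ (Fin d), ℂ) := f.postcompCLM Complex.ofRealCLM
  let F : 𝓢(EuclideanSpace ℝ (Fin d), ℂ) := FourierTransform.fourier f'
  refine ⟨F, F.integrable, ⟨_, F.norm_le_seminorm ℝ⟩, ⟨SchwartzMap.seminorm ℝ 0 1 F, fun p q => ?_⟩,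
    fun x => ?_⟩
  · refine Convex.norm_image_sub_le_of_norm_fderiv_le (s := Set.univ) (𝕜 := ℝ)
      (fun y _ => F.differentiableAt) (fun y _ => ?_) convex_univ (Set.mem_univ q) (Set.mem_univ p)
    rw [← norm_iteratedFDeriv_one]
    exact F.norm_iteratedFDeriv_le_seminorm ℝ 1 y
  · have h1 : f' = FourierTransformInv.fourierInv F :=
      (FourierTransform.fourierInv_fourier_eq f').symm
    have h2 : (f x : ℂ) = f' x := rfl
    rw [h2, h1, SchwartzMap.fourierInv_coe, Real.fourierInv_eq']
    refine integral_congr_ae (ae_of_all _ fun p => ?_)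
    simp only [wave, smul_eq_mul]
    rw [mul_comm]

lemma rescale_eq_integral {f : EuclideanSpace ℝ (Fin d) → ℝ} {F : EuclideanSpace ℝ (Fin d) → ℂ}
    (hF : ∀ x, (f x : ℂ) = ∫ p, F p * wave p x) {ε : ℝ} (hε : 0 < ε)
    (x : EuclideanSpace ℝ (Fin d)) : (rescale f ε x : ℂ) = ∫ p, F (ε • p) * wave p x := by
  have h1 : ∀ p, F (ε • p) * wave p x = F (ε • p) * wave (ε • p) (ε⁻¹ • x) := fun p => by
    simp only [wave]
    rw [real_inner_smul_left, real_inner_smul_right, mul_inv_cancel_left₀ hε.ne']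
  simp_rw [h1]
  rw [Measure.integral_comp_smul volume (fun q => F q * wave q (ε⁻¹ • x)), ← hF, finrank_euclideanSpace_fin, abs_of_pos (by positivity)]
  simp only [rescale]
  push_cast
  rw [Complex.real_smul]
  push_cast
  ring

/-- The Lipschitz bound serves at distance at most 1 and boundedness beyond. The exponent ρ is what
converts a difference of scales into |ε − ε'|^ρ ‖p‖^ρ. -/
lemma exists_holder_of_bounded_lipschitz {E : Type*} [NormedAddCommGroup E] {F : E → ℂ} {M M' : ℝ}
    (hM : ∀ p, ‖F p‖ ≤ M) (hM' : ∀ p q, ‖F p - F q‖ ≤ M' * ‖p - q‖) {ρ : ℝ} (hρ : 0 < ρ)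
    (hρ1 : ρ ≤ 1) : ∃ B, 0 < B ∧ ∀ p q, ‖F p - F q‖ ≤ B * ‖p - q‖ ^ ρ := by
  refine ⟨|M'| + 2 * |M| + 1, by positivity, fun p q => ?_⟩
  have h0 : 0 ≤ ‖p - q‖ ^ ρ := by positivity
  rcases le_total ‖p - q‖ 1 with h | h
  · have h1 : ‖p - q‖ ≤ ‖p - q‖ ^ ρ := by
      rcases (norm_nonneg (p - q)).eq_or_lt with h' | h'
      · rw [← h', Real.zero_rpow hρ.ne']
      · simpa using Real.rpow_le_rpow_of_exponent_ge h' h hρ1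
    calc ‖F p - F q‖ ≤ |M'| * ‖p - q‖ := (hM' p q).trans (by gcongr; exact le_abs_self _)
      _ ≤ |M'| * ‖p - q‖ ^ ρ := by gcongr
      _ ≤ _ := by gcongr; linarith [abs_nonneg M]
  · have h1 : 1 ≤ ‖p - q‖ ^ ρ := Real.one_le_rpow h hρ.le
    calc ‖F p - F q‖ ≤ 2 * |M| := by
          linarith [norm_sub_le (F p) (F q), hM p, hM q, le_abs_self M]
      _ ≤ 2 * |M| * ‖p - q‖ ^ ρ := le_mul_of_one_le_right (by positivity) h1
      _ ≤ _ := by gcongr; linarith [abs_nonneg M']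

/-- Amplitude of the difference of two rescalings. -/
lemma exists_rescale_sub_amplitude (f : 𝓢(EuclideanSpace ℝ (Fin d), ℝ)) {ρ : ℝ} (hρ : 0 < ρ)
    (hρ1 : ρ ≤ 1) : ∃ B, 0 < B ∧ ∀ ε ε' : ℝ, 0 < ε → 0 < ε' →
      ∃ G : EuclideanSpace ℝ (Fin d) → ℂ, Integrable G ∧
        (∀ x, ((rescale f ε x - rescale f ε' x : ℝ) : ℂ) = ∫ p, G p * wave p x) ∧
        ∀ p, ‖G p‖ ≤ B * |ε - ε'| ^ ρ * ‖p‖ ^ ρ := by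
  obtain ⟨F, hFi, ⟨M, hM⟩, ⟨M', hM'⟩, hF⟩ := exists_fourier_amplitude f
  obtain ⟨B, hB, hBF⟩ := exists_holder_of_bounded_lipschitz hM hM' hρ hρ1
  have hint : ∀ ε : ℝ, 0 < ε → Integrable fun p => F (ε • p) := fun ε hε =>
    (integrable_comp_smul_iff volume F hε.ne').2 hFi
  have hintw : ∀ ε : ℝ, 0 < ε → ∀ x, Integrable fun p => F (ε • p) * wave p x := fun ε hε x =>
    (hint ε hε).mul_bdd (c := 1)
      (measurable_wave measurable_id measurable_const).aestronglyMeasurable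
      (ae_of_all _ fun p => (norm_wave _ _).le)
  refine ⟨B, hB, fun ε ε' hε hε' => ⟨fun p => F (ε • p) - F (ε' • p),
    (hint ε hε).sub (hint ε' hε'), fun x => ?_, fun p => ?_⟩⟩
  · simp_rw [sub_mul]
    rw [integral_sub (hintw ε hε x) (hintw ε' hε' x), ← rescale_eq_integral hF hε,
      ← rescale_eq_integral hF hε', Complex.ofReal_sub]
  · refine (hBF _ _).trans_eq ?_
    rw [← sub_smul, norm_smul, Real.norm_eq_abs, Real.mul_rpow (abs_nonneg _) (norm_nonneg _),
      mul_assoc]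

lemma measurable_rescale (f : 𝓢(EuclideanSpace ℝ (Fin d), ℝ)) (ε : ℝ) :
    Measurable (rescale f ε) := by
  have : Continuous (rescale f ε) :=
    (f.continuous.comp (continuous_const_smul _)).div_const _
  exact this.measurable

lemma exists_abs_rescale_le (f : 𝓢(EuclideanSpace ℝ (Fin d), ℝ)) {ε : ℝ} (hε : 0 < ε) :
    ∃ H, ∀ x, |rescale f ε x| ≤ H := by
  refine ⟨SchwartzMap.seminorm ℝ 0 0 f / ε ^ d, fun x => ?_⟩
  rw [rescale, abs_div, abs_of_pos (by positivity : 0 < ε ^ d)]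
  gcongr
  exact f.norm_le_seminorm ℝ _

/-- In the variable `w = ε ^ (-2d)` the rescaled function has a derivative of order
`w ^ (-1/2)`, uniformly in space. -/
lemma exists_abs_rescale_sub_le (hd : 0 < d) (f : 𝓢(EuclideanSpace ℝ (Fin d), ℝ)) :
    ∃ C : ℝ, 0 ≤ C ∧ ∀ (n : ℕ) (w : ℝ), 0 < n → n ≤ w → w ≤ n + 1 → ∀ x,
      |rescale f (w ^ (-(1 / (2 * d : ℝ)))) x - rescale f ((n : ℝ) ^ (-(1 / (2 * d : ℝ)))) x| ≤
        C / √n := by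
  have hdR : (0 : ℝ) < d := by exact_mod_cast hd
  set a : ℝ := 1 / (2 * d : ℝ) with ha
  have ha0 : 0 < a := by positivity
  set M₀ := SchwartzMap.seminorm ℝ 0 0 f with hM₀
  set M₁ := SchwartzMap.seminorm ℝ 1 1 f with hM₁
  have hM₀0 : 0 ≤ M₀ := apply_nonneg _ _
  have hM₁0 : 0 ≤ M₁ := apply_nonneg _ _
  have hres : ∀ w : ℝ, 0 < w → ∀ x, rescale f (w ^ (-a)) x = √w * f (w ^ a • x) := by
    intro w hw x
    have h1 : (w ^ (-a)) ^ d = (√w)⁻¹ := by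
      rw [← Real.rpow_mul_natCast hw.le, Real.sqrt_eq_rpow, ← Real.rpow_neg hw.le]
      congr 1
      rw [ha]
      field_simp
    rw [rescale, h1, Real.rpow_neg hw.le, inv_inv, div_inv_eq_mul, mul_comm]
  refine ⟨M₀ / 2 + a * M₁, by positivity, fun n w hn hnw hwn x => ?_⟩
  have hnR : (0 : ℝ) < n := by exact_mod_cast hn
  rw [hres w (hnR.trans_le hnw), hres n hnR]
  have hder : ∀ v ∈ Set.Icc (n : ℝ) (n + 1), HasDerivWithinAt (fun v : ℝ => √v * f (v ^ a • x))
      (1 / (2 * √v) * f (v ^ a • x) + √v * fderiv ℝ f (v ^ a • x) ((a * v ^ (a - 1)) • x))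
      (Set.Icc (n : ℝ) (n + 1)) v := by
    intro v hv
    have hv0 : 0 < v := hnR.trans_le hv.1
    have h1 : HasDerivAt (fun v : ℝ => √v) (1 / (2 * √v)) v := Real.hasDerivAt_sqrt hv0.ne'
    have h2 : HasDerivAt (fun v : ℝ => v ^ a • x) ((a * v ^ (a - 1)) • x) v :=
      (Real.hasDerivAt_rpow_const (Or.inl hv0.ne')).smul_const x
    have h3 : HasDerivAt (fun v : ℝ => f (v ^ a • x))
        (fderiv ℝ f (v ^ a • x) ((a * v ^ (a - 1)) • x)) v :=
      (f.differentiableAt.hasFDerivAt (x := v ^ a • x)).comp_hasDerivAt v h2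
    exact (h1.mul h3).hasDerivWithinAt
  have hbd : ∀ v ∈ Set.Icc (n : ℝ) (n + 1),
      ‖1 / (2 * √v) * f (v ^ a • x) + √v * fderiv ℝ f (v ^ a • x) ((a * v ^ (a - 1)) • x)‖ ≤
        (M₀ / 2 + a * M₁) / √n := by
    intro v hv
    have hv0 : 0 < v := hnR.trans_le hv.1
    have hsv : 0 < √v := Real.sqrt_pos.2 hv0
    have hsn : 0 < √(n : ℝ) := Real.sqrt_pos.2 hnR
    have hss : √(n : ℝ) ≤ √v := Real.sqrt_le_sqrt hv.1
    have h1 : |f (v ^ a • x)| ≤ M₀ := f.norm_le_seminorm ℝ _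
    have h2 : |fderiv ℝ f (v ^ a • x) (v ^ a • x)| ≤ M₁ := by
      refine ((fderiv ℝ f (v ^ a • x)).le_opNorm _).trans ?_
      have := f.le_seminorm ℝ 1 1 (v ^ a • x)
      rw [norm_iteratedFDeriv_one, pow_one] at this
      rwa [mul_comm]
    -- The velocity of v^a x is a/v times the point v^a x itself, so only the radial derivative of
    -- `f` at that point occurs, and a Schwartz seminorm bounds it uniformly in `x`.
    have h3 : √v * fderiv ℝ f (v ^ a • x) ((a * v ^ (a - 1)) • x) =
        a / √v * fderiv ℝ f (v ^ a • x) (v ^ a • x) := by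
      have h4 : (a * v ^ (a - 1)) • x = (a / v) • (v ^ a • x) := by
        rw [smul_smul, Real.rpow_sub_one hv0.ne']
        congr 1
        ring
      rw [h4, map_smul, smul_eq_mul, ← mul_assoc]
      congr 1
      rw [mul_div_assoc', div_eq_div_iff hv0.ne' hsv.ne']
      nlinarith [Real.mul_self_sqrt hv0.le]
    rw [h3, Real.norm_eq_abs]
    calc |1 / (2 * √v) * f (v ^ a • x) + a / √v * fderiv ℝ f (v ^ a • x) (v ^ a • x)|
        ≤ 1 / (2 * √v) * |f (v ^ a • x)| + a / √v * |fderiv ℝ f (v ^ a • x) (v ^ a • x)| := by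
          refine (abs_add_le _ _).trans_eq ?_
          rw [abs_mul, abs_mul, abs_of_pos (by positivity : 0 < 1 / (2 * √v)),
            abs_of_pos (by positivity : 0 < a / √v)]
      _ ≤ 1 / (2 * √v) * M₀ + a / √v * M₁ := by gcongr
      _ = (M₀ / 2 + a * M₁) / √v := by field_simp
      _ ≤ _ := by gcongr
  have hmvt := Convex.norm_image_sub_le_of_norm_hasDerivWithin_le hder hbd (convex_Icc _ _)
    (Set.left_mem_Icc.2 (by linarith)) (show w ∈ Set.Icc (n : ℝ) (n + 1) from ⟨hnw, hwn⟩)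
  rw [Real.norm_eq_abs] at hmvt
  refine hmvt.trans (mul_le_of_le_one_right (by positivity) ?_)
  rw [Real.norm_eq_abs, abs_le]
  constructor <;> linarith

end Mollifier

/-! ### A version with all paths right continuous, on the whole line -/

section Version

variable {Ω : Type*} [MeasurableSpace Ω] {P : Measure Ω} [IsProbabilityMeasure P] {d : ℕ}

/-- A Lévy process with a symmetric stable exponent agrees, off a null set, with a regular process
on the real line. -/
lemma exists_isRegularProcess {β : ℝ} {ψ : EuclideanSpace ℝ (Fin d) → ℝ} {c : ℝ}
    (hc : ∀ p, c * ‖p‖ ^ β ≤ ψ p) {X : ℝ≥0 → Ω → EuclideanSpace ℝ (Fin d)}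
    (hX : IsLevyProcessWithExponent ψ X P) :
    ∃ Z : ℝ → Ω → EuclideanSpace ℝ (Fin d),
      IsRegularProcess P (fun q => c * (2 * Real.pi) ^ β * ‖q‖ ^ β) Z ∧
      ∀ᵐ ω ∂P, ∀ s : ℝ, Z s ω = X s.toNNReal ω := by
  classical
  set N : Set Ω := toMeasurable P {ω | ¬ IsCadlagPath fun t => X t ω} with hN
  have hNm : MeasurableSet N := measurableSet_toMeasurable _ _
  have hN0 : P N = 0 := by
    rw [hN, measure_toMeasurable]
    exact ae_iff.1 hX.cadlag
  have hcad : ∀ ω, ω ∉ N → IsCadlagPath fun t => X t ω := fun ω hω => by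
    by_contra h
    exact hω (subset_toMeasurable _ _ h)
  -- The path is set to zero on a measurable null set containing the irregular paths, and is
  -- constant at negative times.
  let Z : ℝ → Ω → EuclideanSpace ℝ (Fin d) := fun s => N.piecewise (fun _ => 0) (X s.toNNReal)
  have hZX : ∀ᵐ ω ∂P, ∀ s : ℝ, Z s ω = X s.toNNReal ω := by
    have : ∀ᵐ ω ∂P, ω ∉ N := measure_eq_zero_iff_ae_notMem.1 hN0
    filter_upwards [this] with ω hω s
    exact Set.piecewise_eq_of_notMem _ _ _ hω
  refine ⟨Z, ⟨fun s => Measurable.piecewise hNm measurable_const (hX.measurable _),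
    fun ω s => ?_, fun n t ht => ?_, fun τ σ hτ hσ q => ?_⟩, hZX⟩
  · by_cases hω : ω ∈ N
    · have : (fun u => Z u ω) = fun _ => 0 := funext fun u => Set.piecewise_eq_of_mem _ _ _ hω
      rw [this]
      exact continuousWithinAt_const
    · have : (fun u => Z u ω) = (fun t => X t ω) ∘ Real.toNNReal :=
        funext fun u => Set.piecewise_eq_of_notMem _ _ _ hω
      rw [this]
      exact (hcad ω hω s.toNNReal).1.comp continuous_real_toNNReal.continuousWithinAt
        fun u hu => Real.toNNReal_le_toNNReal hu
  · refine (hX.indepIncrements n (fun i => (t i).toNNReal) fun i j hij =>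
      Real.toNNReal_le_toNNReal (ht hij)).congr fun i => ?_
    filter_upwards [hZX] with ω hω
    rw [hω, hω]
  -- The factor 2π in `wave` is absent from `charFun`; by homogeneity of the lower bound it becomes
  -- the constant (2π)^β.
  · have h1 : ∫ ω, wave q (Z σ ω - Z τ ω) ∂P =
        charFun (P.map fun ω => X (τ.toNNReal + (σ - τ).toNNReal) ω - X τ.toNNReal ω)
          ((2 * Real.pi) • q) := by
      rw [charFun_apply, integral_map]
      · refine integral_congr_ae ?_
        filter_upwards [hZX] with ω hω
        rw [hω, hω, ← Real.toNNReal_add hτ (by linarith), add_sub_cancel, wave,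
          real_inner_smul_right, real_inner_comm]
      · exact ((hX.measurable _).sub (hX.measurable _)).aemeasurable
      · exact (by fun_prop : Continuous _).aestronglyMeasurable
    rw [h1, hX.charFun_increment, Complex.norm_real, Real.norm_of_nonneg (Real.exp_pos _).le,
      Real.exp_le_exp, Real.coe_toNNReal _ (by linarith : 0 ≤ σ - τ), neg_mul, neg_le_neg_iff]
    have h2 := hc ((2 * Real.pi) • q)
    rw [norm_smul, Real.norm_of_nonneg (by positivity), Real.mul_rpow (by positivity)
      (norm_nonneg _), ← mul_assoc] at h2
    exact mul_le_mul_of_nonneg_left h2 (by linarith)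

end Version

end StableSelfIntersection

namespace StableSelfIntersection

/-! ### From factorial moments to stretched exponential moments -/

section Exponential

variable {Ω : Type*} [MeasurableSpace Ω] {P : Measure Ω} [IsProbabilityMeasure P]

/-- From the bound 4^k on the central binomial coefficient. Its square root is what the factorials
of the exponential series compensate. -/
lemma factorial_two_mul_le (k : ℕ) : (2 * k).factorial ≤ (2 ^ k * k.factorial) ^ 2 := by
  have h1 := Nat.choose_mul_factorial_mul_factorial (n := 2 * k) (k := k) (by omega)
  have h2 : (2 * k).choose k ≤ 2 ^ (2 * k) := Nat.choose_le_two_pow _ _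
  rw [show 2 * k - k = k by omega] at h1
  calc (2 * k).factorial = (2 * k).choose k * k.factorial * k.factorial := h1.symm
    _ ≤ 2 ^ (2 * k) * k.factorial * k.factorial := by gcongr
    _ = _ := by ring

/-- Factorial growth of the even moments gives a stretched exponential moment. -/
lemma lintegral_exp_rpow_le_two {Y : Ω → ℝ} (hY : AEStronglyMeasurable Y P) {K a : ℝ} (hK : 0 < K)
    (ha : 1 ≤ a) (h : ∀ k : ℕ, 0 < k → eLpNorm Y ((2 * k : ℕ) : ℝ≥0∞) P ≤
      ENNReal.ofReal (K * ((2 * k).factorial : ℝ) ^ (a / (2 * k : ℕ)))) :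
    ∫⁻ ω, ENNReal.ofReal (Real.exp ((4 * K ^ a⁻¹)⁻¹ * |Y ω| ^ a⁻¹)) ∂P ≤ 2 := by
  have ha0 : 0 < a := by linarith
  have hai1 : a⁻¹ ≤ 1 := inv_le_one_of_one_le₀ ha
  -- The moment of order k/a is at most K^(k/a) 2^k k!, so with this θ the k-th term of the
  -- exponential series is at most 2^(−k), and the total is 2.
  set θ : ℝ := (4 * K ^ a⁻¹)⁻¹ with hθ
  have hθ0 : 0 < θ := by positivity
  have hterm : ∀ k : ℕ, ∫⁻ ω, ENNReal.ofReal ((θ * |Y ω| ^ a⁻¹) ^ k / k.factorial) ∂P ≤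
      ENNReal.ofReal ((1 / 2) ^ k) := by
    intro k
    rcases Nat.eq_zero_or_pos k with rfl | hk
    · simp
    have hkR : (0 : ℝ) < k := by exact_mod_cast hk
    have hq : (0 : ℝ) < a⁻¹ * k := by positivity
    set q : ℝ≥0∞ := ENNReal.ofReal (a⁻¹ * k) with hqdef
    have hq0 : q ≠ 0 := by simpa [hqdef] using hq
    have hqr : q.toReal = a⁻¹ * k := ENNReal.toReal_ofReal hq.le
    -- Since a ≥ 1, the order k/a does not exceed 2k, and L^p norms are monotone under a probability
    -- measure.
    have hq2 : q ≤ ((2 * k : ℕ) : ℝ≥0∞) := by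
      rw [hqdef, ← ENNReal.ofReal_natCast]
      refine ENNReal.ofReal_le_ofReal ?_
      push_cast
      nlinarith
    have h1 : ∫⁻ ω, ‖Y ω‖ₑ ^ (a⁻¹ * k) ∂P ≤
        ENNReal.ofReal ((K ^ a⁻¹) ^ k * (2 ^ k * k.factorial)) := by
      have h2 := (eLpNorm_le_eLpNorm_of_exponent_le (μ := P) hq2 hY).trans (h k hk)
      rw [eLpNorm_eq_lintegral_rpow_enorm_toReal hq0 ENNReal.ofReal_ne_top, hqr] at h2
      have h3 := ENNReal.rpow_le_rpow h2 hq.le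
      rw [← ENNReal.rpow_mul, one_div_mul_cancel hq.ne', ENNReal.rpow_one] at h3
      refine h3.trans ?_
      rw [ENNReal.ofReal_rpow_of_nonneg (by positivity) hq.le]
      refine ENNReal.ofReal_le_ofReal ?_
      rw [Real.mul_rpow hK.le (by positivity), Real.rpow_mul_natCast hK.le, ← Real.rpow_mul
        (by positivity), show a / ((2 * k : ℕ) : ℝ) * (a⁻¹ * k) = 1 / 2 by push_cast; field_simp]
      gcongr
      rw [← Real.sqrt_eq_rpow]
      refine Real.sqrt_le_iff.2 ⟨by positivity, ?_⟩
      exact_mod_cast factorial_two_mul_le k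
    have h4 : ∀ ω, ENNReal.ofReal ((θ * |Y ω| ^ a⁻¹) ^ k / k.factorial) =
        ENNReal.ofReal (θ ^ k / k.factorial) * ‖Y ω‖ₑ ^ (a⁻¹ * k) := fun ω => by
      rw [← ofReal_norm, Real.norm_eq_abs, ENNReal.ofReal_rpow_of_nonneg (abs_nonneg _) hq.le,
        ← ENNReal.ofReal_mul (by positivity), Real.rpow_mul_natCast (abs_nonneg _)]
      congr 1
      ring
    simp_rw [h4]
    rw [lintegral_const_mul' _ _ ENNReal.ofReal_ne_top]
    refine (mul_le_mul_right h1 _).trans ?_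
    rw [← ENNReal.ofReal_mul (by positivity)]
    refine ENNReal.ofReal_le_ofReal (le_of_eq ?_)
    have h5 : θ ^ k * (K ^ a⁻¹) ^ k * 2 ^ k = (1 / 2) ^ k := by
      rw [← mul_pow, ← mul_pow, hθ]
      congr 1
      field_simp
      norm_num
    rw [← h5]
    field_simp
  have hexp : ∀ ω, ENNReal.ofReal (Real.exp (θ * |Y ω| ^ a⁻¹)) =
      ∑' k : ℕ, ENNReal.ofReal ((θ * |Y ω| ^ a⁻¹) ^ k / k.factorial) := fun ω => by
    rw [Real.exp_eq_exp_ℝ, NormedSpace.exp_eq_tsum_div,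
      ENNReal.ofReal_tsum_of_nonneg (fun k => by positivity)]
    exact Real.summable_pow_div_factorial _
  simp_rw [hexp]
  rw [lintegral_tsum fun k => ?_]
  · refine (ENNReal.tsum_le_tsum hterm).trans ?_
    rw [← ENNReal.ofReal_tsum_of_nonneg (fun k => by positivity) summable_geometric_two,
      tsum_geometric_two]
    simp
  · have := hY.aemeasurable
    fun_prop

end Exponential

/-! ### Almost sure and L^p convergence from Hölder bounds -/

section Convergence

variable {Ω : Type*} [MeasurableSpace Ω] {P : Measure Ω} [IsProbabilityMeasure P]

/-- A family of random variables that is Hölder continuous in every `L^{2k}` and has small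
oscillation between the points of a polynomial grid converges almost surely and in every
`L^{2k}`. -/
lemma exists_limit_of_holder {γ : ℝ → Ω → ℝ} (hγ : ∀ ε, 0 < ε → Measurable (γ ε)) {ρ a C' : ℝ}
    (hρ : 0 < ρ) (ha : 0 < a) {C : ℕ → ℝ} (hC : ∀ k, 0 ≤ C k)
    (hhol : ∀ k, 0 < k → ∀ ε ε', 0 < ε → 0 < ε' →
      eLpNorm (γ ε - γ ε') ((2 * k : ℕ) : ℝ≥0∞) P ≤ ENNReal.ofReal (C k * |ε - ε'| ^ ρ))
    (hosc : ∀ (n : ℕ) (w : ℝ), 0 < n → n ≤ w → w ≤ n + 1 → ∀ ω,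
      |γ (w ^ (-a)) ω - γ ((n : ℝ) ^ (-a)) ω| ≤ C' / √n) :
    ∃ γ₀ : Ω → ℝ, Measurable γ₀ ∧
      (∀ᵐ ω ∂P, Tendsto (fun ε => γ ε ω) (𝓝[>] 0) (𝓝 (γ₀ ω))) ∧
      ∀ k, 0 < k → ∀ ε, 0 < ε →
        eLpNorm (γ ε - γ₀) ((2 * k : ℕ) : ℝ≥0∞) P ≤ ENNReal.ofReal (C k * ε ^ ρ) := by
  let e : ℕ → ℝ := fun j => (1 / 2) ^ j
  have he : ∀ j, 0 < e j := fun j => by positivity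
  have hconv : ∀ᵐ ω ∂P, ∃ l, Tendsto (fun j => γ (e j) ω) atTop (𝓝 l) := by
    have hr1 : (1 / 2 : ℝ) ^ ρ < 1 := Real.rpow_lt_one (by norm_num) (by norm_num) hρ
    have hr0 : 0 ≤ (1 / 2 : ℝ) ^ ρ := by positivity
    -- The limit is defined along ε = 2^(−j). The constant is `C 1 + 1` because a strict inequality
    -- is required.
    refine Lp.ae_tendsto_of_cauchy_eLpNorm (p := ((2 * 1 : ℕ) : ℝ≥0∞))
      (B := fun N => ENNReal.ofReal ((C 1 + 1) * ((1 / 2 : ℝ) ^ ρ) ^ N))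
      (fun j => (hγ _ (he j)).aestronglyMeasurable) (by norm_num) ?_ fun N n m hn hm => ?_
    · rw [← ENNReal.ofReal_tsum_of_nonneg]
      · exact ENNReal.ofReal_ne_top
      · intro N; have := hC 1; positivity
      · exact (summable_geometric_of_lt_one hr0 hr1).mul_left _
    · refine (hhol 1 one_pos _ _ (he n) (he m)).trans_lt ?_
      have h1 : |e n - e m| ≤ (1 / 2) ^ N := by
        have h2 : e n ≤ (1 / 2) ^ N := pow_le_pow_of_le_one (by norm_num) (by norm_num) hn
        have h3 : e m ≤ (1 / 2) ^ N := pow_le_pow_of_le_one (by norm_num) (by norm_num) hm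
        rw [abs_le]
        constructor <;> linarith [he n, he m]
      have h4 : |e n - e m| ^ ρ ≤ ((1 / 2 : ℝ) ^ ρ) ^ N := by
        refine (Real.rpow_le_rpow (abs_nonneg _) h1 hρ.le).trans_eq ?_
        rw [← Real.rpow_natCast, ← Real.rpow_natCast, ← Real.rpow_mul (by norm_num),
          ← Real.rpow_mul (by norm_num), mul_comm]
      have h5 : 0 < ((1 / 2 : ℝ) ^ ρ) ^ N := by positivity
      have h6 := hC 1
      refine (ENNReal.ofReal_lt_ofReal_iff (by positivity)).2 ?_
      nlinarith
  obtain ⟨γ₀, hγ₀m, hγ₀⟩ := exists_stronglyMeasurable_limit_of_tendsto_ae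
    (fun j => (hγ _ (he j)).aestronglyMeasurable) hconv
  have he0 : Tendsto e atTop (𝓝 0) :=
    tendsto_pow_atTop_nhds_zero_of_lt_one (by norm_num) (by norm_num)
  have hLp : ∀ k, 0 < k → ∀ ε, 0 < ε →
      eLpNorm (γ ε - γ₀) ((2 * k : ℕ) : ℝ≥0∞) P ≤ ENNReal.ofReal (C k * ε ^ ρ) := by
    intro k hk ε hε
    -- Fatou in the second scale: once `e j < ε`, the distance |ε − e j| is at most ε.
    refine (Lp.eLpNorm_lim_le_liminf_eLpNorm (f := fun j => γ ε - γ (e j))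
      (fun j => ((hγ ε hε).sub (hγ _ (he j))).aestronglyMeasurable) (γ ε - γ₀) ?_).trans ?_
    · filter_upwards [hγ₀] with ω hω
      exact tendsto_const_nhds.sub hω
    · refine liminf_le_of_frequently_le' (Eventually.frequently ?_)
      filter_upwards [he0.eventually (gt_mem_nhds hε)] with j hj
      refine (hhol k hk ε (e j) hε (he j)).trans (ENNReal.ofReal_le_ofReal ?_)
      have h1 : |ε - e j| ≤ ε := by
        rw [abs_le]; constructor <;> linarith [he j]
      have := hC k
      gcongr
  refine ⟨γ₀, hγ₀m.measurable, ?_, hLp⟩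
  have hgrid : ∀ᵐ ω ∂P, Tendsto (fun n : ℕ => γ (((n + 1 : ℕ) : ℝ) ^ (-a)) ω) atTop
      (𝓝 (γ₀ ω)) := by
    -- A moment high enough that n^(−2kaρ) is summable; then the sum of the powers of the errors
    -- along the grid n^(−a) is almost surely finite.
    obtain ⟨k, hk⟩ := exists_nat_gt (1 / (a * ρ))
    have hk0 : 0 < k := by
      have : (0 : ℝ) < k := lt_of_le_of_lt (by positivity) hk
      exact_mod_cast this
    have hk1 : 1 < a * ρ * (2 * k : ℕ) := by
      rw [div_lt_iff₀ (by positivity)] at hk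
      push_cast
      have : 0 < a * ρ * k := by positivity
      nlinarith
    have hg0 : ∀ n : ℕ, 0 < ((n + 1 : ℕ) : ℝ) ^ (-a) := fun n => by positivity
    have hsum : ∑' n : ℕ, ∫⁻ ω, ‖γ (((n + 1 : ℕ) : ℝ) ^ (-a)) ω - γ₀ ω‖ₑ ^ (2 * k) ∂P ≠ ∞ := by
      have hle : ∀ n : ℕ, ∫⁻ ω, ‖γ (((n + 1 : ℕ) : ℝ) ^ (-a)) ω - γ₀ ω‖ₑ ^ (2 * k) ∂P ≤
          ENNReal.ofReal (C k ^ (2 * k) * ((n + 1 : ℕ) : ℝ) ^ (-(a * ρ * (2 * k : ℕ)))) := by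
        intro n
        have h1 := hLp k hk0 _ (hg0 n)
        rw [eLpNorm_eq_lintegral_rpow_enorm_toReal (by simpa using hk0.ne')
          (ENNReal.natCast_ne_top _), ENNReal.toReal_natCast] at h1
        have hk2 : ((2 * k : ℕ) : ℝ) ≠ 0 := by positivity
        have h2 := ENNReal.rpow_le_rpow h1 (Nat.cast_nonneg (2 * k))
        rw [← ENNReal.rpow_mul, one_div_mul_cancel hk2, ENNReal.rpow_one] at h2
        simp_rw [ENNReal.rpow_natCast] at h2
        refine h2.trans_eq ?_
        have := hC k
        rw [← ENNReal.ofReal_pow (by positivity), mul_pow, ← Real.rpow_mul (by positivity),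
          ← Real.rpow_mul_natCast (by positivity)]
        congr 3
        ring
      refine ne_top_of_le_ne_top ?_ (ENNReal.tsum_le_tsum hle)
      rw [← ENNReal.ofReal_tsum_of_nonneg]
      · exact ENNReal.ofReal_ne_top
      · intro n; have := hC k; positivity
      · refine Summable.mul_left _ ?_
        exact (summable_nat_add_iff 1).2 (Real.summable_nat_rpow.2 (by linarith))
    have hmeas : ∀ n : ℕ, Measurable fun ω =>
        ‖γ (((n + 1 : ℕ) : ℝ) ^ (-a)) ω - γ₀ ω‖ₑ ^ (2 * k) := fun n =>
      ((hγ _ (hg0 n)).sub hγ₀m.measurable).enorm.pow_const _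
    rw [← lintegral_tsum fun n => (hmeas n).aemeasurable] at hsum
    have hfin := ae_lt_top (Measurable.tsum hmeas) hsum
    filter_upwards [hfin] with ω hω
    have h1 := ENNReal.tendsto_atTop_zero_of_tsum_ne_top hω.ne
    have h2 : Tendsto (fun n : ℕ => ‖γ (((n + 1 : ℕ) : ℝ) ^ (-a)) ω - γ₀ ω‖ₑ) atTop (𝓝 0) := by
      have h3 := (ENNReal.continuous_rpow_const (y := 1 / ((2 * k : ℕ) : ℝ))).tendsto 0 |>.comp h1
      have hk2 : ((2 * k : ℕ) : ℝ) ≠ 0 := by positivity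
      rw [ENNReal.zero_rpow_of_pos (by positivity)] at h3
      refine h3.congr fun n => ?_
      simp only [Function.comp]
      rw [← ENNReal.rpow_natCast, ← ENNReal.rpow_mul, mul_one_div_cancel hk2, ENNReal.rpow_one]
    rw [tendsto_iff_edist_tendsto_0]
    simpa [edist_eq_enorm_sub] using h2
  filter_upwards [hgrid] with ω hω
  let W : ℝ → ℝ := fun ε => ε ^ (-(1 / a))
  have hW : Tendsto W (𝓝[>] 0) atTop := tendsto_rpow_neg_nhdsGT_zero (by
    have : 0 < 1 / a := by positivity
    linarith)
  -- The grid is indexed by n + 1 to avoid zero, so one is subtracted: ν ε + 1 is the floor of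
  -- ε^(−1/a) once that floor is at least 1.
  let ν : ℝ → ℕ := fun ε => ⌊W ε⌋₊ - 1
  have hν : Tendsto ν (𝓝[>] 0) atTop :=
    (tendsto_sub_atTop_nat 1).comp ((tendsto_nat_floor_atTop).comp hW)
  have hmain := hω.comp hν
  have hdiff : Tendsto (fun ε => γ ε ω - γ (((ν ε + 1 : ℕ) : ℝ) ^ (-a)) ω) (𝓝[>] 0) (𝓝 0) := by
    have hzero : Tendsto (fun n : ℕ => C' / √(((n + 1 : ℕ) : ℝ))) atTop (𝓝 0) := by
      refine tendsto_const_nhds.div_atTop ?_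
      exact Real.tendsto_sqrt_atTop.comp
        (tendsto_natCast_atTop_atTop.comp (tendsto_add_atTop_nat 1))
    refine squeeze_zero_norm' ?_ (hzero.comp hν)
    filter_upwards [hW.eventually_ge_atTop 1, self_mem_nhdsWithin] with ε hε1 hε
    have hε0 : (0 : ℝ) < ε := hε
    have hfl : 1 ≤ ⌊W ε⌋₊ := Nat.one_le_floor_iff _ |>.2 hε1
    have hν1 : ν ε + 1 = ⌊W ε⌋₊ := by simp only [ν]; omega
    have hWε : W ε ^ (-a) = ε := by
      simp only [W]
      rw [← Real.rpow_mul hε0.le]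
      rw [show -(1 / a) * -a = 1 by field_simp, Real.rpow_one]
    have := hosc (ν ε + 1) (W ε) (Nat.succ_pos _) (by
      rw [hν1]; exact Nat.floor_le (by linarith)) (by
      rw [hν1]; exact (Nat.lt_floor_add_one _).le) ω
    rw [hWε] at this
    simpa only [Function.comp, Real.norm_eq_abs] using this
  have := hdiff.add hmain
  rw [zero_add] at this
  refine this.congr fun ε => ?_
  simp [Function.comp]

end Convergence

end StableSelfIntersection

namespace StableSelfIntersection

/-! ### The centred triangle integral as a linear functional of the kernel -/

section Centered

variable {Ω : Type*} [MeasurableSpace Ω] {P : Measure Ω} [IsProbabilityMeasure P]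
  {E : Type*} [NormedAddCommGroup E] [InnerProductSpace ℝ E]
  [MeasurableSpace E] [BorelSpace E] [FiniteDimensional ℝ E]
  {g : E → ℝ} {Z : ℝ → Ω → E}

/-- The centered double integral of `h (Z s - Z r)` over the triangle `0 ≤ r ≤ s ≤ t`. -/
noncomputable def centeredTriangle (P : Measure Ω) (Z : ℝ → Ω → E) (h : E → ℝ) (t : ℝ) (ω : Ω) : ℝ :=
  triangle (fun s r => h (Z s ω - Z r ω)) 0 t -
    ∫ ω', triangle (fun s r => h (Z s ω' - Z r ω')) 0 t ∂P

omit [InnerProductSpace ℝ E] [MeasurableSpace E] [BorelSpace E] [FiniteDimensional ℝ E] in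
lemma abs_centeredTriangle_le {h : E → ℝ} {H : ℝ} (hH : ∀ x, |h x| ≤ H) {t : ℝ} (ht : 0 ≤ t)
    (ω : Ω) : |centeredTriangle P Z h t ω| ≤ 2 * (H * t * t) :=
  abs_sub_integral_le (P := P) (f := fun ω => triangle (fun s r => h (Z s ω - Z r ω)) 0 t)
    (fun ω => by simpa using abs_triangle_le (fun s r => hH (Z s ω - Z r ω)) ht) ω

lemma IsRegularProcess.measurable_centeredTriangle (hZ : IsRegularProcess P g Z) {h : E → ℝ}
    (hh : Measurable h) {t : ℝ} (ht : 0 ≤ t) : Measurable (centeredTriangle P Z h t) :=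
  (hZ.measurable_triangle hh ht).sub_const _

lemma IsRegularProcess.centeredTriangle_sub (hZ : IsRegularProcess P g Z) {h h' : E → ℝ}
    (hh : Measurable h) (hh' : Measurable h') {H H' : ℝ} (hH : ∀ x, |h x| ≤ H)
    (hH' : ∀ x, |h' x| ≤ H') {t : ℝ} (ht : 0 ≤ t) (ω : Ω) :
    centeredTriangle P Z (fun x => h x - h' x) t ω =
      centeredTriangle P Z h t ω - centeredTriangle P Z h' t ω := by
  have hm : ∀ {u : E → ℝ}, Measurable u → ∀ ω,
      Measurable (Function.uncurry fun s r => u (Z s ω - Z r ω)) := fun hu ω => by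
    have hZω : Measurable fun s => Z s ω := hZ.measurable_uncurry.comp measurable_prodMk_right
    exact hu.comp ((hZω.comp measurable_fst).sub (hZω.comp measurable_snd))
  have hsub : ∀ ω, triangle (fun s r => h (Z s ω - Z r ω) - h' (Z s ω - Z r ω)) 0 t =
      triangle (fun s r => h (Z s ω - Z r ω)) 0 t -
        triangle (fun s r => h' (Z s ω - Z r ω)) 0 t := fun ω =>
    triangle_sub (hm hh ω) (hm hh' ω) (fun s r => hH _) (fun s r => hH' _) ht
  simp only [centeredTriangle, hsub]
  rw [integral_sub
    (integrable_of_forall_abs_le (hZ.measurable_triangle hh ht)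
      fun ω => abs_triangle_le (fun s r => hH (Z s ω - Z r ω)) ht)
    (integrable_of_forall_abs_le (hZ.measurable_triangle hh' ht)
      fun ω => abs_triangle_le (fun s r => hH' (Z s ω - Z r ω)) ht)]
  ring

end Centered

/-! ### Assembly for the stable process -/

section Stable

variable {Ω : Type*} [MeasurableSpace Ω] {P : Measure Ω} [IsProbabilityMeasure P] {d : ℕ}
  {X : ℝ≥0 → Ω → EuclideanSpace ℝ (Fin d)} {Z : ℝ → Ω → EuclideanSpace ℝ (Fin d)}
  {g : EuclideanSpace ℝ (Fin d) → ℝ}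

/-- One null set serves all `t` and `ε` simultaneously, as needed for limits along the continuous
parameter ε. -/
lemma ae_gammaReg_eq_centeredTriangle (hXZ : ∀ᵐ ω ∂P, ∀ s : ℝ, Z s ω = X s.toNNReal ω)
    (f : EuclideanSpace ℝ (Fin d) → ℝ) :
    ∀ᵐ ω ∂P, ∀ t ε, gammaReg f X P t ε ω = centeredTriangle P Z (rescale f ε) t ω := by
  have h : ∀ᵐ ω ∂P, ∀ t ε, selfIntersection f X t ε ω =
      triangle (fun s r => rescale f ε (Z s ω - Z r ω)) 0 t := by
    filter_upwards [hXZ] with ω hω t ε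
    simp only [selfIntersection, triangle, hω]
  filter_upwards [h] with ω hω t ε
  rw [gammaReg, centeredTriangle, hω, integral_congr_ae (h.mono fun ω' hω' => hω' t ε)]

/-- Joint Hölder bound, in `ε` and in every even moment, for the centered regularized
self-intersection local time. -/
lemma exists_eLpNorm_centeredTriangle_rescale_sub_le (f : 𝓢(EuclideanSpace ℝ (Fin d), ℝ))
    {c β ρ : ℝ} (hc : 0 < c) (hβ : 0 < β) (hβd : β ≤ d) (hρ : 0 < ρ) (hρ1 : ρ ≤ 1)
    (hρ2 : ρ < β - d / 2) (hρ3 : ρ < 3 * β / 2 - d)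
    (hZ : IsRegularProcess P (fun q => c * ‖q‖ ^ β) Z) :
    ∃ K : ℝ, 0 < K ∧ ∀ ε ε' t : ℝ, 0 < ε → 0 < ε' → 0 < t → ∀ k : ℕ, 0 < k →
      eLpNorm (fun ω => centeredTriangle P Z (rescale f ε) t ω -
          centeredTriangle P Z (rescale f ε') t ω) ((2 * k : ℕ) : ℝ≥0∞) P ≤
        ENNReal.ofReal (K * |ε - ε'| ^ ρ * t ^ (2 - (d + ρ) / β) *
          ((2 * k).factorial : ℝ) ^ ((d + ρ) / β / (2 * k : ℕ))) := by
  obtain ⟨B, hB, hG⟩ := exists_rescale_sub_amplitude f hρ hρ1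
  have hfin : (Module.finrank ℝ (EuclideanSpace ℝ (Fin d)) : ℝ) = d := by simp
  -- In order: `hρ2` makes the momentum integral finite, β ≤ d gives a ≥ 1, and `hρ3` gives a < 3/2.
  obtain ⟨K, hK, hmom⟩ := exists_eLpNorm_triangle_le (P := P) (E := EuclideanSpace ℝ (Fin d))
    hc hβ hρ (by rw [hfin]; linarith) (by rw [hfin, le_div_iff₀ hβ]; linarith)
    (by rw [hfin, div_lt_iff₀ hβ]; linarith)
  rw [hfin] at hmom
  refine ⟨K * B, by positivity, fun ε ε' t hε hε' ht k hk => ?_⟩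
  rcases eq_or_ne ε ε' with rfl | hne
  · simp
  have habs : 0 < |ε - ε'| := abs_pos.2 (sub_ne_zero.2 hne)
  obtain ⟨G, hGi, hGf, hGB⟩ := hG ε ε' hε hε'
  obtain ⟨H, hH⟩ := exists_abs_rescale_le f hε
  obtain ⟨H', hH'⟩ := exists_abs_rescale_le f hε'
  have h := hmom _ Z hZ (fun _ => rfl) (fun x => rescale f ε x - rescale f ε' x) G
    ((measurable_rescale f ε).sub (measurable_rescale f ε'))
    ⟨H + H', fun x => (abs_sub _ _).trans (add_le_add (hH x) (hH' x))⟩ hGi hGf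
    (B * |ε - ε'| ^ ρ) (by positivity) hGB t ht k hk
  refine le_trans (le_of_eq ?_) (h.trans (le_of_eq ?_))
  · congr 1
    funext ω
    exact (hZ.centeredTriangle_sub (measurable_rescale f ε) (measurable_rescale f ε') hH hH' ht.le
      ω).symm
  · congr 1
    ring

/-- The stretched exponential moment of the normalized increments is bounded by `2`. -/
lemma exists_lintegral_exp_gammaReg_sub_le (f : 𝓢(EuclideanSpace ℝ (Fin d), ℝ))
    {c β ρ : ℝ} (hc : 0 < c) (hβ : 0 < β) (hβd : β ≤ d) (hρ : 0 < ρ) (hρ1 : ρ ≤ 1)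
    (hρ2 : ρ < β - d / 2) (hρ3 : ρ < 3 * β / 2 - d)
    (hZ : IsRegularProcess P (fun q => c * ‖q‖ ^ β) Z)
    (hXZ : ∀ᵐ ω ∂P, ∀ s : ℝ, Z s ω = X s.toNNReal ω) :
    ∃ θ : ℝ, 0 < θ ∧ ∀ ε ε' t : ℝ, 0 < ε → 0 < ε' → ε ≠ ε' → 0 < t →
      ∫⁻ ω, ENNReal.ofReal (Real.exp (θ *
        |(gammaReg f X P t ε ω - gammaReg f X P t ε' ω) /
          (|ε - ε'| ^ ρ * t ^ (2 - (d + ρ) / β))| ^ (β / (d + ρ)))) ∂P ≤ 2 := by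
  obtain ⟨K, hK, hmom⟩ :=
    exists_eLpNorm_centeredTriangle_rescale_sub_le f hc hβ hβd hρ hρ1 hρ2 hρ3 hZ
  have ha : 1 ≤ (d + ρ) / β := by rw [le_div_iff₀ hβ]; linarith
  refine ⟨(4 * K ^ ((d + ρ) / β)⁻¹)⁻¹, by positivity, fun ε ε' t hε hε' hne ht => ?_⟩
  have habs : 0 < |ε - ε'| := abs_pos.2 (sub_ne_zero.2 hne)
  set N : ℝ := |ε - ε'| ^ ρ * t ^ (2 - (d + ρ) / β) with hN
  have hN0 : 0 < N := by positivity
  have hY : Measurable fun ω => N⁻¹ * (centeredTriangle P Z (rescale f ε) t ω -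
      centeredTriangle P Z (rescale f ε') t ω) :=
    ((hZ.measurable_centeredTriangle (measurable_rescale f ε) ht.le).sub
      (hZ.measurable_centeredTriangle (measurable_rescale f ε') ht.le)).const_mul _
  have hexp := lintegral_exp_rpow_le_two hY.aestronglyMeasurable (P := P) hK ha fun k hk => by
    have h := eLpNorm_const_smul (N⁻¹) (fun ω => centeredTriangle P Z (rescale f ε) t ω -
      centeredTriangle P Z (rescale f ε') t ω) ((2 * k : ℕ) : ℝ≥0∞) P
    refine (le_of_eq h).trans ?_
    rw [Real.enorm_eq_ofReal (by positivity)]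
    refine (mul_le_mul_right (hmom ε ε' t hε hε' ht k hk) _).trans (le_of_eq ?_)
    rw [← ENNReal.ofReal_mul (by positivity)]
    congr 1
    rw [mul_assoc K, ← hN]
    field_simp
  refine le_trans (le_of_eq (lintegral_congr_ae ?_)) hexp
  filter_upwards [ae_gammaReg_eq_centeredTriangle hXZ f] with ω hω
  simp only [hω, inv_div, div_eq_inv_mul (_ - _ : ℝ) N]

lemma gammaReg_zero (f : EuclideanSpace ℝ (Fin d) → ℝ) (ε : ℝ) : gammaReg f X P 0 ε = 0 := by
  ext ω
  simp [gammaReg, selfIntersection]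

/-- Convergence of the centered regularized self-intersection local times, almost surely and in
every `L^p` with `p < ∞`. -/
lemma exists_limit_gammaReg (hd : 0 < d) (f : 𝓢(EuclideanSpace ℝ (Fin d), ℝ))
    {c β ρ : ℝ} (hc : 0 < c) (hβ : 0 < β) (hβd : β ≤ d) (hρ : 0 < ρ) (hρ1 : ρ ≤ 1)
    (hρ2 : ρ < β - d / 2) (hρ3 : ρ < 3 * β / 2 - d)
    (hZ : IsRegularProcess P (fun q => c * ‖q‖ ^ β) Z)
    (hXZ : ∀ᵐ ω ∂P, ∀ s : ℝ, Z s ω = X s.toNNReal ω) {t : ℝ} (ht : 0 ≤ t) :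
    ∃ γ : Ω → ℝ, (∀ᵐ ω ∂P, Tendsto (fun ε => gammaReg f X P t ε ω) (𝓝[>] 0) (𝓝 (γ ω))) ∧
      ∀ p : ℝ≥0∞, p ≠ ∞ → MemLp γ p P ∧ (∀ ε, 0 < ε → MemLp (gammaReg f X P t ε) p P) ∧
        Tendsto (fun ε => eLpNorm (fun ω => gammaReg f X P t ε ω - γ ω) p P) (𝓝[>] 0) (𝓝 0) := by
  rcases ht.eq_or_lt with rfl | ht
  · exact ⟨0, by simp [gammaReg_zero]⟩
  obtain ⟨K, hK, hmom⟩ :=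
    exists_eLpNorm_centeredTriangle_rescale_sub_le f hc hβ hβd hρ hρ1 hρ2 hρ3 hZ
  obtain ⟨C, hC, hosc⟩ := exists_abs_rescale_sub_le hd f
  have hdR : (0 : ℝ) < d := by exact_mod_cast hd
  have hae := ae_gammaReg_eq_centeredTriangle hXZ f
  have hmeas : ∀ ε, Measurable (centeredTriangle P Z (rescale f ε) t) := fun ε =>
    hZ.measurable_centeredTriangle (measurable_rescale f ε) ht.le
  let C₁ : ℕ → ℝ := fun k => K * t ^ (2 - (d + ρ) / β) *
    ((2 * k).factorial : ℝ) ^ ((d + ρ) / β / (2 * k : ℕ))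
  obtain ⟨γ, hγm, hγlim, hγL⟩ := exists_limit_of_holder (P := P)
    (γ := fun ε => centeredTriangle P Z (rescale f ε) t) (ρ := ρ) (a := 1 / (2 * d : ℝ))
    (C' := 2 * (C * t * t)) (C := C₁) (fun ε _ => hmeas ε) hρ (by positivity)
    (fun k => by positivity)
    (fun k hk ε ε' hε hε' => (hmom ε ε' t hε hε' ht k hk).trans (le_of_eq (by
      congr 1
      ring)))
    (fun n w hn hnw hwn ω => by
      have hnR : (0 : ℝ) < n := by exact_mod_cast hn
      obtain ⟨H, hH⟩ := exists_abs_rescale_le f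
        (Real.rpow_pos_of_pos (hnR.trans_le hnw) (-(1 / (2 * d : ℝ))))
      obtain ⟨H', hH'⟩ := exists_abs_rescale_le f (Real.rpow_pos_of_pos hnR (-(1 / (2 * d : ℝ))))
      rw [← hZ.centeredTriangle_sub (measurable_rescale f _) (measurable_rescale f _) hH hH' ht.le]
      refine (abs_centeredTriangle_le (hosc n w hn hnw hwn) ht.le ω).trans (le_of_eq ?_)
      ring)
  have hmem : ∀ (p : ℝ≥0∞) ε, 0 < ε → MemLp (centeredTriangle P Z (rescale f ε) t) p P :=
    fun p ε hε => by
      obtain ⟨H, hH⟩ := exists_abs_rescale_le f hε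
      exact ⟨(hmeas ε).aestronglyMeasurable, (eLpNorm_le_of_forall_abs_le
        (abs_centeredTriangle_le hH ht.le) p).trans_lt ENNReal.ofReal_lt_top⟩
  have hle : ∀ p : ℝ≥0∞, p ≠ ∞ → ∃ A : ℝ, ∀ ε, 0 < ε →
      eLpNorm (centeredTriangle P Z (rescale f ε) t - γ) p P ≤ ENNReal.ofReal (A * ε ^ ρ) := by
    intro p hp
    obtain ⟨k, hk⟩ := ENNReal.exists_nat_gt hp
    refine ⟨C₁ (k + 1), fun ε hε => (eLpNorm_le_eLpNorm_of_exponent_le ?_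
      ((hmeas ε).sub hγm).aestronglyMeasurable).trans (hγL (k + 1) k.succ_pos ε hε)⟩
    exact hk.le.trans (by exact_mod_cast (by omega : k ≤ 2 * (k + 1)))
  refine ⟨γ, ?_, fun p hp => ⟨?_, fun ε hε => ?_, ?_⟩⟩
  · filter_upwards [hγlim, hae] with ω h1 h2
    simpa only [h2] using h1
  · obtain ⟨A, hA⟩ := hle p hp
    have h1 : MemLp (centeredTriangle P Z (rescale f 1) t - γ) p P :=
      ⟨((hmeas 1).sub hγm).aestronglyMeasurable, (hA 1 one_pos).trans_lt ENNReal.ofReal_lt_top⟩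
    simpa using (hmem p 1 one_pos).sub h1
  · exact (memLp_congr_ae (hae.mono fun ω hω => hω t ε)).2 (hmem p ε hε)
  · obtain ⟨A, hA⟩ := hle p hp
    have hlim : Tendsto (fun ε : ℝ => ENNReal.ofReal (A * ε ^ ρ)) (𝓝[>] 0) (𝓝 0) := by
      have h0 : Tendsto (fun ε : ℝ => A * ε ^ ρ) (𝓝 0) (𝓝 (A * 0 ^ ρ)) :=
        ((Real.continuous_rpow_const hρ.le).tendsto 0).const_mul A
      rw [Real.zero_rpow hρ.ne', mul_zero] at h0
      simpa using ENNReal.tendsto_ofReal (h0.mono_left nhdsWithin_le_nhds)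
    refine tendsto_of_tendsto_of_tendsto_of_le_of_le' tendsto_const_nhds hlim
      (Eventually.of_forall fun _ => zero_le) ?_
    filter_upwards [self_mem_nhdsWithin] with ε hε
    refine le_trans (le_of_eq (eLpNorm_congr_ae ?_)) (hA ε hε)
    filter_upwards [hae] with ω hω
    simp [hω]

end Stable

end StableSelfIntersection

theorem theorem7 {Ω : Type*} [MeasurableSpace Ω] (P : Measure Ω) [IsProbabilityMeasure P]
    (d : ℕ) (β : ℝ) (hβ : 2 * (d : ℝ) / 3 < β) (hβd : β ≤ d)
    (ψ : EuclideanSpace ℝ (Fin d) → ℝ)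
    (hψ : StableSelfIntersection.IsSymmetricStableExponent β ψ)
    (X : ℝ≥0 → Ω → EuclideanSpace ℝ (Fin d))
    (hX : StableSelfIntersection.IsLevyProcessWithExponent ψ X P)
    (f : 𝓢(EuclideanSpace ℝ (Fin d), ℝ)) (hf : StableSelfIntersection.IsMollifier f) :
    (∃ ρ₀ : ℝ, 0 < ρ₀ ∧ ∀ ρ : ℝ, 0 < ρ → ρ < ρ₀ → ∃ θ : ℝ, 0 < θ ∧ ∃ C : ℝ≥0,
      ∀ ε ε' t : ℝ, 0 < ε → 0 < ε' → ε ≠ ε' → 0 < t →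
        ∫⁻ ω, ENNReal.ofReal (Real.exp (θ *
          |(StableSelfIntersection.gammaReg f X P t ε ω
              - StableSelfIntersection.gammaReg f X P t ε' ω)
            / (|ε - ε'| ^ ρ * t ^ (2 - (d + ρ) / β))| ^ (β / (d + ρ)))) ∂P ≤ C) ∧
    (∃ γ : ℝ → Ω → ℝ, ∀ t : ℝ, 0 ≤ t →
      (∀ᵐ ω ∂P, Tendsto (fun ε : ℝ => StableSelfIntersection.gammaReg f X P t ε ω)
        (𝓝[>] 0) (𝓝 (γ t ω))) ∧
      ∀ p : ℝ≥0∞, 1 ≤ p → p ≠ ∞ →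
        MemLp (γ t) p P ∧
        (∀ ε : ℝ, 0 < ε → MemLp (StableSelfIntersection.gammaReg f X P t ε) p P) ∧
        Tendsto (fun ε : ℝ =>
            eLpNorm (fun ω => StableSelfIntersection.gammaReg f X P t ε ω - γ t ω) p P)
          (𝓝[>] 0) (𝓝 0)) := by
  obtain ⟨c, C, hc, -, hcψ⟩ := hψ.comparable
  have hβ0 : 0 < β := lt_of_le_of_lt (by positivity) hβ
  have hdR : (0 : ℝ) < d := hβ0.trans_le hβd
  have hd : 0 < d := by exact_mod_cast hdR
  obtain ⟨Z, hZ, hXZ⟩ :=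
    StableSelfIntersection.exists_isRegularProcess (fun p => (hcψ p).1) hX
  have hc' : 0 < c * (2 * Real.pi) ^ β := by positivity
  -- The three constraints come from Hölder interpolation, the momentum integral and the dyadic
  -- series. The last two bounds are positive because β > 2d/3 and d > 0.
  set ρ₀ : ℝ := min 1 (min (β - d / 2) (3 * β / 2 - d)) with hρ₀
  have hρ₀0 : 0 < ρ₀ := lt_min one_pos (lt_min (by linarith) (by linarith))
  have hρ₀1 : ρ₀ ≤ 1 := min_le_left _ _
  have hρ₀2 : ρ₀ ≤ β - d / 2 := (min_le_right _ _).trans (min_le_left _ _)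
  have hρ₀3 : ρ₀ ≤ 3 * β / 2 - d := (min_le_right _ _).trans (min_le_right _ _)
  refine ⟨⟨ρ₀, hρ₀0, fun ρ hρ hρlt => ?_⟩, ?_⟩
  · obtain ⟨θ, hθ, h⟩ := StableSelfIntersection.exists_lintegral_exp_gammaReg_sub_le f hc' hβ0 hβd
      hρ (by linarith) (by linarith) (by linarith) hZ hXZ
    exact ⟨θ, hθ, 2, h⟩
  -- Convergence needs just one admissible exponent; ρ₀/2 is taken.
  · choose! γ hγ using fun t (ht : 0 ≤ t) => StableSelfIntersection.exists_limit_gammaReg (t := t)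
      hd f hc' hβ0 hβd (half_pos hρ₀0) (by linarith) (by linarith) (by linarith) hZ hXZ ht
    exact ⟨γ, fun t ht => ⟨(hγ t ht).1, fun p _ hp => (hγ t ht).2 p hp⟩⟩
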